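/- **Setting.** In a procurement game there are $m$ sellers; seller $i$ can provide up to $n_i$ units of item $i$ at a private cost $c_i\ge 0$ per unit; $n=\sum_i n_i$. The buyer has a budget $B>0$ and a valuation $V\ge 0$ on allocations $A=(a_1,\dots,a_m)$, $0\le a_i\le n_i$, with $V(0,\dots,0)=0$ and $V$ monotone. A deterministic mechanism maps reported costs to an allocation and non-negative payments $P_i$; seller $i$'s utility is $P_i-a_ic_i$. It is dominant-strategy truthful if reporting $c_i$ is always optimal for $i$, whatever the others report, and individually rational if truthful sellers have non-negative utility. A randomized mechanism is *universally truthful* (*individually rational*) if it is a distribution over deterministic mechanisms that are dominant-strategy truthful (individually rational), and *budget-feasible* if its expected total payment under the true costs is at most $B$. $V$ is *sub-additive* if $V(A\vee A')\le V(A)+V(A')$, *sub-modular* if $V(A\vee A')+V(A\wedge A')\le V(A)+V(A')$ (item-wise max and min), *diminishing-return* if $V(A+e_j)-V(A)\ge V(A'+e_j)-V(A')$ whenever $A\le A'$ (where $A+e_j=A$ if $a_j=n_j$), and *additive* if $V(A)=\sum_i\sum_{k\le a_i}v_{ik}$ for some numbers $v_{ik}$. A *demand oracle* takes a set of players, numbers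 of units $u_i\le n_i$ and prices $p_i\ge0$, and returns (consistently) an allocation maximizing $V(A)-\sum_i a_ip_i$ over the allocations with $a_i\le u_i$ that only use players of the set. Below, $\min\{n_i,\lfloor B/c_i\rfloor\}$ means $n_i$ if $c_i=0$, "$\log$" is base 2, and ties between players are broken lexicographically. **Algorithm $A_{Max}$** (players $T$, costs $c_i$ for $i\in T$). Return the empty allocation if $T=\emptyset$. Otherwise let $n_i'=\min\{n_i,\lfloor B/c_i\rfloor\}$ and $v^*=\max_{i\in T}V(n'_ie_i)$. For $v=|T|v^*,\dots,2v^*,v^*$ let $S$ be the answer of the demand oracle for players $T$, units $n_i'$ and prices $\frac{v}{2B}c_i$; if $V(S)<v/2$ let $S_v$ be the empty allocation; otherwise list the players of $T$ by decreasing $s_ic_i$ and let $S_v$ be $S$ restricted to the longest prefix of this list of total cost at most $B$. Return the first $S_v$ of maximum value. **Mechanism $M_{Rand}$.** Put each player independently with probability $1/2$ into $T$; let $T'$ be the other players. Let $v$ be the value of the output of $A_{Max}$ on $T$ with the reported costs. For $k=1,\dots,\sum_{i\in T'}n_i$: let $X$ be the output of $A_{Max}$ on $T_k=\{i\in T': c_i\le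 B/k\}$ with all costs equal to $B/k$; if $V(X)\ge\frac{\log\log n}{64\log n}\,v$, output $X$, pay $x_iB/k$ to each $i$, and stop. If no round stops, buy and pay nothing. (For $n\le 2$ the threshold factor is read as $0$.) **Mechanism $M_{One}$.** With probability $\frac1{1+\ln n}$ do the following, otherwise buy and pay nothing. Let $\lambda_i=\min\{n_i,\lfloor B/c_i\rfloor\}$, let $i$ be the first player when players are listed by decreasing $V(\lambda_ie_i)$, and $\lambda=\lambda_i$. Let $k\in\{1,\dots,\lambda\}$ be smallest such that $i$ would still be first with cost $B/k$. Buy $\lambda$ units from $i$ and pay him $\sum_{\ell\le\lambda}\theta_\ell$, where $\theta_\ell=B/k$ for $\ell\le k$ and $\theta_\ell=B/\ell$ for $\ell>k$. **Mechanism $M_{Sub}$.** Run $M_{Rand}$ with probability $1/2$ and $M_{One}$ with probability $1/2$. **Theorem.** For every procurement game with a sub-additive valuation and every demand oracle for it, $M_{Sub}$ is universally truthful, individually rational and budget-feasible. There is an absolute constant $C>0$ such that, for every such game with $n\ge 3$ and every true cost profile, the expected value of the allocation chosen by $M_{Sub}$ is at least $$V(A^*)\Big/\Big(C\,\frac{(\log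 n)^2}{\log\log n}\Big),$$ where $A^*$ maximizes $V(A)$ subject to $\sum_i c_ia_i\le B$; that is, $M_{Sub}$ is an $O\big(\frac{(\log n)^2}{\log\log n}\big)$-approximation. The same holds for diminishing-return, sub-modular and additive valuations. Moreover $M_{Sub}$ runs in polynomial time given a demand oracle: one fixed program of a randomized real random-access machine (unit-cost real arithmetic, comparisons and $\ln$; additive arithmetic on natural numbers; coins of a computed bias; queries to the demand oracle and to the value oracle, which returns $V(A)$ for given $A$, at cost $m+1$ each) produces on every such game exactly the outcome distribution of $M_{Sub}$ and always stops within a number of steps polynomial in $m+n$. -/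

import Mathlib

open scoped BigOperators

noncomputable section

namespace Procurement

/-! ## Procurement games -/

/-- The public data of a procurement game with `m` sellers: the number of units of every seller,
the budget, and the buyer's valuation.  Only the values of `val` on allocations `A ≤ units` are
part of the game; no condition is ever imposed elsewhere. -/
structure Game (m : ℕ) where
  units : Fin m → ℕ
  budget : ℝ
  val : (Fin m → ℕ) → ℝ

/-- An outcome: how many units are bought from every seller, and what every seller is paid. -/
structure Outcome (m : ℕ) where
  alloc : Fin m → ℕ
  pay : Fin m → ℝ

/-- A deterministic revealing mechanism maps a profile of reported unit costs to an outcome. -/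
abbrev DetMechanism (m : ℕ) := (Fin m → ℝ) → Outcome m

/-- A randomized mechanism is a probability distribution over deterministic mechanisms. -/
abbrev RandMechanism (m : ℕ) := PMF (DetMechanism m)

variable {m : ℕ}

namespace Game

/-- The total number `n` of units of all items. -/
def total (G : Game m) : ℕ := ∑ i, G.units i

/-- Allocations of the game. -/
def IsAlloc (G : Game m) (A : Fin m → ℕ) : Prop := ∀ i, A i ≤ G.units i

/-- The standing assumptions: positive budget, and a normalized, non-negative, monotone
valuation. -/
structure Proper (G : Game m) : Prop where
  budget_pos : 0 < G.budget
  val_zero : G.val 0 = 0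
  val_nonneg : ∀ A, G.IsAlloc A → 0 ≤ G.val A
  val_mono : ∀ A A', G.IsAlloc A → G.IsAlloc A' → (∀ i, A i ≤ A' i) → G.val A ≤ G.val A'

/-- Sub-additivity with respect to the item-wise maximum. -/
def SubAdditive (G : Game m) : Prop :=
  ∀ A A', G.IsAlloc A → G.IsAlloc A' →
    G.val (fun i => max (A i) (A' i)) ≤ G.val A + G.val A'

/-- Sub-modularity with respect to the item-wise maximum and minimum. -/
def SubModular (G : Game m) : Prop :=
  ∀ A A', G.IsAlloc A → G.IsAlloc A' →
    G.val (fun i => max (A i) (A' i)) + G.val (fun i => min (A i) (A' i)) ≤ G.val A + G.val A'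

/-- `A + e_j`: one more unit of item `j`, unless all its units are already taken. -/
def addUnit (G : Game m) (A : Fin m → ℕ) (j : Fin m) : Fin m → ℕ :=
  if A j < G.units j then Function.update A j (A j + 1) else A

/-- Diminishing return. -/
def DiminishingReturn (G : Game m) : Prop :=
  ∀ A A', G.IsAlloc A → G.IsAlloc A' → (∀ i, A i ≤ A' i) → ∀ j,
    G.val (G.addUnit A' j) - G.val A' ≤ G.val (G.addUnit A j) - G.val A

/-- Additivity: `w i k` is the value of the `(k+1)`-st unit of item `i`. -/
def Additive (G : Game m) : Prop :=
  ∃ w : Fin m → ℕ → ℝ, ∀ A, G.IsAlloc A →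
    G.val A = ∑ i, ∑ k ∈ Finset.range (A i), w i k

/-- `A` is an optimal allocation for the unit costs `c`: it maximizes the value among the
allocations whose total cost is within the budget. -/
def IsOptimal (G : Game m) (c : Fin m → ℝ) (A : Fin m → ℕ) : Prop :=
  G.IsAlloc A ∧ ∑ i, c i * A i ≤ G.budget ∧
    ∀ A', G.IsAlloc A' → ∑ i, c i * A' i ≤ G.budget → G.val A' ≤ G.val A

end Game

/-! ## Solution concepts -/

/-- The utility of player `i`, whose unit cost is `ci`, at an outcome. -/
def utility (i : Fin m) (ci : ℝ) (ω : Outcome m) : ℝ := ω.pay i - ω.alloc i * ci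

/-- Every outcome consists of an allocation of the game and non-negative payments. -/
def DetMechanism.WellFormed (G : Game m) (M : DetMechanism m) : Prop :=
  ∀ c : Fin m → ℝ, (∀ j, 0 ≤ c j) → G.IsAlloc (M c).alloc ∧ ∀ i, 0 ≤ (M c).pay i

/-- Dominant-strategy truthful: whatever the others report (the entries of `c` other than `i`),
reporting the true cost `c i` is at least as good for player `i` as reporting any `b`. -/
def DetMechanism.Truthful (M : DetMechanism m) : Prop :=
  ∀ c : Fin m → ℝ, (∀ j, 0 ≤ c j) → ∀ i, ∀ b : ℝ, 0 ≤ b →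
    utility i (c i) (M (Function.update c i b)) ≤ utility i (c i) (M c)

/-- Individual rationality. -/
def DetMechanism.IndividuallyRational (M : DetMechanism m) : Prop :=
  ∀ c : Fin m → ℝ, (∀ j, 0 ≤ c j) → ∀ i, 0 ≤ utility i (c i) (M c)

/-- Universally truthful: a distribution over dominant-strategy truthful mechanisms. -/
def RandMechanism.UniversallyTruthful (μ : RandMechanism m) : Prop :=
  ∀ M ∈ μ.support, DetMechanism.Truthful M

/-- Individually rational: a distribution over individually rational mechanisms. -/
def RandMechanism.IndividuallyRational (μ : RandMechanism m) : Prop :=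
  ∀ M ∈ μ.support, DetMechanism.IndividuallyRational M

/-- All outcomes that can arise are outcomes of the game. -/
def RandMechanism.WellFormed (G : Game m) (μ : RandMechanism m) : Prop :=
  ∀ M ∈ μ.support, DetMechanism.WellFormed G M

/-- Budget-feasible (in expectation): the expected total payment is at most the budget. -/
def RandMechanism.BudgetFeasible (G : Game m) (μ : RandMechanism m) : Prop :=
  ∀ c : Fin m → ℝ, (∀ j, 0 ≤ c j) →
    ∑' M : DetMechanism m, μ M * ENNReal.ofReal (∑ i, (M c).pay i) ≤ ENNReal.ofReal G.budget

/-- The expected value of the outcome under the true costs is at least a `1 / f` fraction of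
the value of an optimal allocation. -/
def RandMechanism.Approximates (G : Game m) (μ : RandMechanism m) (f : ℝ) : Prop :=
  ∀ c : Fin m → ℝ, (∀ j, 0 ≤ c j) → ∀ A, G.IsOptimal c A →
    ENNReal.ofReal (G.val A / f) ≤
      ∑' M : DetMechanism m, μ M * ENNReal.ofReal (G.val (M c).alloc)

/-! ## Demand oracles -/

/-- The interface of a demand oracle: from a set of players, a profile of numbers of units and a
profile of unit prices it returns an allocation (always the same one for the same query). -/
abbrev DemandFn (m : ℕ) := Finset (Fin m) → (Fin m → ℕ) → (Fin m → ℝ) → Fin m → ℕ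

/-- `A` takes at most `u i` units from every `i` in `S`, and nothing from other players. -/
def Fits (S : Finset (Fin m)) (u A : Fin m → ℕ) : Prop :=
  ∀ i, A i ≤ u i ∧ (i ∉ S → A i = 0)

/-- `D` answers every query by an allocation that maximizes value minus price. -/
def IsDemandOracle (G : Game m) (D : DemandFn m) : Prop :=
  ∀ (S : Finset (Fin m)) (u : Fin m → ℕ) (p : Fin m → ℝ),
    G.IsAlloc u → (∀ i, 0 ≤ p i) →
      Fits S u (D S u p) ∧ ∀ A, Fits S u A →
        G.val A - ∑ i, A i * p i ≤ G.val (D S u p) - ∑ i, D S u p i * p i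

/-! ## The algorithm `A_Max` -/

open Classical in
/-- `min {N, ⌊B / c⌋}` (which is `N` when `c = 0`): the largest number `a ≤ N` of units that cost
at most `B`. -/
def affordable (B : ℝ) (N : ℕ) (c : ℝ) : ℕ := Nat.findGreatest (fun a => (a : ℝ) * c ≤ B) N

/-- The allocation `a e_i`: `a` units of item `i` and nothing else. -/
def single (i : Fin m) (a : ℕ) : Fin m → ℕ := Pi.single i a

/-- `i` does not come after `j` when players are listed by decreasing `key`, ties being broken
in favour of the smaller index. -/
def RankLE (key : Fin m → ℝ) (i j : Fin m) : Prop := key j < key i ∨ (key i = key j ∧ i ≤ j)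

open Classical in
/-- The affordable number of units `n'_i` for the players in `T`, and `0` outside `T`. -/
def maxUnits (G : Game m) (T : Finset (Fin m)) (c : Fin m → ℝ) : Fin m → ℕ :=
  fun i => if i ∈ T then affordable G.budget (G.units i) (c i) else 0

/-- `v*`, the largest value of `n'_i e_i` over `i ∈ T` (these values are non-negative). -/
def maxSingle (G : Game m) (T : Finset (Fin m)) (c : Fin m → ℝ) : ℝ :=
  T.fold max 0 (fun i => G.val (single i (maxUnits G T c i)))

open Classical in
/-- The answer `S` of the demand oracle at the guess `v`, with prices `(v / 2B) c_i`.  Nothing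
about players outside `T` is passed to the oracle. -/
def guessDemand (G : Game m) (D : DemandFn m) (T : Finset (Fin m)) (c : Fin m → ℝ) (v : ℝ) :
    Fin m → ℕ :=
  D T (maxUnits G T c) (fun i => if i ∈ T then v / (2 * G.budget) * c i else 0)

open Classical in
/-- The longest affordable prefix of the allocation `S` when the players of `T` are listed by
decreasing `s_i c_i`, ties broken lexicographically: as these costs are non-negative, player `i`
belongs to it exactly when the players listed up to and including `i` cost at most the budget. -/
def affordablePrefix (G : Game m) (T : Finset (Fin m)) (c : Fin m → ℝ) (S : Fin m → ℕ) :
    Fin m → ℕ :=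
  fun i =>
    if i ∈ T ∧
        ∑ l ∈ T.filter (fun l => RankLE (fun j => (S j : ℝ) * c j) l i), (S l : ℝ) * c l
          ≤ G.budget
    then S i else 0

open Classical in
/-- The candidate allocation `S_v`. -/
def guessAlloc (G : Game m) (D : DemandFn m) (T : Finset (Fin m)) (c : Fin m → ℝ) (v : ℝ) :
    Fin m → ℕ :=
  if G.val (guessDemand G D T c v) < v / 2 then 0
  else affordablePrefix G T c (guessDemand G D T c v)

/-- `A_Max` on the set of players `T` with unit costs `c i` for `i ∈ T`: the most valuable
candidate `S_v` over `v = |T| v*, …, 2 v*, v*`, the first one in this order if there are several,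
and the empty allocation if `T` is empty. -/
def aMax (G : Game m) (D : DemandFn m) (T : Finset (Fin m)) (c : Fin m → ℝ) : Fin m → ℕ :=
  (List.argmax G.val
    ((List.range T.card).reverse.map
      (fun j => guessAlloc G D T c (((j + 1 : ℕ) : ℝ) * maxSingle G T c)))).getD 0

/-! ## The mechanisms -/

/-- Buy nothing and pay nothing. -/
def nullMech : DetMechanism m := fun _ => ⟨0, 0⟩

/-- The acceptance threshold `log log n / (64 log n)`, with logarithms in base 2. -/
def threshold (n : ℕ) : ℝ := Real.logb 2 (Real.logb 2 n) / (64 * Real.logb 2 n)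

/-- The price `B / k` of a unit in round `k`. -/
def roundPrice (G : Game m) (k : ℕ) : ℝ := G.budget / k

open Classical in
/-- The allocation `X` of round `k`: `A_Max` on the players outside `T` whose reported cost is at
most `B / k`, all of them with cost `B / k`. -/
def roundAlloc (G : Game m) (D : DemandFn m) (T : Finset (Fin m)) (c : Fin m → ℝ) (k : ℕ) :
    Fin m → ℕ :=
  aMax G D (Tᶜ.filter (fun i => c i ≤ roundPrice G k)) (fun _ => roundPrice G k)

open Classical in
/-- The deterministic mechanism that random sampling runs once the group `T` is drawn: the first
round `k = 1, 2, …, ∑ i ∉ T, n_i` whose allocation is worth at least the threshold times the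
value found on `T` determines the outcome. -/
def randMech (G : Game m) (D : DemandFn m) (T : Finset (Fin m)) : DetMechanism m := fun c =>
  match ((List.range (∑ i ∈ Tᶜ, G.units i)).map (· + 1)).find? (fun k =>
      decide (threshold G.total * G.val (aMax G D T c) ≤ G.val (roundAlloc G D T c k))) with
  | some k => ⟨roundAlloc G D T c k, fun i => (roundAlloc G D T c k i : ℝ) * roundPrice G k⟩
  | none => ⟨0, 0⟩

/-- The number of units of item `i` that the budget buys at the reported cost. -/
def soloUnits (G : Game m) (c : Fin m → ℝ) (i : Fin m) : ℕ :=
  affordable G.budget (G.units i) (c i)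

/-- The value `v_i` of these units. -/
def soloVal (G : Game m) (c : Fin m → ℝ) (i : Fin m) : ℝ := G.val (single i (soloUnits G c i))

/-- Player `i` is first when the players are listed by decreasing `v_i`, ties broken
lexicographically. -/
def IsFirst (G : Game m) (c : Fin m → ℝ) (i : Fin m) : Prop := ∀ j, RankLE (soloVal G c) i j

/-- The smallest `k` in `{1, …, λ}`, with `λ` the number of units bought from `i`, such that `i`
is still first with cost `B / k`. -/
def firstIndex (G : Game m) (c : Fin m → ℝ) (i : Fin m) : ℕ :=
  sInf {k : ℕ | 1 ≤ k ∧ k ≤ soloUnits G c i ∧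
    IsFirst G (Function.update c i (G.budget / k)) i}

open Classical in
/-- The payment `θ_ℓ` for the `ℓ`-th unit. -/
def unitPay (G : Game m) (c : Fin m → ℝ) (i : Fin m) (l : ℕ) : ℝ :=
  if l ≤ firstIndex G c i then G.budget / firstIndex G c i else G.budget / l

open Classical in
/-- The deterministic mechanism that buys from the first player as many units as the budget
allows and pays `θ_1 + … + θ_λ`. -/
def oneMech (G : Game m) : DetMechanism m := fun c =>
  ⟨fun i => if IsFirst G c i then soloUnits G c i else 0,
   fun i => if IsFirst G c i then ∑ l ∈ Finset.Icc 1 (soloUnits G c i), unitPay G c i l else 0⟩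

/-- A coin showing `true` with probability `p` (cut off to `[0, 1]`). -/
def coin (p : ℝ) : PMF Bool :=
  PMF.ofFintype
    (fun b => if b then min (ENNReal.ofReal p) 1 else 1 - min (ENNReal.ofReal p) 1)
    (by simp [add_tsub_cancel_of_le])

/-- `M_Rand`: the group `T` contains every player independently with probability `1/2`, that is,
it is a uniformly random set of players. -/
def mRand (G : Game m) (D : DemandFn m) : RandMechanism m :=
  (PMF.uniformOfFintype (Finset (Fin m))).map (randMech G D)

/-- `M_One`: run `oneMech` with probability `1 / (1 + ln n)`, and buy nothing otherwise. -/
def mOne (G : Game m) : RandMechanism m :=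
  (coin (1 / (1 + Real.log G.total))).map (fun b => if b then oneMech G else nullMech)

/-- `M_Sub`: the uniform mix of `M_Rand` and `M_One`. -/
def mSub (G : Game m) (D : DemandFn m) : RandMechanism m :=
  (coin (1 / 2)).bind (fun b => if b then mRand G D else mOne G)

/-! ## A machine model

A randomized real random-access machine with oracles.  Its memory consists of arrays of natural
numbers and arrays of real numbers.  One program has to serve all games.  Real arithmetic
(`+`, `-`, `*`, `/`, `ln`, comparison) and additive arithmetic on natural numbers have unit cost;
there is no rounding and no multiplication of natural numbers.  The only control structures are
sequencing, branching and counted loops. -/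

namespace Machine

/-- The memory, together with the number of steps made so far. -/
structure State where
  nat : ℕ → ℕ → ℕ
  real : ℕ → ℕ → ℝ
  time : ℕ

namespace State

/-- Let `t` time steps pass. -/
def tick (s : State) (t : ℕ) : State := { s with time := s.time + t }

/-- Write entry `i` of the integer array `a`. -/
def setNat (s : State) (a i x : ℕ) : State :=
  { s with nat := Function.update s.nat a (Function.update (s.nat a) i x) }

/-- Write entry `i` of the real array `a`. -/
def setReal (s : State) (a i : ℕ) (x : ℝ) : State :=
  { s with real := Function.update s.real a (Function.update (s.real a) i x) }

end State

/-- Integer expressions; `get a i` reads entry `i` of array `a`; `sub` is truncated. -/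
inductive NExp where
  | lit (k : ℕ)
  | get (a : ℕ) (i : NExp)
  | add (x y : NExp)
  | sub (x y : NExp)

/-- Real expressions. -/
inductive RExp where
  | ofNat (x : NExp)
  | get (a : ℕ) (i : NExp)
  | add (x y : RExp)
  | sub (x y : RExp)
  | mul (x y : RExp)
  | div (x y : RExp)
  | ln (x : RExp)

/-- Tests. -/
inductive BExp where
  | nle (x y : NExp)
  | rle (x y : RExp)
  | and (p q : BExp)
  | not (p : BExp)

/-- Programs. -/
inductive Cmd where
  /-- Do nothing. -/
  | skip
  /-- Write the value of `x` into entry `i` of the integer array `a`. -/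
  | setNat (a : ℕ) (i x : NExp)
  /-- Write the value of `x` into entry `i` of the real array `a`. -/
  | setReal (a : ℕ) (i : NExp) (x : RExp)
  /-- First `p`, then `q`. -/
  | seq (p q : Cmd)
  /-- Branch. -/
  | ite (b : BExp) (p q : Cmd)
  /-- Run the body with `0, 1, …, N - 1` written into entry `0` of the integer array `a`, where
  `N` is the value of `bound` on entry. -/
  | loop (a : ℕ) (bound : NExp) (body : Cmd)
  /-- Write `1` with probability `p` and `0` otherwise into entry `i` of the integer array `a`. -/
  | flip (a : ℕ) (i : NExp) (p : RExp)
  /-- Query the demand oracle: the players are those with a non-zero entry in the integer array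
  `set`, their numbers of units and prices are in the arrays `units` and `prices`, and the answer
  is written into the integer array `out`. -/
  | demand (set units prices out : ℕ)
  /-- Query the value of the allocation in the integer array `inp`; the answer is written into
  entry `0` of the real array `out`. -/
  | value (inp out : ℕ)

/-- The value of an integer expression. -/
def NExp.eval (s : State) : NExp → ℕ
  | .lit k => k
  | .get a i => s.nat a (i.eval s)
  | .add x y => x.eval s + y.eval s
  | .sub x y => x.eval s - y.eval s

/-- The number of operations in an integer expression. -/
def NExp.size : NExp → ℕ
  | .lit _ => 1
  | .get _ i => i.size + 1
  | .add x y => x.size + y.size + 1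
  | .sub x y => x.size + y.size + 1

/-- The value of a real expression. -/
def RExp.eval (s : State) : RExp → ℝ
  | .ofNat x => (x.eval s : ℝ)
  | .get a i => s.real a (i.eval s)
  | .add x y => x.eval s + y.eval s
  | .sub x y => x.eval s - y.eval s
  | .mul x y => x.eval s * y.eval s
  | .div x y => x.eval s / y.eval s
  | .ln x => Real.log (x.eval s)

/-- The number of operations in a real expression. -/
def RExp.size : RExp → ℕ
  | .ofNat x => x.size + 1
  | .get _ i => i.size + 1
  | .add x y => x.size + y.size + 1
  | .sub x y => x.size + y.size + 1
  | .mul x y => x.size + y.size + 1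
  | .div x y => x.size + y.size + 1
  | .ln x => x.size + 1

/-- The truth value of a test. -/
def BExp.Holds (s : State) : BExp → Prop
  | .nle x y => x.eval s ≤ y.eval s
  | .rle x y => x.eval s ≤ y.eval s
  | .and p q => p.Holds s ∧ q.Holds s
  | .not p => ¬ p.Holds s

/-- The number of operations in a test. -/
def BExp.size : BExp → ℕ
  | .nle x y => x.size + y.size + 1
  | .rle x y => x.size + y.size + 1
  | .and p q => p.size + q.size + 1
  | .not p => p.size + 1

/-- `f 0`, then `f 1`, and so on up to `f (N - 1)`. -/
def repeatFor (f : ℕ → State → PMF State) : ℕ → State → PMF State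
  | 0, s => PMF.pure s
  | N + 1, s => (repeatFor f N s).bind (f N)

open Classical in
/-- The effect of a query to the demand oracle. -/
def answerDemand (D : DemandFn m) (set units prices out : ℕ) (s : State) : State :=
  { s with
    nat := Function.update s.nat out (fun j =>
      if h : j < m then
        D (Finset.univ.filter (fun i : Fin m => s.nat set i ≠ 0))
          (fun i => s.nat units i) (fun i => s.real prices i) ⟨j, h⟩
      else s.nat out j) }

open Classical in
/-- Running a program, with the demand oracle `D` and the value oracle `V`.  Every command costs
one step plus the number of operations in its expressions, every round of a loop costs one step
in addition to the body, and an oracle query costs one step plus the length `m` of the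
allocation. -/
def exec (D : DemandFn m) (V : (Fin m → ℕ) → ℝ) : Cmd → State → PMF State
  | .skip, s => PMF.pure (s.tick 1)
  | .setNat a i x, s =>
      PMF.pure ((s.setNat a (i.eval s) (x.eval s)).tick (1 + i.size + x.size))
  | .setReal a i x, s =>
      PMF.pure ((s.setReal a (i.eval s) (x.eval s)).tick (1 + i.size + x.size))
  | .seq p q, s => (exec D V p s).bind (exec D V q)
  | .ite b p q, s =>
      if b.Holds s then exec D V p (s.tick (1 + b.size)) else exec D V q (s.tick (1 + b.size))
  | .loop a bound body, s =>
      repeatFor (fun j s' => exec D V body ((s'.setNat a 0 j).tick 1)) (bound.eval s)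
        (s.tick (1 + bound.size))
  | .flip a i p, s =>
      (coin (p.eval s)).map (fun b =>
        (s.setNat a (i.eval s) (if b then 1 else 0)).tick (1 + i.size + p.size))
  | .demand set units prices out, s =>
      PMF.pure ((answerDemand D set units prices out s).tick (1 + m))
  | .value inp out, s =>
      PMF.pure ((s.setReal out 0 (V (fun i => s.nat inp i))).tick (1 + m))

/-- The initial memory: `m` in entry `0` of the integer array `0`, the numbers of units in the
integer array `1`, the budget in entry `0` of the real array `0`, the reported costs in the real
array `1`, and zeros elsewhere. -/
def input (G : Game m) (c : Fin m → ℝ) : State where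
  nat a j := if a = 0 ∧ j = 0 then m else if h : a = 1 ∧ j < m then G.units ⟨j, h.2⟩ else 0
  real a j :=
    if a = 0 ∧ j = 0 then G.budget else if h : a = 1 ∧ j < m then c ⟨j, h.2⟩ else 0
  time := 0

/-- The outcome found in memory: the allocation is in the integer array `2`, the payments are in
the real array `2`. -/
def output (m : ℕ) (s : State) : Outcome m := ⟨fun i => s.nat 2 i, fun i => s.real 2 i⟩

/-- On the game `G` with reports `c`, the program `P` has the same distribution of outcomes as the
mechanism `μ`, and it never makes more than `t` steps. -/
def Implements (P : Cmd) (G : Game m) (D : DemandFn m) (μ : RandMechanism m) (c : Fin m → ℝ)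
    (t : ℕ) : Prop :=
  (exec D G.val P (input G c)).map (output m) = μ.map (fun M => M c) ∧
    ∀ s ∈ (exec D G.val P (input G c)).support, s.time ≤ t

end Machine

end Procurement

end

/-! All four classes consist of sub-additive valuations, so everything rests on sub-additivity and
monotonicity.

Incentives. Once T is drawn, `randMech` posts a falling uniform price. A player outside T influences
it only through the tests whether the report is at most B / k, and the benchmark is computed on T,
whose members never sell (`randMech_truthful`). `oneMech` pays critical prices: if κ is the least
positive number of units that would make i first, unit ℓ is paid B / max κ ℓ, and κ does not depend
on the report of i (`oneMech_truthful`). Random sampling never exceeds the budget. `oneMech` may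
exceed it by a factor 1 + ln n, a harmonic sum, which the probability of running it makes up for.

Approximation. `aMax` is an 8-approximation (`le_aMax`). Let A be optimal. If one player carries
more than a quarter of its value, `oneMech` secures that much. Otherwise the players split into S
and its complement, each worth at least a quarter (`exists_split`). For every T, either T or T ∆ S
then leaves an eighth on both of its sides (`balanced_or`), and of that set and its complement, the
one with the smaller optimum is a good sample (`le_val_randMech_or`). These four sets are equally
distributed, so the average is at least a quarter of the good case (`le_expect_of_symm`).

It remains that some round accepts when the benchmark v is at most the value of an affordable
allocation on the other side (`exists_accepts`). List its sellers by decreasing cost and cut the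
list into groups that can be bought at one price. Round K sees a group of K units, so if every round
rejects, each group is worth at most 8 · threshold · v. A potential combining the remaining cost
with the logarithm of the current highest cost bounds the number of groups by O(log n / log log n)
(`val_restrict_le_of_groups`, `groups_lt`), and the constant 64 in the threshold makes the total
smaller than v.

Machine. The program flips all coins at the start. The rest is deterministic and is verified by loop
invariants in the semantics `run`, which ignores time (`exec_eq_run`, `run_loop_induct`). The
running time is bounded separately from the syntax, every loop having at most m or n rounds
(`exec_time_le`). -/

noncomputable section

namespace Procurement

variable {m : ℕ}

/-! ### Valuation classes and their inclusion in the sub-additive ones -/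

namespace Game

variable {G : Game m}

theorem units_le_total (G : Game m) (i : Fin m) : G.units i ≤ G.total :=
  Finset.single_le_sum (f := G.units) (fun _ _ => Nat.zero_le _) (Finset.mem_univ i)

theorem isAlloc_zero (G : Game m) : G.IsAlloc 0 := fun _ => Nat.zero_le _

theorem IsAlloc.max {A A' : Fin m → ℕ} (hA : G.IsAlloc A) (hA' : G.IsAlloc A') :
    G.IsAlloc (fun i => Max.max (A i) (A' i)) := fun i => max_le (hA i) (hA' i)

theorem IsAlloc.min {A A' : Fin m → ℕ} (hA : G.IsAlloc A) :
    G.IsAlloc (fun i => Min.min (A i) (A' i)) := fun i => (min_le_left _ _).trans (hA i)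

theorem SubModular.subAdditive (hG : G.Proper) (h : G.SubModular) : G.SubAdditive := by
  intro A A' hA hA'
  have h1 := h A A' hA hA'
  have h2 := hG.val_nonneg _ (hA.min (A' := A'))
  linarith

theorem IsAlloc.addUnit {A : Fin m → ℕ} (hA : G.IsAlloc A) (j : Fin m) :
    G.IsAlloc (G.addUnit A j) := by
  intro i
  unfold Game.addUnit
  split_ifs with h
  · by_cases hij : i = j
    · subst hij; simpa using h
    · simpa [hij] using hA i
  · exact hA i

/-- Induction on the number of units of `A`: take away one unit of an item `j`, and put it back. The
maximum with `A'` gains no more from this unit than the smaller allocation does. -/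
theorem DiminishingReturn.subAdditive (hG : G.Proper) (h : G.DiminishingReturn) :
    G.SubAdditive := by
  have key : ∀ N : ℕ, ∀ A A' : Fin m → ℕ, G.IsAlloc A → G.IsAlloc A' → ∑ i, A i = N →
      G.val (fun i => Max.max (A i) (A' i)) ≤ G.val A + G.val A' := by
    intro N
    induction N with
    | zero =>
      intro A A' hA hA' hs
      have hA0 : A = 0 := by
        funext i
        exact (Finset.sum_eq_zero_iff.mp hs) i (Finset.mem_univ i)
      subst hA0
      simp [hG.val_zero]
    | succ N ih =>
      intro A A' hA hA' hs
      obtain ⟨j, hj⟩ : ∃ j, 0 < A j := by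
        by_contra! hcon
        have : ∑ i, A i = 0 := Finset.sum_eq_zero (fun i _ => Nat.le_zero.mp (hcon i))
        omega
      set B : Fin m → ℕ := Function.update A j (A j - 1) with hB
      have hBA : ∀ i, B i ≤ A i := by
        intro i
        by_cases hij : i = j
        · subst hij; simp [hB]
        · simp [hB, hij]
      have hBal : G.IsAlloc B := fun i => (hBA i).trans (hA i)
      have hBj : B j = A j - 1 := by simp [hB]
      have hadd : G.addUnit B j = A := by
        unfold Game.addUnit
        rw [if_pos (by have := hA j; omega)]
        funext i
        by_cases hij : i = j
        · subst hij; simp [hBj]; omega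
        · simp [hB, hij]
      have hsB : ∑ i, B i = N := by
        have h1 := Finset.sum_update_of_mem (Finset.mem_univ j) A (A j - 1)
        have h2 := Finset.add_sum_erase Finset.univ A (Finset.mem_univ j)
        rw [Finset.sdiff_singleton_eq_erase] at h1
        rw [hB, h1]; omega
      have h1 := ih B A' hBal hA' hsB
      have h2 := h B (fun i => Max.max (B i) (A' i)) hBal (hBal.max hA')
        (fun i => le_max_left _ _) j
      rw [hadd] at h2
      -- Only an inequality: if `A'` already has `A j` units of item `j`, the added unit overshoots
      -- the maximum or is refused at capacity. Monotonicity covers both cases.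
      have h3 : G.val (fun i => Max.max (A i) (A' i)) ≤
          G.val (G.addUnit (fun i => Max.max (B i) (A' i)) j) := by
        refine hG.val_mono _ _ (hA.max hA') ((hBal.max hA').addUnit j) ?_
        intro i
        have hAi := hA i
        have hAi' := hA' i
        unfold Game.addUnit
        by_cases hij : i = j
        · subst hij
          split_ifs with hlt
          · simp only [Function.update_self, hBj]; omega
          · simp only [hBj] at hlt ⊢; omega
        · split_ifs with hlt
          · simp [hij, hB]
          · simp [hij, hB]
      linarith
  intro A A' hA hA'
  exact key _ A A' hA hA' rfl

theorem isAlloc_single {i : Fin m} {a : ℕ} (h : a ≤ G.units i) : G.IsAlloc (single i a) := by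
  intro j
  unfold single
  by_cases hij : j = i
  · subst hij; simpa using h
  · simp [hij]

/-- The sum of the first `a` weights of an item is the value of `single i a`, hence non-negative.
For each item the maximum is one of the two amounts, and the other contributes a non-negative term.
-/
theorem Additive.subAdditive (hG : G.Proper) (h : G.Additive) : G.SubAdditive := by
  obtain ⟨w, hw⟩ := h
  have hpos : ∀ i a, a ≤ G.units i → 0 ≤ ∑ k ∈ Finset.range a, w i k := by
    intro i a ha
    have h1 := hG.val_nonneg _ (isAlloc_single ha)
    rw [hw _ (isAlloc_single ha), Finset.sum_eq_single i] at h1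
    · simpa [single] using h1
    · intro j _ hj; simp [single, hj]
    · simp
  intro A A' hA hA'
  rw [hw _ hA, hw _ hA', hw _ (hA.max hA'), ← Finset.sum_add_distrib]
  refine Finset.sum_le_sum (fun i _ => ?_)
  have h1 := hpos i _ (hA i)
  have h2 := hpos i _ (hA' i)
  rcases le_total (A i) (A' i) with h | h
  · rw [max_eq_right h]; linarith
  · rw [max_eq_left h]; linarith

/-- All the classes of valuations considered consist of sub-additive valuations. -/
theorem subAdditive_of_class (hG : G.Proper)
    (h : G.SubAdditive ∨ G.DiminishingReturn ∨ G.SubModular ∨ G.Additive) : G.SubAdditive := by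
  rcases h with h | h | h | h
  · exact h
  · exact h.subAdditive hG
  · exact h.subAdditive hG
  · exact h.subAdditive hG

end Game

/-! ## Affordable numbers of units -/

theorem affordable_le (B : ℝ) (N : ℕ) (c : ℝ) : affordable B N c ≤ N := Nat.findGreatest_le _

theorem affordable_mul_le {B : ℝ} (hB : 0 ≤ B) (N : ℕ) (c : ℝ) :
    (affordable B N c : ℝ) * c ≤ B := by
  classical
  exact Nat.findGreatest_spec (P := fun a : ℕ => (a : ℝ) * c ≤ B) (Nat.zero_le N) (by simpa using hB)

theorem le_affordable {B : ℝ} {N : ℕ} {c : ℝ} {a : ℕ} (ha : a ≤ N) (h : (a : ℝ) * c ≤ B) :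
    a ≤ affordable B N c := by
  classical
  exact Nat.le_findGreatest ha h

/-- This translates the costs `B / k` in the definition of `firstIndex` into numbers of units. -/
theorem affordable_div {B : ℝ} (hB : 0 < B) {N k : ℕ} (hk : 1 ≤ k) (hkN : k ≤ N) :
    affordable B N (B / k) = k := by
  have hk' : (0 : ℝ) < k := by exact_mod_cast hk
  apply le_antisymm
  · have h := affordable_mul_le hB.le N (B / k)
    rw [mul_div_assoc', div_le_iff₀ hk', mul_comm] at h
    exact_mod_cast le_of_mul_le_mul_left h hB
  · exact le_affordable hkN (by field_simp; exact le_refl _)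

/-! ## The order in which players are listed -/

/-- With the key negated, the listing is a lexicographic linear order, which supplies totality,
antisymmetry and extremal elements. -/
theorem rankLE_iff {key : Fin m → ℝ} {i j : Fin m} :
    RankLE key i j ↔ toLex (-key i, i) ≤ toLex (-key j, j) := by
  rw [Prod.Lex.toLex_le_toLex]
  simp [RankLE]

theorem RankLE.total (key : Fin m → ℝ) (i j : Fin m) : RankLE key i j ∨ RankLE key j i := by
  simp only [rankLE_iff]; exact le_total _ _

theorem RankLE.refl (key : Fin m → ℝ) (i : Fin m) : RankLE key i i := Or.inr ⟨rfl, le_rfl⟩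

theorem RankLE.antisymm {key : Fin m → ℝ} {i j : Fin m} (h : RankLE key i j)
    (h' : RankLE key j i) : i = j := by
  rw [rankLE_iff] at *
  have := h.antisymm h'
  simp only [EmbeddingLike.apply_eq_iff_eq, Prod.mk.injEq] at this
  exact this.2

theorem RankLE.key_le {key : Fin m → ℝ} {i j : Fin m} (h : RankLE key i j) : key j ≤ key i := by
  rcases h with h | h
  · exact h.le
  · exact h.1.ge

theorem exists_rank_last {key : Fin m → ℝ} {Q : Finset (Fin m)} (hQ : Q.Nonempty) :
    ∃ i ∈ Q, ∀ l ∈ Q, RankLE key l i := by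
  obtain ⟨i, hi, h⟩ := Finset.exists_max_image Q (fun i => toLex (-key i, i)) hQ
  exact ⟨i, hi, fun l hl => rankLE_iff.mpr (h l hl)⟩

theorem exists_rank_first {key : Fin m → ℝ} {Q : Finset (Fin m)} (hQ : Q.Nonempty) :
    ∃ i ∈ Q, ∀ l ∈ Q, RankLE key i l := by
  obtain ⟨i, hi, h⟩ := Finset.exists_min_image Q (fun i => toLex (-key i, i)) hQ
  exact ⟨i, hi, fun l hl => rankLE_iff.mpr (h l hl)⟩

/-! ## The affordable prefix -/

theorem affordablePrefix_le (G : Game m) (T : Finset (Fin m)) (c : Fin m → ℝ) (S : Fin m → ℕ)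
    (i : Fin m) : affordablePrefix G T c S i ≤ S i := by
  unfold affordablePrefix; split_ifs <;> simp

theorem affordablePrefix_of_notMem {G : Game m} {T : Finset (Fin m)} {c : Fin m → ℝ}
    {S : Fin m → ℕ} {i : Fin m} (h : i ∉ T) : affordablePrefix G T c S i = 0 := by
  unfold affordablePrefix; simp [h]

open Classical in
/-- The players in the affordable prefix. -/
def prefixSet (G : Game m) (T : Finset (Fin m)) (c : Fin m → ℝ) (S : Fin m → ℕ) :
    Finset (Fin m) :=
  T.filter (fun i => ∑ l ∈ T.filter (fun l => RankLE (fun j => (S j : ℝ) * c j) l i),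
    (S l : ℝ) * c l ≤ G.budget)

open Classical in
theorem affordablePrefix_eq (G : Game m) (T : Finset (Fin m)) (c : Fin m → ℝ) (S : Fin m → ℕ) :
    affordablePrefix G T c S = fun i => if i ∈ prefixSet G T c S then S i else 0 := by
  funext i
  simp [affordablePrefix, prefixSet, Finset.mem_filter]

theorem affordablePrefix_cost (G : Game m) (T : Finset (Fin m)) (c : Fin m → ℝ) (S : Fin m → ℕ) :
    ∑ i, (affordablePrefix G T c S i : ℝ) * c i = ∑ i ∈ prefixSet G T c S, (S i : ℝ) * c i := by
  classical
  rw [affordablePrefix_eq, ← Finset.sum_subset (Finset.subset_univ (prefixSet G T c S))]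
  · exact Finset.sum_congr rfl (fun i hi => by simp [hi])
  · intro i _ hi; simp [hi]

/-- The membership test of the member listed last already sums over all members of the prefix. -/
theorem affordablePrefix_cost_le {G : Game m} (hB : 0 ≤ G.budget) {T : Finset (Fin m)}
    {c : Fin m → ℝ} (hc : ∀ i ∈ T, 0 ≤ c i) (S : Fin m → ℕ) :
    ∑ i, (affordablePrefix G T c S i : ℝ) * c i ≤ G.budget := by
  classical
  rw [affordablePrefix_cost]
  rcases (prefixSet G T c S).eq_empty_or_nonempty with h | h
  · simpa [h] using hB
  · obtain ⟨i, hi, hl⟩ := exists_rank_last (key := fun j => (S j : ℝ) * c j) h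
    refine le_trans (Finset.sum_le_sum_of_subset_of_nonneg ?_ ?_) (Finset.mem_filter.mp hi).2
    · intro l hlQ
      exact Finset.mem_filter.mpr ⟨(Finset.mem_filter.mp hlQ).1, hl l hlQ⟩
    · intro l hl' _
      exact mul_nonneg (Nat.cast_nonneg _) (hc l (Finset.mem_filter.mp hl').1)

theorem affordablePrefix_eq_self {G : Game m} {T : Finset (Fin m)}
    {c : Fin m → ℝ} (hc : ∀ i ∈ T, 0 ≤ c i) {S : Fin m → ℕ} (hS : ∀ i, i ∉ T → S i = 0)
    (h : ∑ i ∈ T, (S i : ℝ) * c i ≤ G.budget) : affordablePrefix G T c S = S := by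
  classical
  rw [affordablePrefix_eq]
  funext i
  by_cases hi : i ∈ T
  · rw [if_pos]
    refine Finset.mem_filter.mpr ⟨hi, le_trans (Finset.sum_le_sum_of_subset_of_nonneg
      (Finset.filter_subset _ _) ?_) h⟩
    intro l hl _
    exact mul_nonneg (Nat.cast_nonneg _) (hc l hl)
  · rw [hS i hi]; simp

/-- If not everything fits into the budget, at least half of the budget is used up. -/
theorem half_budget_le_prefix {G : Game m} (hB : 0 ≤ G.budget) {T : Finset (Fin m)}
    {c : Fin m → ℝ} (hc : ∀ i ∈ T, 0 ≤ c i) {S : Fin m → ℕ}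
    (hS : ∀ i ∈ T, (S i : ℝ) * c i ≤ G.budget)
    (h : G.budget < ∑ i ∈ T, (S i : ℝ) * c i) :
    G.budget / 2 ≤ ∑ i ∈ prefixSet G T c S, (S i : ℝ) * c i := by
  classical
  set key : Fin m → ℝ := fun j => (S j : ℝ) * c j with hkey
  have hk0 : ∀ i ∈ T, 0 ≤ key i := fun i hi => mul_nonneg (Nat.cast_nonneg _) (hc i hi)
  -- If all players belonged to the prefix, the test of the last one would say that everything fits.
  have hne : (T \ prefixSet G T c S).Nonempty := by
    rw [Finset.sdiff_nonempty]
    intro hsub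
    have hTe : T.Nonempty := by
      by_contra hcon
      rw [Finset.not_nonempty_iff_eq_empty] at hcon
      subst hcon
      rw [Finset.sum_empty] at h
      exact absurd h (not_lt.mpr hB)
    obtain ⟨i, hi, hl⟩ := exists_rank_last (key := key) hTe
    have h1 := (Finset.mem_filter.mp (hsub hi)).2
    rw [Finset.filter_true_of_mem hl] at h1
    exact absurd h1 (not_le.mpr h)
  -- Let `i` be the first excluded player. The prefix together with `i` costs more than the budget,
  -- and `i` costs no more than the prefix, so the prefix accounts for at least half.
  obtain ⟨i, hi, hfirst⟩ := exists_rank_first (key := key) hne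
  obtain ⟨hiT, hiQ⟩ := Finset.mem_sdiff.mp hi
  have hbig : G.budget < ∑ l ∈ T.filter (fun l => RankLE key l i), key l := by
    by_contra hcon
    exact hiQ (Finset.mem_filter.mpr ⟨hiT, not_lt.mp hcon⟩)
  have hpred : T.filter (fun l => RankLE key l i) ⊆ insert i (prefixSet G T c S) := by
    intro l hl
    obtain ⟨hlT, hli⟩ := Finset.mem_filter.mp hl
    by_cases hlQ : l ∈ prefixSet G T c S
    · exact Finset.mem_insert_of_mem hlQ
    · have := hfirst l (Finset.mem_sdiff.mpr ⟨hlT, hlQ⟩)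
      rw [hli.antisymm this]
      exact Finset.mem_insert_self _ _
  have hsum : ∑ l ∈ T.filter (fun l => RankLE key l i), key l ≤
      key i + ∑ l ∈ prefixSet G T c S, key l := by
    rw [← Finset.sum_insert hiQ]
    refine Finset.sum_le_sum_of_subset_of_nonneg hpred ?_
    intro l hl _
    rcases Finset.mem_insert.mp hl with rfl | hl
    · exact hk0 _ hiT
    · exact hk0 _ (Finset.mem_filter.mp hl).1
  have hnn : 0 ≤ ∑ l ∈ prefixSet G T c S, key l :=
    Finset.sum_nonneg (fun l hl => hk0 l (Finset.mem_filter.mp hl).1)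
  -- Some member of the prefix precedes `i`, since otherwise `i` alone would exceed the budget,
  -- against `hS`. By the decreasing order that member costs at least as much as `i`.
  have hle : key i ≤ ∑ l ∈ prefixSet G T c S, key l := by
    obtain ⟨l, hl, hli⟩ : ∃ l ∈ prefixSet G T c S, RankLE key l i := by
      by_contra! hcon
      have : T.filter (fun l => RankLE key l i) ⊆ {i} := by
        intro l hl
        rcases Finset.mem_insert.mp (hpred hl) with rfl | hlQ
        · exact Finset.mem_singleton_self _
        · exact absurd (Finset.mem_filter.mp hl).2 (hcon l hlQ)
      have h2 : ∑ l ∈ T.filter (fun l => RankLE key l i), key l ≤ key i := by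
        rw [← Finset.sum_singleton key i]
        refine Finset.sum_le_sum_of_subset_of_nonneg this ?_
        intro l hl _
        rw [Finset.mem_singleton.mp hl]; exact hk0 i hiT
      have := hS i hiT
      simp only [hkey] at h2 hbig
      linarith
    exact hli.key_le.trans (Finset.single_le_sum
      (fun l hl => hk0 l (Finset.mem_filter.mp hl).1) hl)
  linarith

/-! ## `A_Max` -/

theorem maxUnits_le (G : Game m) (T : Finset (Fin m)) (c : Fin m → ℝ) (i : Fin m) :
    maxUnits G T c i ≤ G.units i := by
  unfold maxUnits; split_ifs
  · exact affordable_le _ _ _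
  · exact Nat.zero_le _

theorem maxUnits_mul_le {G : Game m} (hB : 0 ≤ G.budget) (T : Finset (Fin m)) (c : Fin m → ℝ)
    (i : Fin m) : (maxUnits G T c i : ℝ) * c i ≤ G.budget := by
  unfold maxUnits; split_ifs
  · exact affordable_mul_le hB _ _
  · simpa using hB

theorem maxSingle_nonneg (G : Game m) (T : Finset (Fin m)) (c : Fin m → ℝ) :
    0 ≤ maxSingle G T c := by
  unfold maxSingle
  rw [Finset.le_fold_max]; exact Or.inl le_rfl

theorem le_maxSingle {G : Game m} {T : Finset (Fin m)} {c : Fin m → ℝ} {i : Fin m} (hi : i ∈ T) :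
    G.val (single i (maxUnits G T c i)) ≤ maxSingle G T c := by
  unfold maxSingle
  rw [Finset.le_fold_max]; exact Or.inr ⟨i, hi, le_rfl⟩

theorem maxSingle_le {G : Game m} {T : Finset (Fin m)} {c : Fin m → ℝ} {x : ℝ} (hx : 0 ≤ x)
    (h : ∀ i ∈ T, G.val (single i (maxUnits G T c i)) ≤ x) : maxSingle G T c ≤ x := by
  unfold maxSingle
  rw [Finset.fold_max_le]; exact ⟨hx, h⟩

/-- The zero prices outside `T` are harmless because fitting allocations take nothing there, so the
price paid is `v / (2B)` times the true cost. -/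
theorem guessDemand_spec {G : Game m} (hG : G.Proper) {D : DemandFn m} (hD : IsDemandOracle G D)
    {T : Finset (Fin m)} {c : Fin m → ℝ} (hc : ∀ i ∈ T, 0 ≤ c i) {v : ℝ} (hv : 0 ≤ v) :
    Fits T (maxUnits G T c) (guessDemand G D T c v) ∧
      ∀ A, Fits T (maxUnits G T c) A →
        G.val A - v / (2 * G.budget) * ∑ i, (A i : ℝ) * c i ≤
          G.val (guessDemand G D T c v) -
            v / (2 * G.budget) * ∑ i, (guessDemand G D T c v i : ℝ) * c i := by
  classical
  have hp : 0 ≤ v / (2 * G.budget) := div_nonneg hv (by linarith [hG.budget_pos])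
  obtain ⟨h1, h2⟩ := hD T (maxUnits G T c)
    (fun i => if i ∈ T then v / (2 * G.budget) * c i else 0) (maxUnits_le G T c)
    (fun i => by
      split_ifs with h
      · exact mul_nonneg hp (hc i h)
      · exact le_rfl)
  refine ⟨h1, ?_⟩
  have hsum : ∀ A, Fits T (maxUnits G T c) A →
      ∑ i, (A i : ℝ) * (if i ∈ T then v / (2 * G.budget) * c i else 0) =
        v / (2 * G.budget) * ∑ i, (A i : ℝ) * c i := by
    intro A hA
    rw [Finset.mul_sum]
    refine Finset.sum_congr rfl (fun i _ => ?_)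
    by_cases h : i ∈ T
    · rw [if_pos h]; ring
    · rw [(hA i).2 h]; simp
  intro A hA
  have h3 := h2 A hA
  rw [hsum A hA, hsum _ h1] at h3
  exact h3

/-- Feasibility of `aMax` thereby reduces to the empty allocation and the candidates with `0 ≤ v`.
-/
theorem aMax_cases (G : Game m) (D : DemandFn m) (T : Finset (Fin m)) (c : Fin m → ℝ) :
    aMax G D T c = 0 ∨ ∃ v, 0 ≤ v ∧ aMax G D T c = guessAlloc G D T c v := by
  unfold aMax
  rcases h : List.argmax G.val ((List.range T.card).reverse.map
      (fun j => guessAlloc G D T c (((j + 1 : ℕ) : ℝ) * maxSingle G T c))) with _ | A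
  · left; rfl
  · right
    have := List.argmax_mem h
    rw [List.mem_map] at this
    obtain ⟨j, _, hj⟩ := this
    exact ⟨_, mul_nonneg (Nat.cast_nonneg _) (maxSingle_nonneg G T c), hj.symm⟩

theorem guessAlloc_le_aMax (G : Game m) (D : DemandFn m) {T : Finset (Fin m)} (c : Fin m → ℝ)
    {j : ℕ} (hj : j < T.card) :
    G.val (guessAlloc G D T c (((j + 1 : ℕ) : ℝ) * maxSingle G T c)) ≤ G.val (aMax G D T c) := by
  have hmem : guessAlloc G D T c (((j + 1 : ℕ) : ℝ) * maxSingle G T c) ∈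
      ((List.range T.card).reverse.map
      (fun j => guessAlloc G D T c (((j + 1 : ℕ) : ℝ) * maxSingle G T c))) :=
    List.mem_map.mpr ⟨j, by simpa using hj, rfl⟩
  unfold aMax
  rcases h : List.argmax G.val ((List.range T.card).reverse.map
      (fun j => guessAlloc G D T c (((j + 1 : ℕ) : ℝ) * maxSingle G T c))) with _ | A
  · rw [List.argmax_eq_none] at h
    rw [h] at hmem
    simp at hmem
  · exact List.le_of_mem_argmax hmem h

theorem aMax_fits {G : Game m} (hG : G.Proper) {D : DemandFn m} (hD : IsDemandOracle G D)
    {T : Finset (Fin m)} {c : Fin m → ℝ} (hc : ∀ i ∈ T, 0 ≤ c i) :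
    Fits T (maxUnits G T c) (aMax G D T c) := by
  rcases aMax_cases G D T c with h | ⟨v, hv, h⟩
  · rw [h]; intro i; simp
  · rw [h]
    unfold guessAlloc
    split_ifs
    · intro i; simp
    · have hf := (guessDemand_spec hG hD hc hv).1
      intro i
      exact ⟨(affordablePrefix_le _ _ _ _ _).trans (hf i).1, fun hi => affordablePrefix_of_notMem hi⟩

theorem aMax_isAlloc {G : Game m} (hG : G.Proper) {D : DemandFn m} (hD : IsDemandOracle G D)
    {T : Finset (Fin m)} {c : Fin m → ℝ} (hc : ∀ i ∈ T, 0 ≤ c i) :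
    G.IsAlloc (aMax G D T c) :=
  fun i => ((aMax_fits hG hD hc) i).1.trans (maxUnits_le G T c i)

theorem aMax_cost_le {G : Game m} (hG : G.Proper) (D : DemandFn m)
    {T : Finset (Fin m)} {c : Fin m → ℝ} (hc : ∀ i ∈ T, 0 ≤ c i) :
    ∑ i, (aMax G D T c i : ℝ) * c i ≤ G.budget := by
  rcases aMax_cases G D T c with h | ⟨v, hv, h⟩
  · rw [h]; simpa using hG.budget_pos.le
  · rw [h]
    unfold guessAlloc
    split_ifs
    · simpa using hG.budget_pos.le
    · exact affordablePrefix_cost_le hG.budget_pos.le hc _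

/-- Reports from outside `T` have no influence. For truthfulness this means that a potential seller
cannot move the benchmark. -/
theorem aMax_congr (G : Game m) (D : DemandFn m) {T : Finset (Fin m)} {c c' : Fin m → ℝ}
    (h : ∀ i ∈ T, c i = c' i) : aMax G D T c = aMax G D T c' := by
  classical
  have h1 : maxUnits G T c = maxUnits G T c' := by
    funext i
    unfold maxUnits
    by_cases hi : i ∈ T
    · simp [hi, h i hi]
    · simp [hi]
  have h2 : maxSingle G T c = maxSingle G T c' := by
    unfold maxSingle; rw [h1]
  have h3 : ∀ v, guessDemand G D T c v = guessDemand G D T c' v := by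
    intro v
    unfold guessDemand
    rw [h1]
    congr 1
    funext i
    by_cases hi : i ∈ T
    · simp [hi, h i hi]
    · simp [hi]
  have h4 : ∀ S, affordablePrefix G T c S = affordablePrefix G T c' S := by
    intro S
    funext i
    unfold affordablePrefix
    by_cases hi : i ∈ T
    · have : ∑ l ∈ T.filter (fun l => RankLE (fun j => (S j : ℝ) * c j) l i), (S l : ℝ) * c l =
          ∑ l ∈ T.filter (fun l => RankLE (fun j => (S j : ℝ) * c' j) l i), (S l : ℝ) * c' l := by
        refine Finset.sum_congr (Finset.filter_congr ?_) ?_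
        · intro l hl
          simp [RankLE, h l hl, h i hi]
        · intro l hl
          rw [h l (Finset.mem_filter.mp hl).1]
      rw [this]
    · simp [hi]
  unfold aMax guessAlloc
  simp only [h2, h3, h4]

end Procurement

/-! ### Truthfulness, individual rationality and budget of the mechanisms -/

namespace Procurement

variable {m : ℕ}

/-! ## Expectations -/

/-- The expectation of a non-negative function. -/
def expect {α : Type*} (μ : PMF α) (g : α → ENNReal) : ENNReal := ∑' a, μ a * g a

theorem expect_pure {α : Type*} (a : α) (g : α → ENNReal) : expect (PMF.pure a) g = g a := by
  unfold expect
  rw [tsum_eq_single a (fun b hb => by simp [PMF.pure_apply, hb])]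
  simp

theorem expect_bind {α β : Type*} (p : PMF α) (f : α → PMF β) (g : β → ENNReal) :
    expect (p.bind f) g = expect p (fun a => expect (f a) g) := by
  unfold expect
  simp_rw [PMF.bind_apply, ← ENNReal.tsum_mul_right, ← ENNReal.tsum_mul_left, mul_assoc]
  exact ENNReal.tsum_comm

theorem expect_map {α β : Type*} (p : PMF α) (f : α → β) (g : β → ENNReal) :
    expect (p.map f) g = expect p (g ∘ f) := by
  unfold PMF.map
  rw [expect_bind]
  simp [expect_pure, Function.comp_def]

theorem coin_true {p : ℝ} (hp : p ≤ 1) : coin p true = ENNReal.ofReal p := by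
  simp [coin, hp]

theorem coin_half (b : Bool) : coin (1 / 2) b = 2⁻¹ := by
  have h : ENNReal.ofReal (1 / 2) = 2⁻¹ := by
    rw [one_div, ENNReal.ofReal_inv_of_pos (by norm_num)]; simp
  cases b
  · simp only [coin, PMF.ofFintype_apply, Bool.false_eq_true, if_false, h]
    rw [min_eq_left (by simp), ENNReal.one_sub_inv_two]
  · rw [coin_true (by norm_num), h]

theorem expect_coin (p : ℝ) (g : Bool → ENNReal) :
    expect (coin p) g = coin p true * g true + coin p false * g false := by
  unfold expect
  rw [tsum_bool, add_comm]

theorem expect_coin_half (g : Bool → ENNReal) :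
    expect (coin (1 / 2)) g = 2⁻¹ * g true + 2⁻¹ * g false := by
  rw [expect_coin, coin_half, coin_half]

theorem expect_le_of_forall {α : Type*} (μ : PMF α) {g : α → ENNReal} {x : ENNReal}
    (h : ∀ a, g a ≤ x) : expect μ g ≤ x := by
  unfold expect
  calc ∑' a, μ a * g a ≤ ∑' a, μ a * x := ENNReal.tsum_le_tsum (fun a => by gcongr; exact h a)
    _ = x := by rw [ENNReal.tsum_mul_right, μ.tsum_coe, one_mul]

/-! ## Random sampling -/

variable {G : Game m} {D : DemandFn m}

/-- The test made in round `k`. -/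
def Accepts (G : Game m) (D : DemandFn m) (T : Finset (Fin m)) (c : Fin m → ℝ) (k : ℕ) : Prop :=
  threshold G.total * G.val (aMax G D T c) ≤ G.val (roundAlloc G D T c k)

/-- The outcome of random sampling if it stops in round `k`. -/
def roundOutcome (G : Game m) (D : DemandFn m) (T : Finset (Fin m)) (c : Fin m → ℝ) (k : ℕ) :
    Outcome m :=
  ⟨roundAlloc G D T c k, fun i => (roundAlloc G D T c k i : ℝ) * roundPrice G k⟩

open Classical in
theorem randMech_eq_of_accepts {T : Finset (Fin m)} {c : Fin m → ℝ} {k : ℕ} (hk1 : 1 ≤ k)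
    (hk : k ≤ ∑ i ∈ Tᶜ, G.units i) (h : Accepts G D T c k)
    (hlt : ∀ k', 1 ≤ k' → k' < k → ¬ Accepts G D T c k') :
    randMech G D T c = roundOutcome G D T c k := by
  have : ((List.range (∑ i ∈ Tᶜ, G.units i)).map (· + 1)).find? (fun k =>
      decide (threshold G.total * G.val (aMax G D T c) ≤ G.val (roundAlloc G D T c k))) =
      some k := by
    rw [List.find?_map, Option.map_eq_some_iff]
    -- Rounds are numbered from 1, the range from 0.
    refine ⟨k - 1, ?_, by omega⟩
    rw [List.find?_range_eq_some]
    refine ⟨?_, ?_, ?_⟩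
    · simp only [Function.comp, decide_eq_true_eq]
      rw [Nat.sub_add_cancel hk1]; exact h
    · simp only [List.mem_range]; omega
    · intro j hj
      have := hlt (j + 1) (by omega) (by omega)
      simpa [Accepts] using this
  unfold randMech
  rw [this]; rfl

open Classical in
theorem randMech_eq_of_not_accepts {T : Finset (Fin m)} {c : Fin m → ℝ}
    (h : ∀ k, 1 ≤ k → k ≤ ∑ i ∈ Tᶜ, G.units i → ¬ Accepts G D T c k) :
    randMech G D T c = ⟨0, 0⟩ := by
  have : ((List.range (∑ i ∈ Tᶜ, G.units i)).map (· + 1)).find? (fun k =>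
      decide (threshold G.total * G.val (aMax G D T c) ≤ G.val (roundAlloc G D T c k))) =
      none := by
    rw [List.find?_map, Option.map_eq_none_iff, List.find?_range_eq_none]
    intro j hj
    have := h (j + 1) (by omega) (by omega)
    simpa [Accepts] using this
  unfold randMech
  rw [this]

theorem randMech_cases (G : Game m) (D : DemandFn m) (T : Finset (Fin m)) (c : Fin m → ℝ) :
    (∃ k, 1 ≤ k ∧ k ≤ ∑ i ∈ Tᶜ, G.units i ∧ Accepts G D T c k ∧
      (∀ k', 1 ≤ k' → k' < k → ¬ Accepts G D T c k') ∧
      randMech G D T c = roundOutcome G D T c k) ∨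
    ((∀ k, 1 ≤ k → k ≤ ∑ i ∈ Tᶜ, G.units i → ¬ Accepts G D T c k) ∧
      randMech G D T c = ⟨0, 0⟩) := by
  classical
  by_cases h : ∃ k, 1 ≤ k ∧ k ≤ ∑ i ∈ Tᶜ, G.units i ∧ Accepts G D T c k
  · left
    obtain ⟨h1, h2, h3⟩ := Nat.find_spec h
    have h4 : ∀ k', 1 ≤ k' → k' < Nat.find h → ¬ Accepts G D T c k' :=
      fun k' hk1 hk' hacc => Nat.find_min h hk' ⟨hk1, by omega, hacc⟩
    exact ⟨Nat.find h, h1, h2, h3, h4, randMech_eq_of_accepts h1 h2 h3 h4⟩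
  · right
    push Not at h
    exact ⟨h, randMech_eq_of_not_accepts h⟩

theorem roundPrice_nonneg (hG : G.Proper) (k : ℕ) : 0 ≤ roundPrice G k :=
  div_nonneg hG.budget_pos.le (Nat.cast_nonneg _)

theorem roundPrice_anti (hG : G.Proper) {k k' : ℕ} (hk : 1 ≤ k) (h : k ≤ k') :
    roundPrice G k' ≤ roundPrice G k := by
  unfold roundPrice
  have : (0 : ℝ) < k := by exact_mod_cast hk
  exact div_le_div_of_nonneg_left hG.budget_pos.le this (by exact_mod_cast h)

theorem roundAlloc_isAlloc (hG : G.Proper) (hD : IsDemandOracle G D) (T : Finset (Fin m))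
    (c : Fin m → ℝ) (k : ℕ) : G.IsAlloc (roundAlloc G D T c k) :=
  aMax_isAlloc hG hD (fun _ _ => roundPrice_nonneg hG k)

theorem roundAlloc_eq_zero (hG : G.Proper) (hD : IsDemandOracle G D) {T : Finset (Fin m)}
    {c : Fin m → ℝ} {k : ℕ} {i : Fin m} (h : i ∈ T ∨ roundPrice G k < c i) :
    roundAlloc G D T c k i = 0 := by
  refine ((aMax_fits hG hD (fun _ _ => roundPrice_nonneg hG k)) i).2 ?_
  simp only [Finset.mem_filter, Finset.mem_compl, not_and, not_le]
  rcases h with h | h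
  · exact fun h' => absurd h h'
  · exact fun _ => h

theorem randMech_wellFormed (hG : G.Proper) (hD : IsDemandOracle G D) (T : Finset (Fin m)) :
    DetMechanism.WellFormed G (randMech G D T) := by
  intro c _
  rcases randMech_cases G D T c with ⟨k, _, _, _, _, h⟩ | ⟨_, h⟩
  · rw [h]
    exact ⟨roundAlloc_isAlloc hG hD T c k,
      fun i => mul_nonneg (Nat.cast_nonneg _) (roundPrice_nonneg hG k)⟩
  · rw [h]; exact ⟨G.isAlloc_zero, fun _ => le_rfl⟩

theorem utility_roundOutcome (i : Fin m) (x : ℝ) (T : Finset (Fin m)) (c : Fin m → ℝ) (k : ℕ) :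
    utility i x (roundOutcome G D T c k) =
      (roundAlloc G D T c k i : ℝ) * (roundPrice G k - x) := by
  simp only [utility, roundOutcome]; ring

theorem utility_zero (i : Fin m) (x : ℝ) : utility i x (⟨0, 0⟩ : Outcome m) = 0 := by
  simp [utility]

theorem randMech_individuallyRational (hG : G.Proper) (hD : IsDemandOracle G D)
    (T : Finset (Fin m)) : DetMechanism.IndividuallyRational (randMech G D T) := by
  intro c _ i
  rcases randMech_cases G D T c with ⟨k, _, _, _, _, h⟩ | ⟨_, h⟩
  · rw [h, utility_roundOutcome]
    by_cases hi : roundPrice G k < c i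
    · rw [roundAlloc_eq_zero hG hD (Or.inr hi)]; simp
    · exact mul_nonneg (Nat.cast_nonneg _) (by linarith)
  · rw [h, utility_zero]

/-- A round uses its own price instead of the reported costs, so a report matters only through the
comparison with that price. -/
theorem roundAlloc_update_eq {T : Finset (Fin m)} {c : Fin m → ℝ} {i : Fin m} {b : ℝ} {k : ℕ}
    (h : i ∈ T ∨ (b ≤ roundPrice G k ↔ c i ≤ roundPrice G k)) :
    roundAlloc G D T (Function.update c i b) k = roundAlloc G D T c k := by
  classical
  unfold roundAlloc
  congr 1
  refine Finset.filter_congr (fun j hj => ?_)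
  by_cases hji : j = i
  · subst hji
    rcases h with h | h
    · exact absurd h (Finset.mem_compl.mp hj)
    · simpa using h
  · simp [hji]

theorem aMax_update_eq {T : Finset (Fin m)} (c : Fin m → ℝ) {i : Fin m} (hi : i ∉ T) (b : ℝ) :
    aMax G D T (Function.update c i b) = aMax G D T c :=
  aMax_congr G D (fun j hj => by
    have : j ≠ i := fun h => hi (h ▸ hj)
    simp [this])

/-- Suppose the deviation stops in round `k`. If `i` sells nothing there or the price is below the
true cost, the utility is at most 0. Otherwise both reports are at most the price of round `k`,
hence at most all earlier and higher prices, so rounds 1 to `k` run identically under both reports.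
-/
theorem randMech_truthful (hG : G.Proper) (hD : IsDemandOracle G D) (T : Finset (Fin m)) :
    DetMechanism.Truthful (randMech G D T) := by
  intro c hc i b _
  have hIR := randMech_individuallyRational hG hD T c hc i
  rcases randMech_cases G D T (Function.update c i b) with ⟨k, hk1, hkN, hacc, hmin, h⟩ | ⟨_, h⟩
  swap
  · rw [h, utility_zero]; exact hIR
  rw [h, utility_roundOutcome]
  by_cases hiT : i ∈ T
  · rw [roundAlloc_eq_zero hG hD (Or.inl hiT)]; simpa using hIR
  by_cases hbk : roundPrice G k < b
  · rw [roundAlloc_eq_zero hG hD (Or.inr (by simpa using hbk))]; simpa using hIR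
  by_cases hck : roundPrice G k < c i
  · refine le_trans (mul_nonpos_of_nonneg_of_nonpos (Nat.cast_nonneg _) (by linarith)) hIR
  push Not at hbk hck
  have hsame : ∀ k', 1 ≤ k' → k' ≤ k →
      roundAlloc G D T (Function.update c i b) k' = roundAlloc G D T c k' := by
    intro k' h1 h2
    have := roundPrice_anti hG h1 h2
    exact roundAlloc_update_eq (Or.inr ⟨fun _ => hck.trans this, fun _ => hbk.trans this⟩)
  have hacc' : ∀ k', 1 ≤ k' → k' ≤ k →
      (Accepts G D T (Function.update c i b) k' ↔ Accepts G D T c k') := by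
    intro k' h1 h2
    unfold Accepts
    rw [hsame k' h1 h2, aMax_update_eq c hiT]
  have heq := randMech_eq_of_accepts hk1 hkN ((hacc' k hk1 le_rfl).mp hacc)
    (fun k' h1 h2 => (hacc' k' h1 h2.le).not.mp (hmin k' h1 h2))
  rw [heq, utility_roundOutcome, hsame k hk1 le_rfl]

/-- The payments are exactly the costs that `aMax` kept within the budget in the accepting round, so
the bound holds for every draw of `T`. -/
theorem randMech_pay_le (hG : G.Proper) (T : Finset (Fin m)) (c : Fin m → ℝ) :
    ∑ i, (randMech G D T c).pay i ≤ G.budget := by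
  rcases randMech_cases G D T c with ⟨k, _, _, _, _, h⟩ | ⟨_, h⟩
  · rw [h]
    exact aMax_cost_le hG D (fun _ _ => roundPrice_nonneg hG k)
  · rw [h]; simpa using hG.budget_pos.le

/-! ## Buying from one player -/

/-- Player `i` would be first with `a` units, the reports of the others being `c`. -/
def FirstAt (G : Game m) (c : Fin m → ℝ) (i : Fin m) (a : ℕ) : Prop :=
  ∀ j, j ≠ i → (soloVal G c j < G.val (single i a) ∨ (G.val (single i a) = soloVal G c j ∧ i ≤ j))

theorem isFirst_iff (c : Fin m → ℝ) (i : Fin m) :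
    IsFirst G c i ↔ FirstAt G c i (soloUnits G c i) := by
  constructor
  · intro h j _; exact h j
  · intro h j
    by_cases hj : j = i
    · rw [hj]; exact RankLE.refl _ _
    · exact h j hj

theorem firstAt_update (c : Fin m → ℝ) (i : Fin m) (b : ℝ) (a : ℕ) :
    FirstAt G (Function.update c i b) i a ↔ FirstAt G c i a := by
  unfold FirstAt
  refine forall_congr' (fun j => forall_congr' (fun hj => ?_))
  simp [soloVal, soloUnits, hj]

/-- Monotone selection: being first is a threshold condition on the number of units, which makes
critical payments meaningful. -/
theorem FirstAt.mono (hG : G.Proper) {c : Fin m → ℝ} {i : Fin m} {a a' : ℕ}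
    (h : FirstAt G c i a) (ha : a ≤ a') (ha' : a' ≤ G.units i) : FirstAt G c i a' := by
  have hle : G.val (single i a) ≤ G.val (single i a') :=
    hG.val_mono _ _ (Game.isAlloc_single (ha.trans ha')) (Game.isAlloc_single ha') (fun j => by
      unfold single
      by_cases hj : j = i
      · subst hj; simpa using ha
      · simp [hj])
  intro j hj
  rcases h j hj with h | ⟨h1, h2⟩
  · exact Or.inl (h.trans_le hle)
  · rcases hle.lt_or_eq with h' | h'
    · exact Or.inl (h1 ▸ h')
    · exact Or.inr ⟨h' ▸ h1, h2⟩

theorem soloUnits_le (G : Game m) (c : Fin m → ℝ) (i : Fin m) : soloUnits G c i ≤ G.units i :=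
  affordable_le _ _ _

theorem isFirst_update_div (hG : G.Proper) (c : Fin m → ℝ) (i : Fin m) {k : ℕ} (hk : 1 ≤ k)
    (hkn : k ≤ G.units i) :
    IsFirst G (Function.update c i (G.budget / k)) i ↔ FirstAt G c i k := by
  rw [isFirst_iff, firstAt_update]
  simp [soloUnits, affordable_div hG.budget_pos hk hkn]

/-- `soloUnits` itself is a candidate, so the infimum is attained. Without `hl` the set would be
empty and `firstIndex` would take the default value 0. -/
theorem firstIndex_spec (hG : G.Proper) {c : Fin m → ℝ} {i : Fin m} (h : IsFirst G c i)
    (hl : 1 ≤ soloUnits G c i) :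
    1 ≤ firstIndex G c i ∧ firstIndex G c i ≤ soloUnits G c i ∧
      FirstAt G c i (firstIndex G c i) ∧
      ∀ a, 1 ≤ a → a < firstIndex G c i → ¬ FirstAt G c i a := by
  have hset : {k : ℕ | 1 ≤ k ∧ k ≤ soloUnits G c i ∧
      IsFirst G (Function.update c i (G.budget / k)) i} =
      {k : ℕ | 1 ≤ k ∧ k ≤ soloUnits G c i ∧ FirstAt G c i k} := by
    ext k
    constructor
    · rintro ⟨h1, h2, h3⟩
      exact ⟨h1, h2, (isFirst_update_div hG c i h1 (h2.trans (soloUnits_le _ _ _))).mp h3⟩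
    · rintro ⟨h1, h2, h3⟩
      exact ⟨h1, h2, (isFirst_update_div hG c i h1 (h2.trans (soloUnits_le _ _ _))).mpr h3⟩
  have hfi : firstIndex G c i =
      sInf {k : ℕ | 1 ≤ k ∧ k ≤ soloUnits G c i ∧ FirstAt G c i k} := congrArg sInf hset
  obtain ⟨h1, h2, h3⟩ := Nat.sInf_mem
    (s := {k : ℕ | 1 ≤ k ∧ k ≤ soloUnits G c i ∧ FirstAt G c i k})
    ⟨_, hl, le_rfl, (isFirst_iff c i).mp h⟩
  rw [← hfi] at h1 h2 h3
  refine ⟨h1, h2, h3, fun a ha1 ha hfa => ?_⟩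
  have hle : firstIndex G c i ≤ a := hfi ▸ Nat.sInf_le ⟨ha1, ha.le.trans h2, hfa⟩
  omega

/-- This closed form replaces the case distinction in all the payment arguments. -/
theorem unitPay_eq (c : Fin m → ℝ) (i : Fin m) (l : ℕ) :
    unitPay G c i l = G.budget / ((Max.max (firstIndex G c i) l : ℕ) : ℝ) := by
  unfold unitPay
  split_ifs with h
  · rw [max_eq_left h]
  · rw [max_eq_right (by omega)]

open Classical in
theorem utility_oneMech (c : Fin m → ℝ) (i : Fin m) (x : ℝ) :
    utility i x (oneMech G c) =
      if IsFirst G c i then ∑ l ∈ Finset.Icc 1 (soloUnits G c i), (unitPay G c i l - x) else 0 := by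
  unfold utility oneMech
  by_cases h : IsFirst G c i
  · simp [h, Finset.sum_sub_distrib]
  · simp [h]

/-- Up to `soloUnits` units the price `B / a` covers the cost of a unit. Together with
`oneMech_term_neg` this gives the sign of the surplus of every unit. -/
theorem oneMech_term_nonneg (hG : G.Proper) {c : Fin m → ℝ} {i : Fin m} {κ l : ℕ}
    (hκ : 1 ≤ κ) (hκ' : κ ≤ soloUnits G c i) (hl : l ≤ soloUnits G c i) :
    0 ≤ G.budget / ((Max.max κ l : ℕ) : ℝ) - c i := by
  have h1 : (soloUnits G c i : ℝ) * c i ≤ G.budget := affordable_mul_le hG.budget_pos.le _ _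
  have h2 : (0 : ℝ) < soloUnits G c i := by exact_mod_cast hκ.trans hκ'
  have h3 : (0 : ℝ) < ((Max.max κ l : ℕ) : ℝ) := by
    exact_mod_cast hκ.trans (le_max_left _ _)
  have h4 : ((Max.max κ l : ℕ) : ℝ) ≤ soloUnits G c i := by
    exact_mod_cast max_le hκ' hl
  have h5 : c i ≤ G.budget / soloUnits G c i := by
    rw [le_div_iff₀ h2]; linarith
  have h6 := div_le_div_of_nonneg_left hG.budget_pos.le h3 h4
  linarith

theorem oneMech_term_neg {c : Fin m → ℝ} {i : Fin m} {a : ℕ}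
    (ha : soloUnits G c i < a) (ha' : a ≤ G.units i) : G.budget / (a : ℝ) - c i ≤ 0 := by
  have h0 : (0 : ℝ) < a := by exact_mod_cast (by omega : 0 < a)
  have h1 : G.budget < a * c i := by
    by_contra hcon
    exact absurd (le_affordable ha' (not_lt.mp hcon)) (not_le.mpr ha)
  have : G.budget / a ≤ c i := by
    rw [div_le_iff₀ h0]; linarith
  linarith

theorem oneMech_individuallyRational (hG : G.Proper) :
    DetMechanism.IndividuallyRational (oneMech G) := by
  intro c _ i
  rw [utility_oneMech]
  split_ifs with h
  · refine Finset.sum_nonneg (fun l hl => ?_)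
    rw [Finset.mem_Icc] at hl
    obtain ⟨h1, h2, _⟩ := firstIndex_spec hG h (hl.1.trans hl.2)
    rw [unitPay_eq]
    exact oneMech_term_nonneg hG h1 h2 hl.2
  · exact le_rfl

/-- The index `κ` depends on the other reports only. A winning report thus earns the sum of `B / max
κ l - c i` over the units `l` bought. If `κ` is at most the true `soloUnits`, these terms are
non-negative up to that number and non-positive beyond it, so the truthful number of units maximizes
the sum. -/
theorem oneMech_truthful (hG : G.Proper) : DetMechanism.Truthful (oneMech G) := by
  intro c hc i b _
  have hIR := oneMech_individuallyRational hG c hc i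
  set c' := Function.update c i b with hc'
  rw [utility_oneMech c']
  split_ifs with h
  swap
  · exact hIR
  -- A winner with no affordable unit is paid an empty sum, and `firstIndex` carries no information
  -- then.
  rcases Nat.eq_zero_or_pos (soloUnits G c' i) with h0 | hpos
  · rw [h0]; simpa using hIR
  obtain ⟨k1, k2, k3, k4⟩ := firstIndex_spec hG h hpos
  set κ := firstIndex G c' i with hκ
  have hF : ∀ a, FirstAt G c' i a ↔ FirstAt G c i a := fun a => firstAt_update c i b a
  simp only [unitPay_eq, ← hκ]
  have hu' := soloUnits_le G c' i
  by_cases hle : κ ≤ soloUnits G c i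
  · have hfirst : IsFirst G c i := by
      rw [isFirst_iff]
      exact ((hF κ).mp k3).mono hG hle (soloUnits_le G c i)
    obtain ⟨j1, j2, j3, j4⟩ := firstIndex_spec hG hfirst (k1.trans hle)
    -- Both are the least positive number of units that makes `i` first against the same opponents.
    have heq : firstIndex G c i = κ := by
      apply le_antisymm
      · by_contra hcon
        exact j4 κ k1 (by omega) ((hF κ).mp k3)
      · by_contra hcon
        exact k4 _ j1 (by omega) ((hF _).mpr j3)
    rw [utility_oneMech, if_pos hfirst]
    simp only [unitPay_eq, heq]
    rcases le_total (soloUnits G c' i) (soloUnits G c i) with hl | hl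
    · refine Finset.sum_le_sum_of_subset_of_nonneg (Finset.Icc_subset_Icc_right hl) ?_
      intro l hl _
      rw [Finset.mem_Icc] at hl
      exact oneMech_term_nonneg hG k1 hle hl.2
    · rw [← Finset.sum_sdiff (Finset.Icc_subset_Icc_right hl)]
      have : ∑ l ∈ Finset.Icc 1 (soloUnits G c' i) \ Finset.Icc 1 (soloUnits G c i),
          (G.budget / ((Max.max κ l : ℕ) : ℝ) - c i) ≤ 0 := by
        refine Finset.sum_nonpos (fun l hl => ?_)
        simp only [Finset.mem_sdiff, Finset.mem_Icc, not_and, not_le] at hl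
        refine oneMech_term_neg ((hl.2 hl.1.1).trans_le (le_max_right _ _)) ?_
        exact max_le (k2.trans hu') (hl.1.2.trans hu')
      linarith
  -- Here `max κ l` always exceeds the true `soloUnits`, so no unit is paid more than it costs.
  · refine le_trans (Finset.sum_nonpos (fun l hl => ?_)) hIR
    rw [Finset.mem_Icc] at hl
    exact oneMech_term_neg ((not_le.mp hle).trans_le (le_max_left _ _))
      (max_le (k2.trans hu') (hl.2.trans hu'))

theorem unitPay_nonneg (hG : G.Proper) (c : Fin m → ℝ) (i : Fin m) (l : ℕ) :
    0 ≤ unitPay G c i l := by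
  rw [unitPay_eq]; exact div_nonneg hG.budget_pos.le (Nat.cast_nonneg _)

theorem oneMech_wellFormed (hG : G.Proper) : DetMechanism.WellFormed G (oneMech G) := by
  intro c _
  refine ⟨fun i => ?_, fun i => ?_⟩
  · simp only [oneMech]
    split_ifs
    · exact soloUnits_le G c i
    · exact Nat.zero_le _
  · simp only [oneMech]
    split_ifs
    · exact Finset.sum_nonneg (fun l _ => unitPay_nonneg hG c i l)
    · exact le_rfl

theorem IsFirst.unique {c : Fin m → ℝ} {i j : Fin m} (hi : IsFirst G c i) (hj : IsFirst G c j) :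
    i = j := (hi j).antisymm (hj i)

theorem log_total_nonneg (G : Game m) : 0 ≤ Real.log G.total := Real.log_natCast_nonneg _

/-- Every `θ_l` is at most `B / l`, so the payment is bounded by a harmonic sum. This is where the
bias `1 / (1 + ln n)` of the coin comes from. -/
theorem sum_unitPay_le (hG : G.Proper) (c : Fin m → ℝ) (i : Fin m) :
    ∑ l ∈ Finset.Icc 1 (soloUnits G c i), unitPay G c i l ≤
      G.budget * (1 + Real.log G.total) := by
  have h1 : ∑ l ∈ Finset.Icc 1 (soloUnits G c i), unitPay G c i l ≤
      ∑ l ∈ Finset.Icc 1 (soloUnits G c i), G.budget * ((l : ℝ))⁻¹ := by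
    refine Finset.sum_le_sum (fun l hl => ?_)
    rw [Finset.mem_Icc] at hl
    rw [unitPay_eq, ← div_eq_mul_inv]
    exact div_le_div_of_nonneg_left hG.budget_pos.le (by exact_mod_cast hl.1)
      (by exact_mod_cast le_max_right _ _)
  refine h1.trans ?_
  rw [← Finset.mul_sum]
  refine mul_le_mul_of_nonneg_left ?_ hG.budget_pos.le
  have h2 := harmonic_le_one_add_log (soloUnits G c i)
  simp only [harmonic_eq_sum_Icc, Rat.cast_sum, Rat.cast_inv, Rat.cast_natCast] at h2
  refine h2.trans ?_
  rcases Nat.eq_zero_or_pos (soloUnits G c i) with h0 | hpos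
  · rw [h0]; simpa using log_total_nonneg G
  · have : (soloUnits G c i : ℝ) ≤ G.total := by
      exact_mod_cast (soloUnits_le G c i).trans (G.units_le_total i)
    have := Real.log_le_log (by exact_mod_cast hpos) this
    linarith

theorem oneMech_pay_le (hG : G.Proper) (c : Fin m → ℝ) :
    ∑ i, (oneMech G c).pay i ≤ G.budget * (1 + Real.log G.total) := by
  classical
  have hnn : 0 ≤ G.budget * (1 + Real.log G.total) :=
    mul_nonneg hG.budget_pos.le (by linarith [log_total_nonneg G])
  by_cases h : ∃ i, IsFirst G c i
  · obtain ⟨i, hi⟩ := h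
    rw [Finset.sum_eq_single i]
    · simp only [oneMech, if_pos hi]; exact sum_unitPay_le hG c i
    · intro j _ hj
      simp only [oneMech]
      rw [if_neg (fun hj' => hj (hj'.unique hi))]
    · simp
  · push Not at h
    simpa [oneMech, h] using hnn

/-! ## The mechanism `M_Sub` -/

theorem mem_support_mSub {M : DetMechanism m} (h : M ∈ (mSub G D).support) :
    (∃ T, M = randMech G D T) ∨ M = oneMech G ∨ M = nullMech := by
  unfold mSub at h
  rw [PMF.mem_support_bind_iff] at h
  obtain ⟨b, _, h⟩ := h
  cases b
  · right
    simp only [Bool.false_eq_true, if_false, mOne, PMF.mem_support_map_iff] at h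
    obtain ⟨b, _, h⟩ := h
    cases b <;> simp_all
  · left
    simp only [if_true, mRand, PMF.mem_support_map_iff] at h
    obtain ⟨T, _, h⟩ := h
    exact ⟨T, h.symm⟩

theorem mSub_wellFormed (hG : G.Proper) (hD : IsDemandOracle G D) :
    (mSub G D).WellFormed G := by
  intro M hM
  rcases mem_support_mSub hM with ⟨T, rfl⟩ | rfl | rfl
  · exact randMech_wellFormed hG hD T
  · exact oneMech_wellFormed hG
  · exact fun c _ => ⟨G.isAlloc_zero, fun _ => le_rfl⟩

theorem mSub_universallyTruthful (hG : G.Proper) (hD : IsDemandOracle G D) :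
    (mSub G D).UniversallyTruthful := by
  intro M hM
  rcases mem_support_mSub hM with ⟨T, rfl⟩ | rfl | rfl
  · exact randMech_truthful hG hD T
  · exact oneMech_truthful hG
  · exact fun c _ i b _ => le_rfl

theorem mSub_individuallyRational (hG : G.Proper) (hD : IsDemandOracle G D) :
    (mSub G D).IndividuallyRational := by
  intro M hM
  rcases mem_support_mSub hM with ⟨T, rfl⟩ | rfl | rfl
  · exact randMech_individuallyRational hG hD T
  · exact oneMech_individuallyRational hG
  · exact fun c _ i => by simp [nullMech, utility]

theorem expect_mSub (G : Game m) (D : DemandFn m) (g : DetMechanism m → ENNReal) :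
    expect (mSub G D) g =
      2⁻¹ * expect (PMF.uniformOfFintype (Finset (Fin m))) (fun T => g (randMech G D T)) +
      2⁻¹ * (ENNReal.ofReal (1 / (1 + Real.log G.total)) * g (oneMech G) +
        coin (1 / (1 + Real.log G.total)) false * g nullMech) := by
  have hp : 1 / (1 + Real.log G.total) ≤ 1 := by
    have := log_total_nonneg G
    rw [div_le_one (by linarith)]; linarith
  unfold mSub
  rw [expect_bind, expect_coin_half]
  simp only [if_true, Bool.false_eq_true, if_false, mRand, mOne, expect_map, expect_coin,
    Function.comp_def, coin_true hp]

/-- Each half contributes at most half of the budget; for `oneMech` the excess factor `1 + ln n`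
cancels against its probability. -/
theorem mSub_budgetFeasible (hG : G.Proper) (D : DemandFn m) : (mSub G D).BudgetFeasible G := by
  intro c _
  have h := expect_mSub G D (fun M => ENNReal.ofReal (∑ i, (M c).pay i))
  unfold expect at h
  rw [h]
  have h1 : ∑' T, (PMF.uniformOfFintype (Finset (Fin m))) T *
      ENNReal.ofReal (∑ i, (randMech G D T c).pay i) ≤ ENNReal.ofReal G.budget :=
    expect_le_of_forall _ (fun T => ENNReal.ofReal_le_ofReal (randMech_pay_le hG T c))
  have h2 : ENNReal.ofReal (1 / (1 + Real.log G.total)) *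
        ENNReal.ofReal (∑ i, (oneMech G c).pay i) +
        coin (1 / (1 + Real.log G.total)) false *
          ENNReal.ofReal (∑ i, ((nullMech : DetMechanism m) c).pay i) ≤
      ENNReal.ofReal G.budget := by
    have hl : 0 < 1 + Real.log G.total := by linarith [log_total_nonneg G]
    simp only [nullMech, Pi.zero_apply, Finset.sum_const_zero, ENNReal.ofReal_zero, mul_zero,
      add_zero]
    rw [← ENNReal.ofReal_mul (by positivity)]
    refine ENNReal.ofReal_le_ofReal ?_
    rw [one_div_mul_eq_div, div_le_iff₀ hl]
    exact oneMech_pay_le hG c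
  calc _ ≤ 2⁻¹ * ENNReal.ofReal G.budget + 2⁻¹ * ENNReal.ofReal G.budget := by gcongr
    _ = ENNReal.ofReal G.budget := by
      rw [← add_mul, ENNReal.inv_two_add_inv_two, one_mul]

end Procurement

/-! ### Approximation by `aMax` and acceptance in random sampling -/

namespace Procurement

variable {m : ℕ} {G : Game m} {D : DemandFn m}

/-! ## Restrictions of allocations -/

open Classical in
/-- The allocation `A` restricted to the players in `Q`. -/
def restrict (Q : Finset (Fin m)) (A : Fin m → ℕ) : Fin m → ℕ := fun i => if i ∈ Q then A i else 0

theorem restrict_le (Q : Finset (Fin m)) (A : Fin m → ℕ) (i : Fin m) : restrict Q A i ≤ A i := by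
  unfold restrict; split_ifs <;> simp

theorem restrict_of_notMem {Q : Finset (Fin m)} (A : Fin m → ℕ) {i : Fin m} (h : i ∉ Q) :
    restrict Q A i = 0 := if_neg h

theorem restrict_of_mem {Q : Finset (Fin m)} (A : Fin m → ℕ) {i : Fin m} (h : i ∈ Q) :
    restrict Q A i = A i := if_pos h

theorem restrict_isAlloc (Q : Finset (Fin m)) {A : Fin m → ℕ} (hA : G.IsAlloc A) :
    G.IsAlloc (restrict Q A) := fun i => (restrict_le Q A i).trans (hA i)

theorem restrict_eq_self {Q : Finset (Fin m)} {A : Fin m → ℕ} (h : ∀ i, i ∉ Q → A i = 0) :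
    restrict Q A = A := by
  funext i
  by_cases hi : i ∈ Q
  · exact restrict_of_mem A hi
  · rw [restrict_of_notMem A hi, h i hi]

theorem restrict_empty (A : Fin m → ℕ) : restrict ∅ A = 0 := by
  funext i; simp [restrict]

theorem sum_restrict (Q : Finset (Fin m)) (A : Fin m → ℕ) (c : Fin m → ℝ) :
    ∑ i, (restrict Q A i : ℝ) * c i = ∑ i ∈ Q, (A i : ℝ) * c i := by
  classical
  rw [← Finset.sum_subset (Finset.subset_univ Q)]
  · exact Finset.sum_congr rfl (fun i hi => by rw [restrict_of_mem A hi])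
  · intro i _ hi; rw [restrict_of_notMem A hi]; simp

theorem val_restrict_mono (hG : G.Proper) {A : Fin m → ℕ} (hA : G.IsAlloc A)
    {Q R : Finset (Fin m)} (h : Q ⊆ R) : G.val (restrict Q A) ≤ G.val (restrict R A) := by
  refine hG.val_mono _ _ (restrict_isAlloc Q hA) (restrict_isAlloc R hA) (fun i => ?_)
  by_cases hi : i ∈ Q
  · rw [restrict_of_mem A hi, restrict_of_mem A (h hi)]
  · rw [restrict_of_notMem A hi]; exact Nat.zero_le _

theorem val_restrict_union (hS : G.SubAdditive) {A : Fin m → ℕ} (hA : G.IsAlloc A)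
    {P Q R : Finset (Fin m)} (h : ∀ i ∈ P, i ∈ Q ∨ i ∈ R) (hQ : Q ⊆ P) (hR : R ⊆ P) :
    G.val (restrict P A) ≤ G.val (restrict Q A) + G.val (restrict R A) := by
  have := hS _ _ (restrict_isAlloc Q hA) (restrict_isAlloc R hA)
  convert this using 2
  funext i
  by_cases hi : i ∈ P
  · rcases h i hi with h' | h'
    · rw [restrict_of_mem A hi, restrict_of_mem A h', max_eq_left (restrict_le R A i)]
    · rw [restrict_of_mem A hi, restrict_of_mem A h', max_eq_right (restrict_le Q A i)]
  · rw [restrict_of_notMem A hi, restrict_of_notMem A (fun h' => hi (hQ h')),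
      restrict_of_notMem A (fun h' => hi (hR h'))]
    rfl

theorem restrict_singleton (A : Fin m → ℕ) (i : Fin m) : restrict {i} A = single i (A i) := by
  funext j
  unfold restrict single
  by_cases hj : j = i
  · subst hj; simp
  · simp [hj]

theorem val_restrict_le_sum (hG : G.Proper) (hS : G.SubAdditive) {A : Fin m → ℕ}
    (hA : G.IsAlloc A) (Q : Finset (Fin m)) :
    G.val (restrict Q A) ≤ ∑ i ∈ Q, G.val (single i (A i)) := by
  classical
  induction Q using Finset.induction_on with
  | empty => simp [restrict_empty, hG.val_zero]
  | insert a Q ha ih =>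
    rw [Finset.sum_insert ha, ← restrict_singleton A a]
    refine le_trans (val_restrict_union hS hA (Q := {a}) (R := Q) ?_ ?_ ?_) (by gcongr)
    · intro i hi
      rcases Finset.mem_insert.mp hi with h | h
      · exact Or.inl (Finset.mem_singleton.mpr h)
      · exact Or.inr h
    · simp
    · exact Finset.subset_insert _ _

theorem val_single_mono (hG : G.Proper) {i : Fin m} {a b : ℕ} (h : a ≤ b) (hb : b ≤ G.units i) :
    G.val (single i a) ≤ G.val (single i b) :=
  hG.val_mono _ _ (Game.isAlloc_single (h.trans hb)) (Game.isAlloc_single hb) (fun j => by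
    unfold single
    by_cases hj : j = i
    · subst hj; simpa using h
    · simp [hj])

/-! ## The approximation guarantee of `A_Max` -/

/-- For the right guess `v` with `v ≤ V(A) < 2v`, the prices charge `A` at most `v/2`, so the demand
set `S` has net value, and hence value, at least `v/2`. If `S` has to be cut, the prefix uses half
of the budget, and by optimality of `S` its marginal value is at least its price, which is at least
`v/4`. Hence the factor 8. -/
theorem le_aMax_of_maxSingle_le (hG : G.Proper) (hS : G.SubAdditive) (hD : IsDemandOracle G D)
    {T : Finset (Fin m)} {c : Fin m → ℝ} (hc : ∀ i ∈ T, 0 ≤ c i) {A : Fin m → ℕ}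
    (hA : Fits T (maxUnits G T c) A) (hcost : ∑ i, (A i : ℝ) * c i ≤ G.budget)
    (hpos : 0 < maxSingle G T c) (hle : maxSingle G T c ≤ G.val A) :
    G.val A ≤ 8 * G.val (aMax G D T c) := by
  classical
  set M := maxSingle G T c with hM
  have hAal : G.IsAlloc A := fun i => (hA i).1.trans (maxUnits_le G T c i)
  have hAcard : G.val A ≤ T.card * M := by
    rw [← restrict_eq_self (fun i => (hA i).2)]
    refine (val_restrict_le_sum hG hS hAal T).trans ?_
    rw [← nsmul_eq_mul]
    refine Finset.sum_le_card_nsmul _ _ _ (fun i hi => ?_)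
    exact (val_single_mono hG (hA i).1 (maxUnits_le G T c i)).trans (le_maxSingle hi)
  -- The guess is the largest multiple of `M` not above `V(A)`. The floor is at least 1 by `hle` and
  -- at most `|T|` by `hAcard`, so the guess is on the list.
  obtain ⟨j, hj⟩ : ∃ j : ℕ, j + 1 = ⌊G.val A / M⌋₊ := by
    have : 1 ≤ ⌊G.val A / M⌋₊ := by
      rw [Nat.one_le_floor_iff, le_div_iff₀ hpos]; linarith
    exact ⟨_, Nat.sub_add_cancel this⟩
  have hjle : ((j + 1 : ℕ) : ℝ) * M ≤ G.val A := by
    rw [hj, ← le_div_iff₀ hpos]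
    exact Nat.floor_le (div_nonneg (hpos.le.trans hle) hpos.le)
  have hjlt : G.val A < 2 * (((j + 1 : ℕ) : ℝ) * M) := by
    have h1 := Nat.lt_floor_add_one (G.val A / M)
    rw [← hj, div_lt_iff₀ hpos] at h1
    have h2 : M ≤ ((j + 1 : ℕ) : ℝ) * M := by
      have : (1 : ℝ) ≤ ((j + 1 : ℕ) : ℝ) := by exact_mod_cast Nat.le_add_left 1 j
      nlinarith
    nlinarith
  have hjc : j < T.card := by
    have h1 : ((j + 1 : ℕ) : ℝ) ≤ T.card := le_of_mul_le_mul_right (hjle.trans hAcard) hpos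
    have : j + 1 ≤ T.card := by exact_mod_cast h1
    omega
  refine le_trans ?_ (mul_le_mul_of_nonneg_left (guessAlloc_le_aMax G D c hjc) (by norm_num))
  rw [← hM]
  set v := ((j + 1 : ℕ) : ℝ) * M with hv
  have hv0 : 0 < v := by linarith
  have hB := hG.budget_pos
  obtain ⟨hSf, hSopt⟩ := guessDemand_spec hG hD hc hv0.le
  set S := guessDemand G D T c v with hSdef
  set p := v / (2 * G.budget) with hp
  have hp0 : 0 < p := by positivity
  have hpB : p * G.budget = v / 2 := by rw [hp]; field_simp
  have hSal : G.IsAlloc S := fun i => (hSf i).1.trans (maxUnits_le G T c i)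
  have hcS : ∑ i, (S i : ℝ) * c i = ∑ i ∈ T, (S i : ℝ) * c i := by
    rw [← sum_restrict T S c, restrict_eq_self (fun i => (hSf i).2)]
  have hSv : v / 2 ≤ G.val S := by
    have h1 := hSopt A hA
    have h2 : p * ∑ i, (A i : ℝ) * c i ≤ p * G.budget := mul_le_mul_of_nonneg_left hcost hp0.le
    have h3 : 0 ≤ p * ∑ i, (S i : ℝ) * c i := by
      rw [hcS]
      exact mul_nonneg hp0.le (Finset.sum_nonneg
        (fun i hi => mul_nonneg (Nat.cast_nonneg _) (hc i hi)))
    linarith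
  unfold guessAlloc
  rw [if_neg (not_lt.mpr hSv)]
  rw [← hSdef]
  by_cases hfit : ∑ i ∈ T, (S i : ℝ) * c i ≤ G.budget
  · rw [affordablePrefix_eq_self hc (fun i => (hSf i).2) hfit]
    linarith
  · have hhalf := half_budget_le_prefix hB.le hc
      (fun i _ => by
        have := maxUnits_mul_le hB.le T c i
        have h2 : (S i : ℝ) ≤ maxUnits G T c i := by exact_mod_cast (hSf i).1
        rcases le_or_gt 0 (c i) with h | h
        · exact (mul_le_mul_of_nonneg_right h2 h).trans this
        · exact (mul_nonpos_of_nonneg_of_nonpos (Nat.cast_nonneg _) h.le).trans hB.le)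
      (not_le.mp hfit)
    set Q := prefixSet G T c S with hQ
    have hQT : Q ⊆ T := Finset.filter_subset _ _
    have hpre : affordablePrefix G T c S = restrict Q S := by
      rw [affordablePrefix_eq]; rfl
    rw [hpre]
    -- Dropping the prefix from `S` cannot improve the net value, so the prefix adds at least its
    -- price to the value of the rest.
    have hR := hSopt (restrict (T \ Q) S) (fun i => ⟨(restrict_le _ _ i).trans (hSf i).1,
      fun hi => restrict_of_notMem _ (fun h => hi (Finset.mem_sdiff.mp h).1)⟩)
    have hsplit : G.val S ≤ G.val (restrict Q S) + G.val (restrict (T \ Q) S) := by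
      conv_lhs => rw [← restrict_eq_self (fun i => (hSf i).2)]
      refine val_restrict_union hS hSal ?_ hQT Finset.sdiff_subset
      intro i hi
      by_cases h : i ∈ Q
      · exact Or.inl h
      · exact Or.inr (Finset.mem_sdiff.mpr ⟨hi, h⟩)
    rw [sum_restrict, hcS, ← Finset.sum_sdiff hQT] at hR
    have h4 : p * (G.budget / 2) ≤ p * ∑ i ∈ Q, (S i : ℝ) * c i :=
      mul_le_mul_of_nonneg_left hhalf hp0.le
    nlinarith

theorem fits_of_cost_le {T : Finset (Fin m)} {c : Fin m → ℝ}
    (hc : ∀ i ∈ T, 0 ≤ c i) {A : Fin m → ℕ} (hA : G.IsAlloc A) (hT : ∀ i, i ∉ T → A i = 0)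
    (hcost : ∑ i, (A i : ℝ) * c i ≤ G.budget) : Fits T (maxUnits G T c) A := by
  classical
  intro i
  refine ⟨?_, hT i⟩
  by_cases hi : i ∈ T
  · unfold maxUnits
    rw [if_pos hi]
    refine le_affordable (hA i) (le_trans ?_ hcost)
    refine Finset.single_le_sum (f := fun i => (A i : ℝ) * c i) (fun j _ => ?_) (Finset.mem_univ i)
    by_cases hj : j ∈ T
    · exact mul_nonneg (Nat.cast_nonneg _) (hc j hj)
    · simp [hT j hj]
  · rw [hT i hi]; exact Nat.zero_le _

/-- `A_Max` is an 8-approximation. -/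
theorem le_aMax (hG : G.Proper) (hS : G.SubAdditive) (hD : IsDemandOracle G D)
    {T : Finset (Fin m)} {c : Fin m → ℝ} (hc : ∀ i ∈ T, 0 ≤ c i) {A : Fin m → ℕ}
    (hA : G.IsAlloc A) (hT : ∀ i, i ∉ T → A i = 0)
    (hcost : ∑ i, (A i : ℝ) * c i ≤ G.budget) :
    G.val A ≤ 8 * G.val (aMax G D T c) := by
  classical
  have hfit := fits_of_cost_le hc hA hT hcost
  have haM : 0 ≤ G.val (aMax G D T c) := hG.val_nonneg _ (aMax_isAlloc hG hD hc)
  have hA' : G.val A ≤ T.card * maxSingle G T c := by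
    rw [← restrict_eq_self hT]
    refine (val_restrict_le_sum hG hS hA T).trans ?_
    rw [← nsmul_eq_mul]
    refine Finset.sum_le_card_nsmul _ _ _ (fun i hi => ?_)
    exact (val_single_mono hG (hfit i).1 (maxUnits_le G T c i)).trans (le_maxSingle hi)
  rcases (maxSingle_nonneg G T c).eq_or_lt with h0 | hpos
  · rw [← h0] at hA'; linarith
  rcases le_or_gt (maxSingle G T c) (G.val A) with hle | hlt
  · exact le_aMax_of_maxSingle_le hG hS hD hc hfit hcost hpos hle
  -- `A` is worth less than the best single player, who is then compared with `aMax` in its place.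
  · have hTe : T.Nonempty := by
      by_contra hcon
      rw [Finset.not_nonempty_iff_eq_empty] at hcon
      subst hcon
      simp [maxSingle] at hpos
    obtain ⟨i, hi, hmax⟩ := Finset.exists_max_image T
      (fun i => G.val (single i (maxUnits G T c i))) hTe
    have hge : maxSingle G T c ≤ G.val (single i (maxUnits G T c i)) :=
      maxSingle_le (hG.val_nonneg _ (Game.isAlloc_single (maxUnits_le G T c i))) hmax
    refine hlt.le.trans (hge.trans (le_aMax_of_maxSingle_le hG hS hD hc ?_ ?_ hpos hge))
    · intro j
      unfold single
      by_cases hj : j = i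
      · subst hj
        exact ⟨by simp, fun h => absurd hi h⟩
      · simp [hj]
    · rw [Finset.sum_eq_single i]
      · simpa [single] using maxUnits_mul_le hG.budget_pos.le T c i
      · intro j _ hj; simp [single, hj]
      · simp

/-! ## Grouping players by cost -/

/-- Split the players, listed by decreasing cost, into groups that can be bought at a uniform
price.  If no group is worth more than `X`, all of them are worth at most `X` times the number of
groups, which is bounded by means of a potential function. -/
theorem val_restrict_le_of_groups (hG : G.Proper) (hS : G.SubAdditive) {c : Fin m → ℝ}
    (hc : ∀ i, 0 ≤ c i) {A : Fin m → ℕ} (hA : G.IsAlloc A) {X t n : ℝ} (hX : 0 ≤ X) (ht : 0 < t)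
    (hα : 0 < 1 - Real.log t) (hn : ∑ i, (A i : ℝ) ≤ n)
    (hgood : ∀ Q : Finset (Fin m), ∀ e ∈ Q, (∀ l ∈ Q, c l ≤ c e) →
      c e * ∑ l ∈ Q, (A l : ℝ) ≤ G.budget → G.val (restrict Q A) ≤ X) :
    ∀ k : ℕ, ∀ R : Finset (Fin m), R.card = k → ∀ e ∈ R, (∀ l ∈ R, RankLE c e l) →
      (∀ l ∈ R, (A l : ℝ) * c l ≤ G.budget) → G.budget < c e * ∑ l ∈ R, (A l : ℝ) →
      G.val (restrict R A) ≤ X * (2 + ((2 * ∑ l ∈ R, (A l : ℝ) * c l - A e * c e) / (t * G.budget)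
        + Real.log (n * c e / G.budget)) / (1 - Real.log t)) := by
  classical
  intro k
  induction k using Nat.strong_induction_on with
  | _ k ih =>
  intro R hRk e he hfirst hsmall hbad
  have hB := hG.budget_pos
  have hA0 : ∀ i, (0 : ℝ) ≤ A i := fun i => Nat.cast_nonneg _
  have hAc : ∀ i, 0 ≤ (A i : ℝ) * c i := fun i => mul_nonneg (hA0 i) (hc i)
  have hRn : ∀ R : Finset (Fin m), ∑ l ∈ R, (A l : ℝ) ≤ n := fun R =>
    (Finset.sum_le_sum_of_subset_of_nonneg (Finset.subset_univ R) (fun i _ _ => hA0 i)).trans hn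
  -- A list that is too expensive at the price of `f` forces `n * c f` above the budget, which keeps
  -- the logarithm in the potential positive.
  have hlarge : ∀ R : Finset (Fin m), ∀ f, G.budget < c f * ∑ l ∈ R, (A l : ℝ) →
      0 < c f ∧ G.budget < n * c f := by
    intro R f hf
    have h1 : c f * ∑ l ∈ R, (A l : ℝ) ≤ c f * n := mul_le_mul_of_nonneg_left (hRn R) (hc f)
    refine ⟨?_, by linarith⟩
    rcases (hc f).eq_or_lt with h | h
    · rw [← h] at hf; linarith
    · exact h
  obtain ⟨hce, hnce⟩ := hlarge R e hbad
  -- the first player that does not fit into the group of `e`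
  have hne : (R.filter (fun i => G.budget <
      c e * ∑ l ∈ R.filter (fun l => RankLE c l i), (A l : ℝ))).Nonempty := by
    obtain ⟨i, hi, hlast⟩ := exists_rank_last (key := c) ⟨e, he⟩
    refine ⟨i, Finset.mem_filter.mpr ⟨hi, ?_⟩⟩
    rw [Finset.filter_true_of_mem hlast]
    exact hbad
  obtain ⟨f, hf, hffirst⟩ := exists_rank_first (key := c) hne
  obtain ⟨hfR, hfbad⟩ := Finset.mem_filter.mp hf
  set Q := R.filter (fun l => ¬ RankLE c f l) with hQ
  set R' := R.filter (fun l => RankLE c f l) with hR'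
  have hfR' : f ∈ R' := Finset.mem_filter.mpr ⟨hfR, RankLE.refl _ _⟩
  -- The group of `e` is not empty: `e` alone fits by `hsmall`.
  have hef : ¬ RankLE c f e := by
    intro h
    have : f = e := h.antisymm (hfirst f hfR)
    subst this
    have h1 : R.filter (fun l => RankLE c l f) = {f} := by
      ext l
      simp only [Finset.mem_filter, Finset.mem_singleton]
      exact ⟨fun h => h.2.antisymm (hfirst l h.1), fun h => by rw [h]; exact ⟨hfR, RankLE.refl _ _⟩⟩
    rw [h1, Finset.sum_singleton] at hfbad
    have := hsmall f hfR
    linarith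
  have heQ : e ∈ Q := Finset.mem_filter.mpr ⟨he, hef⟩
  have hQR : Q ⊆ R := Finset.filter_subset _ _
  have hR'R : R' ⊆ R := Finset.filter_subset _ _
  have hsumA : ∀ g : Fin m → ℝ, ∑ l ∈ R, g l = ∑ l ∈ Q, g l + ∑ l ∈ R', g l := by
    intro g
    rw [add_comm]
    exact (Finset.sum_filter_add_sum_filter_not R (fun l => RankLE c f l) g).symm
  -- The last member of `Q` comes before `f`, so it passed the test, and all of `Q` is among its
  -- predecessors.
  have hQgood : c e * ∑ l ∈ Q, (A l : ℝ) ≤ G.budget := by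
    obtain ⟨i, hi, hlast⟩ := exists_rank_last (key := c) ⟨e, heQ⟩
    obtain ⟨hiR, hif⟩ := Finset.mem_filter.mp hi
    have hni : ¬ G.budget < c e * ∑ l ∈ R.filter (fun l => RankLE c l i), (A l : ℝ) :=
      fun h => hif (hffirst i (Finset.mem_filter.mpr ⟨hiR, h⟩))
    refine le_trans (mul_le_mul_of_nonneg_left ?_ (hc e)) (not_lt.mp hni)
    refine Finset.sum_le_sum_of_subset_of_nonneg ?_ (fun i _ _ => hA0 i)
    intro l hl
    exact Finset.mem_filter.mpr ⟨hQR hl, hlast l hl⟩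
  have hQX : G.val (restrict Q A) ≤ X :=
    hgood Q e heQ (fun l hl => (hfirst l (hQR hl)).key_le) hQgood
  have hsplit : G.val (restrict R A) ≤ X + G.val (restrict R' A) := by
    have := val_restrict_union hS hA (P := R) (Q := Q) (R := R') (fun i hi => by
      by_cases h : RankLE c f i
      · exact Or.inr (Finset.mem_filter.mpr ⟨hi, h⟩)
      · exact Or.inl (Finset.mem_filter.mpr ⟨hi, h⟩)) hQR hR'R
    linarith
  have htB : 0 < t * G.budget := mul_pos ht hB
  have hfirstcost : (A e : ℝ) * c e ≤ ∑ l ∈ Q, (A l : ℝ) * c l :=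
    Finset.single_le_sum (f := fun l => (A l : ℝ) * c l) (fun l _ => hAc l) heQ
  have hR'0 : 0 ≤ ∑ l ∈ R', (A l : ℝ) * c l := Finset.sum_nonneg (fun l _ => hAc l)
  have hlogpos : 0 ≤ Real.log (n * c e / G.budget) := by
    apply Real.log_nonneg
    rw [le_div_iff₀ hB]; linarith
  -- If the rest is a single group, two groups suffice; they are the 2 in the bound, and the
  -- potential is non-negative.
  by_cases hgoodR' : c f * ∑ l ∈ R', (A l : ℝ) ≤ G.budget
  · have h1 : G.val (restrict R' A) ≤ X :=
      hgood R' f hfR' (fun l hl => (Finset.mem_filter.mp hl).2.key_le) hgoodR'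
    have h2 : 0 ≤ ((2 * ∑ l ∈ R, (A l : ℝ) * c l - A e * c e) / (t * G.budget)
        + Real.log (n * c e / G.budget)) / (1 - Real.log t) := by
      refine div_nonneg (add_nonneg (div_nonneg ?_ htB.le) hlogpos) hα.le
      rw [hsumA]; linarith [hAc e]
    nlinarith
  · push Not at hgoodR'
    obtain ⟨hcf, hncf⟩ := hlarge R' f hgoodR'
    have hcard : R'.card < k := by
      rw [← hRk]
      refine Finset.card_lt_card ⟨hR'R, fun h => ?_⟩
      exact hef (Finset.mem_filter.mp (h he)).2
    have hih := ih _ hcard R' rfl f hfR' (fun l hl => (Finset.mem_filter.mp hl).2)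
      (fun l hl => hsmall l (hR'R hl)) hgoodR'
    -- `Q` together with `f` overflows at the price `c e`. Scaling by `c f / c e` prices all these
    -- units at `c f`, at most their true costs.
    have hratio : G.budget * (c f / c e) ≤ ∑ l ∈ Q, (A l : ℝ) * c l + A f * c f := by
      have h1 : ∑ l ∈ R.filter (fun l => RankLE c l f), (A l : ℝ) ≤
          ∑ l ∈ insert f Q, (A l : ℝ) := by
        refine Finset.sum_le_sum_of_subset_of_nonneg ?_ (fun i _ _ => hA0 i)
        intro l hl
        obtain ⟨hl1, hl2⟩ := Finset.mem_filter.mp hl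
        by_cases h : RankLE c f l
        · rw [hl2.antisymm h]; exact Finset.mem_insert_self _ _
        · exact Finset.mem_insert_of_mem (Finset.mem_filter.mpr ⟨hl1, h⟩)
      have hfQ : f ∉ Q := fun h => (Finset.mem_filter.mp h).2 (RankLE.refl _ _)
      rw [Finset.sum_insert hfQ] at h1
      have h2 : c f * ∑ l ∈ Q, (A l : ℝ) ≤ ∑ l ∈ Q, (A l : ℝ) * c l := by
        rw [Finset.mul_sum]
        refine Finset.sum_le_sum (fun l hl => ?_)
        have : c f ≤ c l := by
          rcases RankLE.total c l f with h | h
          · exact h.key_le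
          · exact absurd h (Finset.mem_filter.mp hl).2
        nlinarith [hA0 l]
      have h3 : G.budget * (c f / c e) ≤
          c f * ∑ l ∈ R.filter (fun l => RankLE c l f), (A l : ℝ) := by
        rw [mul_div_assoc', div_le_iff₀ hce]
        nlinarith
      nlinarith
    have hlog : Real.log (n * c e / G.budget) = Real.log (n * c f / G.budget)
        - Real.log (c f / c e) := by
      have h1 : n * c e ≠ 0 := by linarith
      have h2 : n * c f ≠ 0 := by linarith
      have hn0 : n ≠ 0 := left_ne_zero_of_mul h1
      rw [Real.log_div h1 hB.ne', Real.log_div h2 hB.ne', Real.log_div hcf.ne' hce.ne',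
        Real.log_mul hn0 hce.ne', Real.log_mul hn0 hcf.ne']
      ring
    -- With `r = c f / c e`, the cost part of the potential falls by at least `r / t` and the
    -- logarithmic part by `-log r`. The sum is least at `r = t`, so every group uses up at least `1
    -- - log t`.
    have hkey : 1 - Real.log t ≤ (c f / c e) / t - Real.log (c f / c e) := by
      have hr : 0 < c f / c e := div_pos hcf hce
      have h1 := Real.log_le_sub_one_of_pos (div_pos hr ht)
      rw [Real.log_div hr.ne' ht.ne'] at h1
      linarith
    -- The cost of `f` is charged both to the group before it and to its own group. This explains
    -- the factor 2 and the correction by the cost of the first player.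
    have hpot : (2 * ∑ l ∈ R', (A l : ℝ) * c l - A f * c f) / (t * G.budget) + (c f / c e) / t ≤
        (2 * ∑ l ∈ R, (A l : ℝ) * c l - A e * c e) / (t * G.budget) := by
      have h1 : (c f / c e) / t = (G.budget * (c f / c e)) / (t * G.budget) := by
        field_simp
      rw [h1, ← add_div]
      refine div_le_div_of_nonneg_right ?_ htB.le
      rw [hsumA (fun l => (A l : ℝ) * c l)]
      linarith
    have hfinal : 1 + ((2 * ∑ l ∈ R', (A l : ℝ) * c l - A f * c f) / (t * G.budget)
        + Real.log (n * c f / G.budget)) / (1 - Real.log t) ≤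
        ((2 * ∑ l ∈ R, (A l : ℝ) * c l - A e * c e) / (t * G.budget)
        + Real.log (n * c e / G.budget)) / (1 - Real.log t) := by
      rw [le_div_iff₀ hα, add_mul, div_mul_cancel₀ _ hα.ne', hlog]
      linarith
    nlinarith

/-- The number of groups is less than `8 log n / log log n`. -/
theorem groups_lt {n : ℕ} (hn : 3 ≤ n) :
    ∃ t : ℝ, 0 < t ∧ 0 < 1 - Real.log t ∧ 0 < threshold n ∧
      8 * threshold n * (2 + (2 / t + Real.log n) / (1 - Real.log t)) < 1 := by
  have hl2 : 0 < Real.log 2 := Real.log_pos (by norm_num)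
  have hl2' := Real.log_two_gt_d9
  have hl2'' := Real.log_two_lt_d9
  set x := Real.logb 2 n with hx
  have hn' : (3 : ℝ) ≤ n := by exact_mod_cast hn
  have hx1 : 1 < x := by
    rw [hx, Real.lt_logb_iff_rpow_lt (by norm_num) (by linarith)]
    norm_num; linarith
  have hlogn : Real.log n = x * Real.log 2 := by
    rw [hx, Real.logb]; field_simp
  have hu : 0 < Real.log x := Real.log_pos hx1
  have hux : Real.log x ≤ x - 1 := Real.log_le_sub_one_of_pos (by linarith)
  have hsx : 0 < Real.sqrt x := Real.sqrt_pos.mpr (by linarith)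
  have hsx1 : Real.sqrt x ≤ x := by
    rw [Real.sqrt_le_left (by linarith)]; nlinarith
  have hthr : threshold n = Real.log x / (64 * (x * Real.log 2)) := by
    unfold threshold
    rw [← hx]
    rw [show Real.logb 2 x = Real.log x / Real.log 2 from rfl]
    field_simp
  have hlogt : 1 - Real.log (2 / Real.sqrt x) = 1 - Real.log 2 + Real.log x / 2 := by
    rw [Real.log_div (by norm_num) hsx.ne', Real.log_sqrt (by linarith)]; ring
  -- With this `t` the term `2 / t = √x` is at most `x = log n`, while `-log t` grows like `(log x)
  -- / 2`; the division by it yields the `log log n`.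
  refine ⟨2 / Real.sqrt x, by positivity, ?_, ?_, ?_⟩
  · rw [hlogt]; linarith
  · rw [hthr]
    have : 0 < x := by linarith
    positivity
  · rw [hlogt, hthr, hlogn]
    have h2 : 2 / (2 / Real.sqrt x) = Real.sqrt x := by field_simp
    rw [h2]
    have h3 : (Real.sqrt x + x * Real.log 2) / (1 - Real.log 2 + Real.log x / 2) ≤
        (x + x * Real.log 2) / (Real.log x / 2) := by
      apply div_le_div₀ <;> nlinarith
    have hx0 : 0 < x := by linarith
    have h4 : 8 * (Real.log x / (64 * (x * Real.log 2))) *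
        (2 + (x + x * Real.log 2) / (Real.log x / 2)) < 1 := by
      have : 8 * (Real.log x / (64 * (x * Real.log 2))) *
        (2 + (x + x * Real.log 2) / (Real.log x / 2)) =
        (2 * Real.log x + 2 * (x + x * Real.log 2)) / (8 * (x * Real.log 2)) := by
        field_simp; ring
      -- What remains is `log x + x < 3 x log 2`, which follows from `log x ≤ x - 1` and `log 2 >
      -- 2/3`. The constant 64 of the threshold is used here.
      rw [this, div_lt_one (by positivity)]
      nlinarith
    refine lt_of_le_of_lt ?_ h4
    have : 0 ≤ 8 * (Real.log x / (64 * (x * Real.log 2))) := by positivity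
    gcongr

theorem budget_eq_mul_div (B : ℝ) {k : ℕ} (hk : 1 ≤ k) : (k : ℝ) * (B / k) = B := by
  have : (k : ℝ) ≠ 0 := by exact_mod_cast (by omega : k ≠ 0)
  field_simp

/-- If the value found on `T` is positive and at most the value of some affordable allocation on
the other players, then some round accepts. -/
theorem exists_accepts (hG : G.Proper) (hS : G.SubAdditive) (hD : IsDemandOracle G D)
    (hn : 3 ≤ G.total) {c : Fin m → ℝ} (hc : ∀ i, 0 ≤ c i) {T : Finset (Fin m)} {A : Fin m → ℕ}
    (hA : G.IsAlloc A) (hT : ∀ i ∈ T, A i = 0) (hcost : ∑ i, (A i : ℝ) * c i ≤ G.budget)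
    (hpos : 0 < G.val (aMax G D T c)) (hle : G.val (aMax G D T c) ≤ G.val A) :
    ∃ k, 1 ≤ k ∧ k ≤ ∑ i ∈ Tᶜ, G.units i ∧ Accepts G D T c k := by
  classical
  by_contra! hcon
  obtain ⟨t, ht, hα, hthr, hlt⟩ := groups_lt hn
  set v := G.val (aMax G D T c) with hv
  -- Players selling no unit are left out because their costs may exceed the budget.
  set P : Finset (Fin m) := Finset.univ.filter (fun i => 1 ≤ A i) with hP
  have hB := hG.budget_pos
  have hX : 0 ≤ 8 * (threshold G.total * v) := by positivity
  have hAc : ∀ i, 0 ≤ (A i : ℝ) * c i := fun i => mul_nonneg (Nat.cast_nonneg _) (hc i)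
  have hsmall : ∀ i, (A i : ℝ) * c i ≤ G.budget := fun i =>
    (Finset.single_le_sum (f := fun i => (A i : ℝ) * c i) (fun i _ => hAc i)
      (Finset.mem_univ i)).trans hcost
  have hAn : ∑ i, (A i : ℝ) ≤ G.total := by
    unfold Game.total
    push_cast
    exact Finset.sum_le_sum (fun i _ => by exact_mod_cast hA i)
  have hgood : ∀ Q : Finset (Fin m), ∀ e ∈ Q, (∀ l ∈ Q, c l ≤ c e) →
      c e * ∑ l ∈ Q, (A l : ℝ) ≤ G.budget →
      G.val (restrict Q A) ≤ 8 * (threshold G.total * v) := by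
    intro Q e _ hmax hcQ
    -- The group is compared with round `K`: all its costs are at most `B / K`, and its `K` units
    -- cost exactly the budget at that price. As round `K` rejects, the factor 8 of `aMax` bounds
    -- the group.
    set K := ∑ l ∈ Q, A l with hK
    rcases Nat.eq_zero_or_pos K with h0 | hK1
    · have : restrict Q A = 0 := by
        funext i
        by_cases hi : i ∈ Q
        · rw [restrict_of_mem A hi]
          exact Finset.sum_eq_zero_iff.mp h0 i hi
        · rw [restrict_of_notMem A hi]; rfl
      rw [this, hG.val_zero]; exact hX
    · have hKle : K ≤ ∑ i ∈ Tᶜ, G.units i := by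
        have h1 : K ≤ ∑ i, A i := Finset.sum_le_sum_of_subset (Finset.subset_univ Q)
        have h2 : ∑ i, A i = ∑ i ∈ Tᶜ, A i := by
          refine (Finset.sum_subset (Finset.subset_univ _) (fun i _ hi => ?_)).symm
          exact hT i (by simpa using hi)
        rw [h2] at h1
        exact h1.trans (Finset.sum_le_sum (fun i _ => hA i))
      have hnacc := hcon K hK1 hKle
      have hle8 : G.val (restrict Q A) ≤ 8 * G.val (roundAlloc G D T c K) := by
        unfold roundAlloc
        refine le_aMax hG hS hD (fun _ _ => roundPrice_nonneg hG K) (restrict_isAlloc Q hA) ?_ ?_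
        · intro i hi
          by_cases hiQ : i ∈ Q
          · rw [restrict_of_mem A hiQ]
            by_contra hAi
            refine hi (Finset.mem_filter.mpr ⟨?_, ?_⟩)
            · rw [Finset.mem_compl]
              exact fun h => hAi (hT i h)
            · unfold roundPrice
              have hK0 : (0 : ℝ) < K := by exact_mod_cast hK1
              rw [le_div_iff₀ hK0]
              refine le_trans (mul_le_mul_of_nonneg_right (hmax i hiQ) hK0.le) ?_
              rw [hK]; push_cast; exact hcQ
          · exact restrict_of_notMem A hiQ
        · rw [sum_restrict, ← Finset.sum_mul, ← Nat.cast_sum, ← hK]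
          unfold roundPrice
          rw [budget_eq_mul_div _ hK1]
      have : ¬ threshold G.total * v ≤ G.val (roundAlloc G D T c K) := hnacc
      linarith
  have hPA : restrict P A = A := restrict_eq_self (fun i hi => by
    simp only [hP, Finset.mem_filter, Finset.mem_univ, true_and] at hi
    omega)
  have hPne : P.Nonempty := by
    by_contra hne
    rw [Finset.not_nonempty_iff_eq_empty] at hne
    rw [hne, restrict_empty] at hPA
    rw [← hPA, hG.val_zero] at hle
    linarith
  obtain ⟨e, he, hfirst⟩ := exists_rank_first (key := c) hPne
  have hbound : 2 ≤ 2 + (2 / t + Real.log G.total) / (1 - Real.log t) := by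
    have : 0 ≤ (2 / t + Real.log G.total) / (1 - Real.log t) :=
      div_nonneg (add_nonneg (by positivity) (log_total_nonneg G)) hα.le
    linarith
  have hval : G.val A ≤ 8 * (threshold G.total * v) *
      (2 + (2 / t + Real.log G.total) / (1 - Real.log t)) := by
    by_cases hall : c e * ∑ l ∈ P, (A l : ℝ) ≤ G.budget
    · have := hgood P e he (fun l hl => (hfirst l hl).key_le) hall
      rw [hPA] at this
      nlinarith
    · push Not at hall
      have hmain := val_restrict_le_of_groups hG hS hc hA hX ht hα hAn hgood _ P rfl e he hfirst
        (fun l _ => hsmall l) hall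
      rw [hPA] at hmain
      refine hmain.trans (mul_le_mul_of_nonneg_left ?_ hX)
      have hcpos : 0 < c e := by
        rcases (hc e).eq_or_lt with h | h
        · rw [← h] at hall; linarith
        · exact h
      -- `e` sells at least one unit, so the initial logarithm is at most `log n`.
      have hceB : c e ≤ G.budget := by
        have h1 : (1 : ℝ) ≤ A e := by
          exact_mod_cast (Finset.mem_filter.mp he).2
        have := hsmall e
        nlinarith
      have hsumP : ∑ l ∈ P, (A l : ℝ) * c l ≤ G.budget :=
        (Finset.sum_le_sum_of_subset_of_nonneg (Finset.subset_univ P)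
          (fun i _ _ => hAc i)).trans hcost
      have hn0 : (0 : ℝ) < G.total := by exact_mod_cast (by omega : 0 < G.total)
      gcongr 2 + ?_ / (1 - Real.log t)
      refine add_le_add ?_ ?_
      · rw [div_le_div_iff₀ (by positivity) ht]
        have := hAc e
        nlinarith
      · refine Real.log_le_log (by positivity) ?_
        rw [div_le_iff₀ hB]
        exact mul_le_mul_of_nonneg_left hceB hn0.le
  -- By `groups_lt` the coefficient of `v` is below 1, contradicting `v ≤ V(A)`.
  have : 8 * (threshold G.total * v) * (2 + (2 / t + Real.log G.total) / (1 - Real.log t)) =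
      (8 * threshold G.total * (2 + (2 / t + Real.log G.total) / (1 - Real.log t))) * v := by ring
  nlinarith

end Procurement

/-! ### Random splitting and the approximation ratio of the mechanism -/

namespace Procurement

variable {m : ℕ} {G : Game m} {D : DemandFn m}

/-! ## Splitting a valuable set of players at random -/

/-- There is a best affordable allocation on every set of players. -/
theorem exists_best (hG : G.Proper) (c : Fin m → ℝ) (T : Finset (Fin m)) :
    ∃ A, (G.IsAlloc A ∧ (∀ i, i ∉ T → A i = 0) ∧ ∑ i, (A i : ℝ) * c i ≤ G.budget) ∧
      ∀ A', G.IsAlloc A' → (∀ i, i ∉ T → A' i = 0) → ∑ i, (A' i : ℝ) * c i ≤ G.budget →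
        G.val A' ≤ G.val A := by
  have hfin : {A : Fin m → ℕ | G.IsAlloc A ∧ (∀ i, i ∉ T → A i = 0) ∧
      ∑ i, (A i : ℝ) * c i ≤ G.budget}.Finite :=
    (Set.finite_Iic G.units).subset (fun A hA => hA.1)
  obtain ⟨A, hA, hmax⟩ := Set.exists_max_image _ G.val hfin
    ⟨0, G.isAlloc_zero, fun _ _ => rfl, by simpa using hG.budget_pos.le⟩
  exact ⟨A, hA, fun A' h1 h2 h3 => hmax A' ⟨h1, h2, h3⟩⟩

/-- If no single player is worth too much, the players can be split into two valuable groups. -/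
theorem exists_split (hG : G.Proper) (hS : G.SubAdditive) {A : Fin m → ℕ} (hA : G.IsAlloc A)
    (hpos : 0 < G.val A) (hsmall : ∀ i, G.val (single i (A i)) ≤ G.val A / 4) :
    ∃ S : Finset (Fin m), G.val A / 4 ≤ G.val (restrict S A) ∧
      G.val A / 4 ≤ G.val (restrict Sᶜ A) := by
  classical
  have hu : restrict Finset.univ A = A := restrict_eq_self (by simp)
  have hne : ((Finset.univ : Finset (Finset (Fin m))).filter
      (fun S => G.val A / 4 ≤ G.val (restrict S A))).Nonempty :=
    ⟨Finset.univ, by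
      simp only [Finset.mem_filter, Finset.mem_univ, true_and, hu]; linarith⟩
  -- In a smallest such set, removing any one player leaves less than a quarter and that player is
  -- worth at most a quarter. So `S` is worth less than a half, and the complement more than a half.
  obtain ⟨S, hS1, hmin⟩ := Finset.exists_min_image _ Finset.card hne
  have hS2 := (Finset.mem_filter.mp hS1).2
  refine ⟨S, hS2, ?_⟩
  have hSne : S.Nonempty := by
    by_contra hcon
    rw [Finset.not_nonempty_iff_eq_empty] at hcon
    rw [hcon, restrict_empty, hG.val_zero] at hS2
    linarith
  obtain ⟨i, hi⟩ := hSne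
  have herase : G.val (restrict (S.erase i) A) < G.val A / 4 := by
    by_contra hcon
    have := hmin (S.erase i) (Finset.mem_filter.mpr ⟨Finset.mem_univ _, not_lt.mp hcon⟩)
    have := Finset.card_erase_lt_of_mem hi
    omega
  have h1 : G.val (restrict S A) ≤ G.val (restrict {i} A) + G.val (restrict (S.erase i) A) := by
    refine val_restrict_union hS hA ?_ (by simpa using hi) (Finset.erase_subset _ _)
    intro j hj
    by_cases hji : j = i
    · exact Or.inl (by simpa using hji)
    · exact Or.inr (Finset.mem_erase.mpr ⟨hji, hj⟩)
  have h2 : G.val (restrict Finset.univ A) ≤ G.val (restrict S A) + G.val (restrict Sᶜ A) := by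
    refine val_restrict_union hS hA ?_ (Finset.subset_univ _) (Finset.subset_univ _)
    intro j _
    by_cases hj : j ∈ S
    · exact Or.inl hj
    · exact Or.inr (Finset.mem_compl.mpr hj)
  rw [restrict_singleton] at h1
  rw [hu] at h2
  have := hsmall i
  linarith

open Classical in
/-- Out of `T` and `T ∆ S`, one splits the value evenly up to a constant. -/
theorem balanced_or (hG : G.Proper) (hS : G.SubAdditive) {A : Fin m → ℕ} (hA : G.IsAlloc A)
    {S : Finset (Fin m)} {x : ℝ} (h1 : 2 * x ≤ G.val (restrict S A))
    (h2 : 2 * x ≤ G.val (restrict Sᶜ A)) (T : Finset (Fin m)) :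
    (x ≤ G.val (restrict T A) ∧ x ≤ G.val (restrict Tᶜ A)) ∨
      (x ≤ G.val (restrict (symmDiff T S) A) ∧ x ≤ G.val (restrict (symmDiff T S)ᶜ A)) := by
  have hsplit : ∀ R : Finset (Fin m), 2 * x ≤ G.val (restrict R A) →
      x ≤ G.val (restrict (R ∩ T) A) ∨ x ≤ G.val (restrict (R \ T) A) := by
    intro R hR
    have := val_restrict_union hS hA (P := R) (Q := R ∩ T) (R := R \ T) (fun i hi => by
      by_cases h : i ∈ T
      · exact Or.inl (Finset.mem_inter.mpr ⟨hi, h⟩)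
      · exact Or.inr (Finset.mem_sdiff.mpr ⟨hi, h⟩)) Finset.inter_subset_left Finset.sdiff_subset
    by_contra! hcon
    linarith
  have hm : ∀ {Q R : Finset (Fin m)}, Q ⊆ R → x ≤ G.val (restrict Q A) →
      x ≤ G.val (restrict R A) := fun h hx => hx.trans (val_restrict_mono hG hA h)
  -- `T` cuts both `S` and its complement, and each has a heavy piece. If the pieces lie on
  -- different sides of `T`, then `T` is balanced; if on the same side, toggling `S` moves one of
  -- them across.
  rcases hsplit S h1 with ha | ha <;> rcases hsplit Sᶜ h2 with hb | hb
  · refine Or.inr ⟨hm ?_ hb, hm ?_ ha⟩ <;> intro i <;> simp [Finset.mem_symmDiff] <;> tauto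
  · refine Or.inl ⟨hm ?_ ha, hm ?_ hb⟩ <;> intro i <;> simp
  · refine Or.inl ⟨hm ?_ hb, hm ?_ ha⟩ <;> intro i <;> simp
  · refine Or.inr ⟨hm ?_ ha, hm ?_ hb⟩ <;> intro i <;> simp [Finset.mem_symmDiff] <;> tauto

/-- Random sampling succeeds on `T` or on its complement if both contain valuable allocations. -/
theorem le_val_randMech_or (hG : G.Proper) (hS : G.SubAdditive) (hD : IsDemandOracle G D)
    (hn : 3 ≤ G.total) {c : Fin m → ℝ} (hc : ∀ i, 0 ≤ c i) {A : Fin m → ℕ} (hA : G.IsAlloc A)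
    (hcost : ∑ i, (A i : ℝ) * c i ≤ G.budget) {x : ℝ} (hx : 0 < x) {T : Finset (Fin m)}
    (h1 : x ≤ G.val (restrict T A)) (h2 : x ≤ G.val (restrict Tᶜ A)) :
    threshold G.total * (x / 8) ≤ G.val (randMech G D T c).alloc ∨
      threshold G.total * (x / 8) ≤ G.val (randMech G D Tᶜ c).alloc := by
  classical
  obtain ⟨t, _, _, hthr, _⟩ := groups_lt hn
  have hcostR : ∀ Q : Finset (Fin m), ∑ i, (restrict Q A i : ℝ) * c i ≤ G.budget := by
    intro Q
    refine le_trans (Finset.sum_le_sum (fun i _ => ?_)) hcost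
    exact mul_le_mul_of_nonneg_right (by exact_mod_cast restrict_le Q A i) (hc i)
  -- Sampling on the side with the smaller optimum guarantees that the benchmark does not exceed the
  -- other optimum, so some round accepts. Acceptance alone then secures the threshold times `x /
  -- 8`.
  have key : ∀ U : Finset (Fin m), x ≤ G.val (restrict U A) → ∀ O O' : Fin m → ℕ,
      (∀ A', G.IsAlloc A' → (∀ i, i ∉ U → A' i = 0) → ∑ i, (A' i : ℝ) * c i ≤ G.budget →
        G.val A' ≤ G.val O) →
      G.IsAlloc O' → (∀ i ∈ U, O' i = 0) → ∑ i, (O' i : ℝ) * c i ≤ G.budget →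
      G.val O ≤ G.val O' → threshold G.total * (x / 8) ≤ G.val (randMech G D U c).alloc := by
    intro U hU O O' hO hO'1 hO'2 hO'3 hOO'
    have hcU : ∀ i ∈ U, 0 ≤ c i := fun i _ => hc i
    have hv8 : x ≤ 8 * G.val (aMax G D U c) :=
      hU.trans (le_aMax hG hS hD hcU (restrict_isAlloc U hA)
        (fun i hi => restrict_of_notMem A hi) (hcostR U))
    have hvO : G.val (aMax G D U c) ≤ G.val O :=
      hO _ (aMax_isAlloc hG hD hcU) (fun i hi => (aMax_fits hG hD hcU i).2 hi)
        (aMax_cost_le hG D hcU)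
    obtain ⟨k, hk1, hk2, hk3⟩ := exists_accepts hG hS hD hn hc hO'1 hO'2 hO'3 (by linarith)
      (hvO.trans hOO')
    rcases randMech_cases G D U c with ⟨k', _, _, hacc, _, h⟩ | ⟨hno, _⟩
    · rw [h]
      refine le_trans ?_ hacc
      exact mul_le_mul_of_nonneg_left (by linarith) hthr.le
    · exact absurd hk3 (hno k hk1 hk2)
  obtain ⟨O, ⟨hO1, hO2, hO3⟩, hO4⟩ := exists_best hG c T
  obtain ⟨O', ⟨hO'1, hO'2, hO'3⟩, hO'4⟩ := exists_best hG c Tᶜ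
  rcases le_total (G.val O) (G.val O') with h | h
  · exact Or.inl (key T h1 O O' hO4 hO'1 (fun i hi => hO'2 i (by simpa using hi)) hO'3 h)
  · exact Or.inr (key Tᶜ h2 O' O hO'4 hO1 (fun i hi => hO2 i (by simpa using hi)) hO3 h)

open Classical in
/-- If out of `T`, its complement and their symmetric differences with `S` one always has value at
least `β`, the average is at least `β / 4`. -/
theorem le_expect_of_symm {g : Finset (Fin m) → ENNReal} {β : ENNReal} (S : Finset (Fin m))
    (h : ∀ T, β ≤ g T ∨ β ≤ g Tᶜ ∨ β ≤ g (symmDiff T S) ∨ β ≤ g (symmDiff T S)ᶜ) :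
    β ≤ 4 * expect (PMF.uniformOfFintype (Finset (Fin m))) g := by
  have hle : ∀ T, β ≤ g T + g Tᶜ + g (symmDiff T S) + g (symmDiff T S)ᶜ := by
    intro T
    rcases h T with h | h | h | h
    · exact h.trans (by rw [add_assoc, add_assoc]; exact le_self_add)
    · exact h.trans (by
        rw [add_assoc, add_comm (g T), add_assoc]; exact le_self_add)
    · exact h.trans (le_trans le_add_self le_self_add)
    · exact h.trans le_add_self
  have hc : Function.Involutive (fun T : Finset (Fin m) => Tᶜ) := compl_involutive
  have hs : Function.Involutive (fun T : Finset (Fin m) => symmDiff T S) := fun T => by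
    simp
  -- Complementing and toggling `S` are involutions, so all four sums agree.
  have e1 : ∑ T, g Tᶜ = ∑ T, g T := Equiv.sum_comp hc.toPerm g
  have e2 : ∑ T, g (symmDiff T S) = ∑ T, g T := Equiv.sum_comp hs.toPerm g
  have e3 : ∑ T, g (symmDiff T S)ᶜ = ∑ T, g T :=
    (Equiv.sum_comp hs.toPerm (fun T => g Tᶜ)).trans e1
  have hsum : ∑ _T : Finset (Fin m), β ≤ 4 * ∑ T, g T := by
    calc ∑ _T : Finset (Fin m), β
        ≤ ∑ T, (g T + g Tᶜ + g (symmDiff T S) + g (symmDiff T S)ᶜ) :=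
          Finset.sum_le_sum (fun T _ => hle T)
      _ = 4 * ∑ T, g T := by
          rw [Finset.sum_add_distrib, Finset.sum_add_distrib, Finset.sum_add_distrib, e1, e2, e3]
          ring
  unfold expect
  rw [tsum_fintype]
  simp only [PMF.uniformOfFintype_apply]
  rw [← Finset.mul_sum, mul_left_comm]
  rw [Finset.sum_const, Finset.card_univ, nsmul_eq_mul] at hsum
  calc β = (Fintype.card (Finset (Fin m)) : ENNReal)⁻¹ * (Fintype.card (Finset (Fin m)) * β) := by
        rw [← mul_assoc, ENNReal.inv_mul_cancel (by simp) (by simp), one_mul]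
    _ ≤ _ := by gcongr

/-! ## The approximation guarantee of `M_Sub` -/

theorem exists_isFirst (G : Game m) (c : Fin m → ℝ) (j : Fin m) : ∃ i, IsFirst G c i := by
  obtain ⟨i, _, h⟩ := exists_rank_first (key := soloVal G c)
    (⟨j, Finset.mem_univ j⟩ : (Finset.univ : Finset (Fin m)).Nonempty)
  exact ⟨i, fun l => h l (Finset.mem_univ l)⟩

theorem oneMech_alloc {c : Fin m → ℝ} {i : Fin m} (h : IsFirst G c i) :
    (oneMech G c).alloc = single i (soloUnits G c i) := by
  funext j
  unfold oneMech single
  by_cases hj : j = i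
  · subst hj; simp [h]
  · have : ¬ IsFirst G c j := fun h' => hj (h'.unique h)
    simp [hj, this]

/-- `j` alone can deliver `A j` units within the budget, and the first player is worth at least as
much as `j`. -/
theorem le_val_oneMech (hG : G.Proper) {c : Fin m → ℝ} (hc : ∀ i, 0 ≤ c i) {A : Fin m → ℕ}
    (hA : G.IsAlloc A) (hcost : ∑ i, (A i : ℝ) * c i ≤ G.budget) (j : Fin m) :
    G.val (single j (A j)) ≤ G.val (oneMech G c).alloc := by
  obtain ⟨i, hi⟩ := exists_isFirst G c j
  rw [oneMech_alloc hi]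
  refine le_trans ?_ (hi j).key_le
  refine val_single_mono hG (le_affordable (hA j) ?_) (soloUnits_le G c j)
  exact (Finset.single_le_sum (f := fun i => (A i : ℝ) * c i)
    (fun i _ => mul_nonneg (Nat.cast_nonneg _) (hc i)) (Finset.mem_univ j)).trans hcost

/-- Either no player carries more than a quarter of the optimum, and random sampling loses a factor
of order log n / log log n, or some player does, and `oneMech` loses a factor of order log n. Both
are within the stated ratio. -/
theorem mSub_approximates (hG : G.Proper) (hS : G.SubAdditive) (hD : IsDemandOracle G D)
    (hn : 3 ≤ G.total) :
    (mSub G D).Approximates G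
      (40000 * (Real.logb 2 G.total ^ 2 / Real.logb 2 (Real.logb 2 G.total))) := by
  classical
  intro c hc A hopt
  obtain ⟨hA, hcost, -⟩ := hopt
  have hcost' : ∑ i, (A i : ℝ) * c i ≤ G.budget := by
    simpa only [mul_comm] using hcost
  change _ ≤ expect (mSub G D) (fun M => ENNReal.ofReal (G.val (M c).alloc))
  rw [expect_mSub]
  set x := Real.logb 2 G.total with hx
  have hn' : (3 : ℝ) ≤ G.total := by exact_mod_cast hn
  have hx1 : 1 < x := by
    rw [hx, Real.lt_logb_iff_rpow_lt (by norm_num) (by linarith)]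
    norm_num; linarith
  set y := Real.logb 2 x with hy
  have hy0 : 0 < y := Real.logb_pos (by norm_num) hx1
  have hl2 : 0 < Real.log 2 := Real.log_pos (by norm_num)
  have hyx : y ≤ 2 * x := by
    have h1 : Real.log x ≤ x := by
      have := Real.log_le_sub_one_of_pos (show 0 < x by linarith); linarith
    rw [hy, Real.logb, div_le_iff₀ hl2]
    have := Real.log_two_gt_d9
    nlinarith
  have hthr : threshold G.total = y / (64 * x) := rfl
  rcases (hG.val_nonneg A hA).eq_or_lt with h0 | hpos
  · rw [← h0]; simp
  by_cases hsmall : ∀ i, G.val (single i (A i)) ≤ G.val A / 4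
  · obtain ⟨S, hS1, hS2⟩ := exists_split hG hS hA hpos hsmall
    have hxpos : 0 < G.val A / 8 := by linarith
    have hsymm := le_expect_of_symm
      (g := fun T => ENNReal.ofReal (G.val (randMech G D T c).alloc))
      (β := ENNReal.ofReal (threshold G.total * (G.val A / 8 / 8))) S (fun T => by
        rcases balanced_or hG hS hA (S := S) (x := G.val A / 8) (by linarith) (by linarith) T with h | h
        · rcases le_val_randMech_or hG hS hD hn hc hA hcost' hxpos h.1 h.2 with h | h
          · exact Or.inl (ENNReal.ofReal_le_ofReal h)
          · exact Or.inr (Or.inl (ENNReal.ofReal_le_ofReal h))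
        · rcases le_val_randMech_or hG hS hD hn hc hA hcost' hxpos h.1 h.2 with h | h
          · exact Or.inr (Or.inr (Or.inl (ENNReal.ofReal_le_ofReal h)))
          · exact Or.inr (Or.inr (Or.inr (ENNReal.ofReal_le_ofReal h))))
    refine le_trans ?_ le_self_add
    have h4 : ENNReal.ofReal (threshold G.total * (G.val A / 8 / 8) / 4) ≤
        expect (PMF.uniformOfFintype (Finset (Fin m)))
          (fun T => ENNReal.ofReal (G.val (randMech G D T c).alloc)) := by
      rw [ENNReal.ofReal_div_of_pos (by norm_num)]
      refine ENNReal.div_le_of_le_mul' ?_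
      simpa using hsymm
    refine le_trans ?_ (mul_le_mul_right h4 _)
    have h2 : (2⁻¹ : ENNReal) = ENNReal.ofReal (1 / 2) := by
      rw [one_div, ENNReal.ofReal_inv_of_pos (by norm_num)]; simp
    rw [h2, ← ENNReal.ofReal_mul (by norm_num)]
    refine ENNReal.ofReal_le_ofReal ?_
    rw [hthr]
    have hx0 : 0 < x := by linarith
    have e1 : G.val A / (40000 * (x ^ 2 / y)) = (G.val A * y) / (40000 * x ^ 2) := by
      field_simp
    -- The factors: 1/2 for choosing `mRand`, the threshold `y / (64 x)`, 1/8 for the balanced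
    -- split, 1/8 for `aMax`, and 1/4 from the symmetrization.
    have e2 : 1 / 2 * (y / (64 * x) * (G.val A / 8 / 8) / 4) = (G.val A * y) / (32768 * x) := by
      field_simp; ring
    rw [e1, e2]
    refine div_le_div_of_nonneg_left (by positivity) (by positivity) ?_
    nlinarith
  · push Not at hsmall
    obtain ⟨j, hj⟩ := hsmall
    refine le_trans ?_ (le_add_self)
    have h1 := le_val_oneMech hG hc hA hcost' j
    refine le_trans ?_ (mul_le_mul_right le_self_add _)
    have h2 : (2⁻¹ : ENNReal) = ENNReal.ofReal (1 / 2) := by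
      rw [one_div, ENNReal.ofReal_inv_of_pos (by norm_num)]; simp
    have hlog : Real.log G.total ≤ x := by
      have h3 : Real.log G.total = x * Real.log 2 := by
        rw [hx, Real.logb]; field_simp
      have := Real.log_two_lt_d9
      rw [h3]; nlinarith
    have hl0 := log_total_nonneg G
    rw [h2, ← ENNReal.ofReal_mul (by positivity), ← ENNReal.ofReal_mul (by norm_num)]
    refine ENNReal.ofReal_le_ofReal ?_
    have hx0 : 0 < x := by linarith
    have e1 : G.val A / (40000 * (x ^ 2 / y)) = (G.val A * y) / (40000 * x ^ 2) := by
      field_simp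
    have h5 : G.val A / 4 ≤ G.val (oneMech G c).alloc := by linarith
    -- Both 1 and `ln n` are at most `x`, the base 2 logarithm of `n`.
    have h6 : (1 : ℝ) / (2 * x) ≤ 1 / (1 + Real.log G.total) :=
      one_div_le_one_div_of_le (by linarith) (by linarith)
    have h7 : 1 / 2 * (1 / (2 * x) * (G.val A / 4)) ≤
        1 / 2 * (1 / (1 + Real.log G.total) * G.val (oneMech G c).alloc) := by
      gcongr
    refine le_trans ?_ h7
    have e2 : 1 / 2 * (1 / (2 * x) * (G.val A / 4)) = G.val A / (16 * x) := by
      field_simp; ring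
    rw [e1, e2, div_le_div_iff₀ (by positivity) (by positivity)]
    have : G.val A * y * (16 * x) ≤ G.val A * (2 * x) * (16 * x) := by gcongr
    nlinarith [mul_pos hpos (mul_pos hx0 hx0)]

end Procurement

/-! ### Implementation on the random-access machine -/

namespace Procurement

namespace Machine

variable {m : ℕ}

/-! ## Deterministic runs -/

/-- `f 0`, then `f 1`, and so on up to `f (N - 1)`. -/
def runFor (f : ℕ → State → State) : ℕ → State → State
  | 0, s => s
  | N + 1, s => f N (runFor f N s)

open Classical in
/-- The effect of a program without coin flips, without regard to the number of steps. -/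
def run (D : DemandFn m) (V : (Fin m → ℕ) → ℝ) : Cmd → State → State
  | .skip, s => s
  | .setNat a i x, s => s.setNat a (i.eval s) (x.eval s)
  | .setReal a i x, s => s.setReal a (i.eval s) (x.eval s)
  | .seq p q, s => run D V q (run D V p s)
  | .ite b p q, s => if b.Holds s then run D V p s else run D V q s
  | .loop a bound body, s =>
      runFor (fun j s' => run D V body (s'.setNat a 0 j)) (bound.eval s) s
  | .flip _ _ _, s => s
  | .demand set units prices out, s => answerDemand D set units prices out s
  | .value inp out, s => s.setReal out 0 (V (fun i => s.nat inp i))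

/-- No coins are flipped. -/
def Cmd.flipFree : Cmd → Bool
  | .seq p q => p.flipFree && q.flipFree
  | .ite _ p q => p.flipFree && q.flipFree
  | .loop _ _ body => body.flipFree
  | .flip _ _ _ => false
  | _ => true

/-- The integer arrays a program may write to. -/
def Cmd.natWrites : Cmd → List ℕ
  | .setNat a _ _ => [a]
  | .seq p q => p.natWrites ++ q.natWrites
  | .ite _ p q => p.natWrites ++ q.natWrites
  | .loop a _ body => a :: body.natWrites
  | .flip a _ _ => [a]
  | .demand _ _ _ out => [out]
  | _ => []

/-- The real arrays a program may write to. -/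
def Cmd.realWrites : Cmd → List ℕ
  | .setReal a _ _ => [a]
  | .seq p q => p.realWrites ++ q.realWrites
  | .ite _ p q => p.realWrites ++ q.realWrites
  | .loop _ _ body => body.realWrites
  | .value _ out => [out]
  | _ => []

@[simp] theorem State.tick_nat (s : State) (t : ℕ) : (s.tick t).nat = s.nat := rfl
@[simp] theorem State.tick_real (s : State) (t : ℕ) : (s.tick t).real = s.real := rfl
@[simp] theorem State.setNat_real (s : State) (a i x : ℕ) : (s.setNat a i x).real = s.real := rfl
@[simp] theorem State.setReal_nat (s : State) (a i : ℕ) (x : ℝ) :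
    (s.setReal a i x).nat = s.nat := rfl

theorem State.setNat_nat (s : State) (a i x b j : ℕ) :
    (s.setNat a i x).nat b j = if b = a ∧ j = i then x else s.nat b j := by
  unfold State.setNat
  by_cases hb : b = a
  · subst hb
    by_cases hj : j = i
    · subst hj; simp
    · simp [hj]
  · simp [hb]

theorem State.setReal_real (s : State) (a i b j : ℕ) (x : ℝ) :
    (s.setReal a i x).real b j = if b = a ∧ j = i then x else s.real b j := by
  unfold State.setReal
  by_cases hb : b = a
  · subst hb
    by_cases hj : j = i
    · subst hj; simp
    · simp [hj]
  · simp [hb]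

@[simp] theorem NExp.eval_tick (s : State) (t : ℕ) (e : NExp) : e.eval (s.tick t) = e.eval s := by
  induction e with
  | lit k => rfl
  | get a i ih => simp only [NExp.eval, ih, State.tick_nat]
  | add x y hx hy => simp only [NExp.eval, hx, hy]
  | sub x y hx hy => simp only [NExp.eval, hx, hy]

@[simp] theorem RExp.eval_tick (s : State) (t : ℕ) (e : RExp) : e.eval (s.tick t) = e.eval s := by
  induction e with
  | ofNat x => simp only [RExp.eval, NExp.eval_tick]
  | get a i => simp only [RExp.eval, NExp.eval_tick, State.tick_real]
  | add x y hx hy => simp only [RExp.eval, hx, hy]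
  | sub x y hx hy => simp only [RExp.eval, hx, hy]
  | mul x y hx hy => simp only [RExp.eval, hx, hy]
  | div x y hx hy => simp only [RExp.eval, hx, hy]
  | ln x hx => simp only [RExp.eval, hx]

@[simp] theorem BExp.holds_tick (s : State) (t : ℕ) (b : BExp) : b.Holds (s.tick t) ↔ b.Holds s := by
  induction b with
  | nle x y => simp only [BExp.Holds, NExp.eval_tick]
  | rle x y => simp only [BExp.Holds, RExp.eval_tick]
  | and p q hp hq => simp only [BExp.Holds, hp, hq]
  | not p hp => simp only [BExp.Holds, hp]

theorem State.tick_tick (s : State) (t u : ℕ) : (s.tick t).tick u = s.tick (t + u) := by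
  simp [State.tick, add_assoc]

theorem runFor_tick {f : ℕ → State → State} (hf : ∀ j s t, f j (s.tick t) = (f j s).tick t)
    (N : ℕ) (s : State) (t : ℕ) : runFor f N (s.tick t) = (runFor f N s).tick t := by
  induction N with
  | zero => rfl
  | succ N ih => simp only [runFor, ih, hf]

/-- No expression reads the clock, so elapsed time can be moved out of a run. -/
theorem run_tick (D : DemandFn m) (V : (Fin m → ℕ) → ℝ) (c : Cmd) :
    ∀ (s : State) (t : ℕ), run D V c (s.tick t) = (run D V c s).tick t := by
  induction c with
  | skip => intro s t; rfl
  | setNat a i x => intro s t; simp only [run, NExp.eval_tick]; rfl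
  | setReal a i x => intro s t; simp only [run, NExp.eval_tick, RExp.eval_tick]; rfl
  | seq p q hp hq => intro s t; simp only [run, hp, hq]
  | ite b p q hp hq =>
    intro s t
    simp only [run]
    by_cases h : b.Holds s
    · rw [if_pos h, if_pos ((BExp.holds_tick s t b).mpr h), hp]
    · rw [if_neg h, if_neg (fun h' => h ((BExp.holds_tick s t b).mp h')), hq]
  | loop a bound body hb =>
    intro s t
    simp only [run, NExp.eval_tick]
    refine runFor_tick (fun j s t => ?_) _ s t
    rw [← hb]; rfl
  | flip a i p => intro s t; rfl
  | demand a b c d => intro s t; rfl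
  | value a b => intro s t; rfl

theorem repeatFor_eq {F : ℕ → State → PMF State} {f : ℕ → State → State}
    (hf : ∀ j s t, f j (s.tick t) = (f j s).tick t)
    (hF : ∀ j s, ∃ t, F j s = PMF.pure ((f j s).tick t)) (N : ℕ) (s : State) :
    ∃ t, repeatFor F N s = PMF.pure ((runFor f N s).tick t) := by
  induction N with
  | zero => exact ⟨0, rfl⟩
  | succ N ih =>
    obtain ⟨t, ht⟩ := ih
    obtain ⟨u, hu⟩ := hF N ((runFor f N s).tick t)
    refine ⟨t + u, ?_⟩
    simp only [repeatFor, ht, PMF.pure_bind, hu, hf, State.tick_tick, runFor]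

/-- Correctness of coin-free code becomes a statement about a function on states. The elapsed time
stays unspecified because `exec_time_le` bounds it. -/
theorem exec_eq_run (D : DemandFn m) (V : (Fin m → ℕ) → ℝ) {c : Cmd} (hc : c.flipFree = true) :
    ∀ s : State, ∃ t, exec D V c s = PMF.pure ((run D V c s).tick t) := by
  induction c with
  | skip => intro s; exact ⟨1, rfl⟩
  | setNat a i x => intro s; exact ⟨_, rfl⟩
  | setReal a i x => intro s; exact ⟨_, rfl⟩
  | seq p q hp hq =>
    intro s
    simp only [Cmd.flipFree, Bool.and_eq_true] at hc
    obtain ⟨t, ht⟩ := hp hc.1 s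
    obtain ⟨u, hu⟩ := hq hc.2 ((run D V p s).tick t)
    refine ⟨t + u, ?_⟩
    simp only [exec, ht, PMF.pure_bind, hu, run, run_tick, State.tick_tick]
  | ite b p q hp hq =>
    intro s
    simp only [Cmd.flipFree, Bool.and_eq_true] at hc
    simp only [exec, run]
    split_ifs with h
    · obtain ⟨t, ht⟩ := hp hc.1 (s.tick (1 + b.size))
      exact ⟨_, by rw [ht, run_tick, State.tick_tick]⟩
    · obtain ⟨t, ht⟩ := hq hc.2 (s.tick (1 + b.size))
      exact ⟨_, by rw [ht, run_tick, State.tick_tick]⟩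
  | loop a bound body hb =>
    intro s
    simp only [Cmd.flipFree] at hc
    have hft : ∀ (j : ℕ) (s : State) (t : ℕ), (fun j s' => run D V body (State.setNat s' a 0 j)) j
        (s.tick t) = ((fun j s' => run D V body (State.setNat s' a 0 j)) j s).tick t := by
      intro j s t
      simp only
      rw [← run_tick]; rfl
    obtain ⟨t, ht⟩ := repeatFor_eq
      (F := fun j s' => exec D V body ((s'.setNat a 0 j).tick 1))
      (f := fun j s' => run D V body (s'.setNat a 0 j)) hft (fun j s => by
        obtain ⟨t, ht⟩ := hb hc ((s.setNat a 0 j).tick 1)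
        exact ⟨1 + t, by rw [ht, run_tick, State.tick_tick]⟩) (bound.eval s)
      (s.tick (1 + bound.size))
    refine ⟨1 + bound.size + t, ?_⟩
    simp only [exec, ht, run]
    rw [runFor_tick hft, State.tick_tick]
  | flip a i p => simp [Cmd.flipFree] at hc
  | demand a b c d => intro s; exact ⟨_, rfl⟩
  | value a b => intro s; exact ⟨_, rfl⟩

/-! ## Frames -/

/-- Blocks use separate arrays for separate purposes. The written arrays are read off the syntax, so
non-interference can be decided by computation. -/
theorem run_nat_frame (D : DemandFn m) (V : (Fin m → ℕ) → ℝ) {c : Cmd} {r : ℕ}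
    (hr : r ∉ c.natWrites) : ∀ s : State, (run D V c s).nat r = s.nat r := by
  induction c with
  | skip => intro s; rfl
  | setNat a i x =>
    intro s
    simp only [Cmd.natWrites, List.mem_singleton] at hr
    funext j
    simp [run, State.setNat_nat, hr]
  | setReal a i x => intro s; rfl
  | seq p q hp hq =>
    intro s
    simp only [Cmd.natWrites, List.mem_append, not_or] at hr
    simp only [run]
    rw [hq hr.2, hp hr.1]
  | ite b p q hp hq =>
    intro s
    simp only [Cmd.natWrites, List.mem_append, not_or] at hr
    simp only [run]
    split_ifs
    · exact hp hr.1 s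
    · exact hq hr.2 s
  | loop a bound body hb =>
    intro s
    simp only [Cmd.natWrites, List.mem_cons, not_or] at hr
    simp only [run]
    generalize bound.eval s = N
    induction N with
    | zero => rfl
    | succ N ih =>
      simp only [runFor]
      rw [hb hr.2, ← ih]
      funext j
      simp [State.setNat_nat, hr.1]
  | flip a i p => intro s; rfl
  | demand a b c d =>
    intro s
    simp only [Cmd.natWrites, List.mem_singleton] at hr
    simp [run, answerDemand, hr]
  | value a b => intro s; rfl

theorem run_real_frame (D : DemandFn m) (V : (Fin m → ℕ) → ℝ) {c : Cmd} {r : ℕ}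
    (hr : r ∉ c.realWrites) : ∀ s : State, (run D V c s).real r = s.real r := by
  induction c with
  | skip => intro s; rfl
  | setNat a i x => intro s; rfl
  | setReal a i x =>
    intro s
    simp only [Cmd.realWrites, List.mem_singleton] at hr
    funext j
    simp [run, State.setReal_real, hr]
  | seq p q hp hq =>
    intro s
    simp only [Cmd.realWrites, List.mem_append, not_or] at hr
    simp only [run]
    rw [hq hr.2, hp hr.1]
  | ite b p q hp hq =>
    intro s
    simp only [Cmd.realWrites, List.mem_append, not_or] at hr
    simp only [run]
    split_ifs
    · exact hp hr.1 s
    · exact hq hr.2 s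
  | loop a bound body hb =>
    intro s
    simp only [Cmd.realWrites] at hr
    simp only [run]
    generalize bound.eval s = N
    induction N with
    | zero => rfl
    | succ N ih =>
      simp only [runFor]
      rw [hb hr, ← ih]
      rfl
  | flip a i p => intro s; rfl
  | demand a b c d => intro s; rfl
  | value a b =>
    intro s
    simp only [Cmd.realWrites, List.mem_singleton] at hr
    funext j
    simp [run, State.setReal_real, hr]

/-- Induction over the rounds of a loop. -/
theorem run_loop_induct (D : DemandFn m) (V : (Fin m → ℕ) → ℝ) {a : ℕ} {bound : NExp} {body : Cmd}
    {s : State} {N : ℕ} (hN : bound.eval s = N) (Inv : ℕ → State → Prop) (h0 : Inv 0 s)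
    (hstep : ∀ j < N, ∀ s' : State,
      (∀ r, r ∉ a :: body.natWrites → s'.nat r = s.nat r) →
      (∀ r, r ∉ body.realWrites → s'.real r = s.real r) →
      Inv j s' → Inv (j + 1) (run D V body (s'.setNat a 0 j))) :
    Inv N (run D V (.loop a bound body) s) := by
  simp only [run, hN]
  -- The frame facts are carried along with the invariant, so every round knows that untouched
  -- arrays still hold their values from before the loop.
  have : ∀ j ≤ N, Inv j (runFor (fun j s' => run D V body (s'.setNat a 0 j)) j s) ∧
      (∀ r, r ∉ a :: body.natWrites →
        (runFor (fun j s' => run D V body (s'.setNat a 0 j)) j s).nat r = s.nat r) ∧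
      (∀ r, r ∉ body.realWrites →
        (runFor (fun j s' => run D V body (s'.setNat a 0 j)) j s).real r = s.real r) := by
    intro j
    induction j with
    | zero => exact fun _ => ⟨h0, fun _ _ => rfl, fun _ _ => rfl⟩
    | succ j ih =>
      intro hj
      obtain ⟨h1, h2, h3⟩ := ih (by omega)
      refine ⟨hstep j (by omega) _ h2 h3 h1, fun r hr => ?_, fun r hr => ?_⟩
      · simp only [runFor]
        rw [← h2 r hr]
        simp only [List.mem_cons, not_or] at hr
        rw [run_nat_frame D V hr.2]
        funext k
        simp [State.setNat_nat, hr.1]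
      · simp only [runFor]
        rw [← h3 r hr, run_real_frame D V hr]
        rfl
  exact (this N le_rfl).1

/-! ## Running time -/

/-- The bound of a loop is read from entry `0` of an array in `R`. -/
def NExp.isBound (R : List ℕ) : NExp → Prop
  | .get a (.lit 0) => a ∈ R
  | _ => False

/-- All loop bounds are read from entries `0` of arrays in `R`. -/
def Cmd.Bounded (R : List ℕ) : Cmd → Prop
  | .seq p q => p.Bounded R ∧ q.Bounded R
  | .ite _ p q => p.Bounded R ∧ q.Bounded R
  | .loop _ bound body => bound.isBound R ∧ body.Bounded R
  | _ => True

open Polynomial in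
/-- A bound for the number of steps in terms of a bound for the numbers of rounds of the loops and
the number of players. -/
def Cmd.cost : Cmd → ℕ[X]
  | .skip => 1
  | .setNat _ i x => C (1 + i.size + x.size)
  | .setReal _ i x => C (1 + i.size + x.size)
  | .seq p q => p.cost + q.cost
  | .ite b p q => C (1 + b.size) + (p.cost + q.cost)
  | .loop _ bound body => C (1 + bound.size) + X * (1 + body.cost)
  | .flip _ i p => C (1 + i.size + p.size)
  | .demand _ _ _ _ => 1 + X
  | .value _ _ => 1 + X

theorem exec_nat_frame (D : DemandFn m) (V : (Fin m → ℕ) → ℝ) {c : Cmd} {r : ℕ}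
    (hr : r ∉ c.natWrites) :
    ∀ s s' : State, s' ∈ (exec D V c s).support → s'.nat r = s.nat r := by
  induction c with
  | skip => intro s s' h; simp only [exec, PMF.mem_support_pure_iff] at h; rw [h]; rfl
  | setNat a i x =>
    intro s s' h
    simp only [exec, PMF.mem_support_pure_iff] at h
    simp only [Cmd.natWrites, List.mem_singleton] at hr
    rw [h]
    funext j
    simp [State.setNat_nat, hr]
  | setReal a i x => intro s s' h; simp only [exec, PMF.mem_support_pure_iff] at h; rw [h]; rfl
  | seq p q hp hq =>
    intro s s' h
    simp only [Cmd.natWrites, List.mem_append, not_or] at hr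
    simp only [exec, PMF.mem_support_bind_iff] at h
    obtain ⟨s1, h1, h2⟩ := h
    rw [hq hr.2 _ _ h2, hp hr.1 _ _ h1]
  | ite b p q hp hq =>
    intro s s' h
    simp only [Cmd.natWrites, List.mem_append, not_or] at hr
    simp only [exec] at h
    split_ifs at h
    · exact hp hr.1 (s.tick _) _ h
    · exact hq hr.2 (s.tick _) _ h
  | loop a bound body hb =>
    intro s s' h
    simp only [Cmd.natWrites, List.mem_cons, not_or] at hr
    simp only [exec] at h
    generalize bound.eval s = N at h
    induction N generalizing s' with
    | zero =>
      simp only [repeatFor, PMF.mem_support_pure_iff] at h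
      rw [h]; rfl
    | succ N ih =>
      simp only [repeatFor, PMF.mem_support_bind_iff] at h
      obtain ⟨s1, h1, h2⟩ := h
      rw [hb hr.2 _ _ h2, ← ih s1 h1]
      funext j
      simp [State.setNat_nat, hr.1]
  | flip a i p =>
    intro s s' h
    simp only [exec, PMF.mem_support_map_iff] at h
    simp only [Cmd.natWrites, List.mem_singleton] at hr
    obtain ⟨b, _, h⟩ := h
    rw [← h]
    funext j
    simp [State.setNat_nat, hr]
  | demand a b c d =>
    intro s s' h
    simp only [exec, PMF.mem_support_pure_iff] at h
    simp only [Cmd.natWrites, List.mem_singleton] at hr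
    rw [h]
    simp [answerDemand, hr]
  | value a b => intro s s' h; simp only [exec, PMF.mem_support_pure_iff] at h; rw [h]; rfl

/-- Loop bounds come from arrays that the program never writes, so each loop has at most `K` rounds
even when nested, and the cost polynomial follows the syntax. -/
theorem exec_time_le (D : DemandFn m) (V : (Fin m → ℕ) → ℝ) {R : List ℕ} {K : ℕ} (hm : m ≤ K)
    {c : Cmd} (hc : c.Bounded R) (hR : ∀ r ∈ R, r ∉ c.natWrites) :
    ∀ s : State, (∀ r ∈ R, s.nat r 0 ≤ K) → ∀ s' ∈ (exec D V c s).support,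
      s'.time ≤ s.time + c.cost.eval K := by
  induction c with
  | skip =>
    intro s _ s' h
    simp only [exec, PMF.mem_support_pure_iff] at h
    rw [h]; simp [State.tick, Cmd.cost]
  | setNat a i x =>
    intro s _ s' h
    simp only [exec, PMF.mem_support_pure_iff] at h
    rw [h]; simp [State.tick, Cmd.cost, State.setNat]
  | setReal a i x =>
    intro s _ s' h
    simp only [exec, PMF.mem_support_pure_iff] at h
    rw [h]; simp [State.tick, Cmd.cost, State.setReal]
  | seq p q hp hq =>
    intro s hs s' h
    simp only [Cmd.natWrites, List.mem_append, not_or] at hR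
    simp only [exec, PMF.mem_support_bind_iff] at h
    obtain ⟨s1, h1, h2⟩ := h
    have e1 := hp hc.1 (fun r hr => (hR r hr).1) s hs s1 h1
    have e2 := hq hc.2 (fun r hr => (hR r hr).2) s1 (fun r hr => by
      rw [exec_nat_frame D V (hR r hr).1 _ _ h1]; exact hs r hr) s' h2
    simp only [Cmd.cost, Polynomial.eval_add]
    omega
  | ite b p q hp hq =>
    intro s hs s' h
    simp only [Cmd.natWrites, List.mem_append, not_or] at hR
    simp only [exec] at h
    simp only [Cmd.cost, Polynomial.eval_add, Polynomial.eval_C]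
    split_ifs at h
    · have := hp hc.1 (fun r hr => (hR r hr).1) (s.tick (1 + b.size)) hs s' h
      simp only [State.tick] at this
      omega
    · have := hq hc.2 (fun r hr => (hR r hr).2) (s.tick (1 + b.size)) hs s' h
      simp only [State.tick] at this
      omega
  | loop a bound body hb =>
    intro s hs s' h
    simp only [Cmd.natWrites, List.mem_cons, not_or] at hR
    simp only [exec] at h
    have hN : bound.eval s ≤ K := by
      have hbd := hc.1
      unfold NExp.isBound at hbd
      split at hbd
      · exact hs _ hbd
      · exact hbd.elim
    have key : ∀ N s', s' ∈ (repeatFor (fun j s' => exec D V body ((s'.setNat a 0 j).tick 1)) N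
        (s.tick (1 + bound.size))).support →
        s'.time ≤ s.time + (1 + bound.size) + N * (1 + body.cost.eval K) ∧
          ∀ r ∈ R, s'.nat r = s.nat r := by
      intro N
      induction N with
      | zero =>
        intro s' h
        simp only [repeatFor, PMF.mem_support_pure_iff] at h
        rw [h]
        exact ⟨by simp [State.tick], fun _ _ => rfl⟩
      | succ N ih =>
        intro s' h
        simp only [repeatFor, PMF.mem_support_bind_iff] at h
        obtain ⟨s1, h1, h2⟩ := h
        obtain ⟨i1, i2⟩ := ih s1 h1
        have hfr : ∀ r ∈ R, ((s1.setNat a 0 N).tick 1).nat r = s.nat r := by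
          intro r hr
          rw [← i2 r hr]
          funext j
          simp [State.setNat_nat, (hR r hr).1]
        have e := hb hc.2 (fun r hr => (hR r hr).2) _ (fun r hr => by
          rw [hfr r hr]; exact hs r hr) s' h2
        refine ⟨?_, fun r hr => ?_⟩
        · simp only [State.tick, State.setNat] at e
          rw [Nat.succ_mul]
          omega
        · rw [exec_nat_frame D V (hR r hr).2 _ _ h2, hfr r hr]
    have e := (key _ s' h).1
    have : bound.eval s * (1 + body.cost.eval K) ≤ K * (1 + body.cost.eval K) :=
      Nat.mul_le_mul_right _ hN
    simp only [Cmd.cost, Polynomial.eval_add, Polynomial.eval_C, Polynomial.eval_mul,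
      Polynomial.eval_X, Polynomial.eval_one]
    omega
  | flip a i p =>
    intro s _ s' h
    simp only [exec, PMF.mem_support_map_iff] at h
    obtain ⟨b, _, h⟩ := h
    rw [← h]; simp [State.tick, Cmd.cost, State.setNat]
  | demand a b c d =>
    intro s _ s' h
    simp only [exec, PMF.mem_support_pure_iff] at h
    rw [h]
    simp only [State.tick, Cmd.cost, answerDemand, Polynomial.eval_add, Polynomial.eval_one,
      Polynomial.eval_X]
    omega
  | value a b =>
    intro s _ s' h
    simp only [exec, PMF.mem_support_pure_iff] at h
    rw [h]
    simp only [State.tick, Cmd.cost, State.setReal, Polynomial.eval_add, Polynomial.eval_one,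
      Polynomial.eval_X]
    omega

/-! ## Building blocks of the program

Integer arrays `0`, `1`, `3` and real arrays `0`, `1` hold the input and the total number of units
and are never written to by the blocks. -/

infixr:30 " ;; " => Cmd.seq

/-- Entry `0` of an integer array. -/
abbrev nv (a : ℕ) : NExp := .get a (.lit 0)

/-- The entry of an integer array at the index stored in `i`. -/
abbrev na (a i : ℕ) : NExp := .get a (nv i)

/-- Entry `0` of a real array. -/
abbrev rv (a : ℕ) : RExp := .get a (.lit 0)

/-- The entry of a real array at the index stored in `i`. -/
abbrev ra (a i : ℕ) : RExp := .get a (nv i)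

/-- Write entry `0` of an integer array. -/
abbrev setN (a : ℕ) (x : NExp) : Cmd := .setNat a (.lit 0) x

/-- Write entry `0` of a real array. -/
abbrev setR (a : ℕ) (x : RExp) : Cmd := .setReal a (.lit 0) x

/-- The entry of an integer array at the index stored in `i` is not zero. -/
abbrev nonzero (a i : ℕ) : BExp := .nle (.lit 1) (na a i)

section Equations

variable (D : DemandFn m) (V : (Fin m → ℕ) → ℝ)

theorem run_skip (s : State) : run D V .skip s = s := rfl

theorem run_setNat (a : ℕ) (i x : NExp) (s : State) :
    run D V (.setNat a i x) s = s.setNat a (i.eval s) (x.eval s) := rfl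

theorem run_setReal (a : ℕ) (i : NExp) (x : RExp) (s : State) :
    run D V (.setReal a i x) s = s.setReal a (i.eval s) (x.eval s) := rfl

theorem run_seq (p q : Cmd) (s : State) : run D V (p ;; q) s = run D V q (run D V p s) := rfl

open Classical in
theorem run_ite (b : BExp) (p q : Cmd) (s : State) :
    run D V (.ite b p q) s = if b.Holds s then run D V p s else run D V q s := rfl

theorem run_value (a b : ℕ) (s : State) :
    run D V (.value a b) s = s.setReal b 0 (V (fun i => s.nat a i)) := rfl

theorem run_ite_pos {b : BExp} {p q : Cmd} {s : State} (h : b.Holds s) :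
    run D V (.ite b p q) s = run D V p s := by
  classical
  rw [run_ite, if_pos h]

theorem run_ite_neg {b : BExp} {p q : Cmd} {s : State} (h : ¬ b.Holds s) :
    run D V (.ite b p q) s = run D V q s := by
  classical
  rw [run_ite, if_neg h]

end Equations

attribute [simp] run_skip run_setNat run_setReal run_seq run_value NExp.eval RExp.eval BExp.Holds
  State.setNat_nat State.setReal_real run_nat_frame run_real_frame Cmd.natWrites Cmd.realWrites

@[simp] theorem State.setNat_nat_of_ne (s : State) {a b : ℕ} (h : b ≠ a) (i x : ℕ) :
    (s.setNat a i x).nat b = s.nat b := by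
  funext j; simp [h]

@[simp] theorem State.setReal_real_of_ne (s : State) {a b : ℕ} (h : b ≠ a) (i : ℕ) (x : ℝ) :
    (s.setReal a i x).real b = s.real b := by
  funext j; simp [h]

/-- Induction over a loop whose counter runs over the players. -/
theorem run_players (D : DemandFn m) (V : (Fin m → ℕ) → ℝ) {a : ℕ} {body : Cmd} {s : State}
    (hs : s.nat 0 0 = m) (Inv : ℕ → State → Prop) (h0 : Inv 0 s)
    (hstep : ∀ (i : Fin m) (s' : State),
      (∀ r, r ∉ a :: body.natWrites → s'.nat r = s.nat r) →
      (∀ r, r ∉ body.realWrites → s'.real r = s.real r) →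
      Inv i s' → Inv (i + 1) (run D V body (s'.setNat a 0 i))) :
    Inv m (run D V (.loop a (nv 0) body) s) :=
  run_loop_induct D V (by simpa using hs) Inv h0 (fun j hj s' hn hr hI => hstep ⟨j, hj⟩ s' hn hr hI)

/-- A loop that fills an integer array. -/
theorem run_fill_nat (D : DemandFn m) (V : (Fin m → ℕ) → ℝ) {a b : ℕ} {body : Cmd} {s : State}
    (hs : s.nat 0 0 = m) (f : Fin m → ℕ)
    (hstep : ∀ (i : Fin m) (s' : State),
      (∀ r, r ∉ a :: body.natWrites → s'.nat r = s.nat r) →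
      (∀ r, r ∉ body.realWrites → s'.real r = s.real r) →
      ∀ j : Fin m, (run D V body (s'.setNat a 0 i)).nat b j = if j = i then f i else s'.nat b j) :
    ∀ i : Fin m, (run D V (.loop a (nv 0) body) s).nat b i = f i := by
  have := run_players D V (a := a) (body := body) hs
    (fun j s' => ∀ i : Fin m, (i : ℕ) < j → s'.nat b i = f i) (fun i hi => absurd hi (by omega))
    (fun i s' hn hr hI l hl => by
      rw [hstep i s' hn hr l]
      split_ifs with h
      · rw [h]
      · have : (l : ℕ) ≠ i := fun h' => h (Fin.ext h')
        exact hI l (by omega))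
  exact fun i => this i i.2

/-- A loop that fills a real array. -/
theorem run_fill_real (D : DemandFn m) (V : (Fin m → ℕ) → ℝ) {a b : ℕ} {body : Cmd} {s : State}
    (hs : s.nat 0 0 = m) (f : Fin m → ℝ)
    (hstep : ∀ (i : Fin m) (s' : State),
      (∀ r, r ∉ a :: body.natWrites → s'.nat r = s.nat r) →
      (∀ r, r ∉ body.realWrites → s'.real r = s.real r) →
      ∀ j : Fin m, (run D V body (s'.setNat a 0 i)).real b j =
        if j = i then f i else s'.real b j) :
    ∀ i : Fin m, (run D V (.loop a (nv 0) body) s).real b i = f i := by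
  have := run_players D V (a := a) (body := body) hs
    (fun j s' => ∀ i : Fin m, (i : ℕ) < j → s'.real b i = f i) (fun i hi => absurd hi (by omega))
    (fun i s' hn hr hI l hl => by
      rw [hstep i s' hn hr l]
      split_ifs with h
      · rw [h]
      · have : (l : ℕ) ≠ i := fun h' => h (Fin.ext h')
        exact hI l (by omega))
  exact fun i => this i i.2

open Classical in
theorem affordable_succ (B : ℝ) (N : ℕ) (c : ℝ) :
    affordable B (N + 1) c = if ((N : ℝ) + 1) * c ≤ B then N + 1 else affordable B N c := by
  unfold affordable
  rw [Nat.findGreatest_succ]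
  push_cast
  rfl

/-- `affordable`: the arguments are in the integer variable `30` and the real variable `30`, the
result in the integer variable `31`. -/
def affordCmd : Cmd :=
  setN 31 (.lit 0) ;;
  .loop 32 (nv 3)
    (.ite (.and (.nle (.add (nv 32) (.lit 1)) (nv 30))
        (.rle (.mul (.ofNat (.add (nv 32) (.lit 1))) (rv 30)) (rv 0)))
      (setN 31 (.add (nv 32) (.lit 1))) .skip)

@[simp] theorem affordCmd_natWrites : affordCmd.natWrites = [31, 32, 31] := rfl
@[simp] theorem affordCmd_realWrites : affordCmd.realWrites = [] := rfl

/-- The loop runs over the total number of units, a bound that is never overwritten. Rounds beyond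
the capacity do nothing, hence the `min` in the invariant. -/
theorem run_affordCmd (D : DemandFn m) (V : (Fin m → ℕ) → ℝ) {s : State}
    (h : s.nat 30 0 ≤ s.nat 3 0) :
    (run D V affordCmd s).nat 31 0 = affordable (s.real 0 0) (s.nat 30 0) (s.real 30 0) := by
  unfold affordCmd
  rw [run_seq]
  rw [← min_eq_right h]
  refine run_loop_induct D V (by simp)
    (fun j s' => s'.nat 31 0 = affordable (s.real 0 0) (min j (s.nat 30 0)) (s.real 30 0))
    (by simp [affordable]) ?_
  intro j hj s' hn hr hI
  have h30 : s'.nat 30 = s.nat 30 := by rw [hn 30 (by decide)]; simp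
  have r30 : s'.real 30 = s.real 30 := by rw [hr 30 (by decide)]; simp
  have r0 : s'.real 0 = s.real 0 := by rw [hr 0 (by decide)]; simp
  by_cases h1 : j + 1 ≤ s.nat 30 0
  · rw [min_eq_left (by omega)] at hI
    rw [min_eq_left h1, affordable_succ]
    by_cases h2 : ((j : ℝ) + 1) * s.real 30 0 ≤ s.real 0 0
    · rw [run_ite_pos]
      · simp [h2]
      · simp [h30, h1, r30, r0, h2]
    · rw [run_ite_neg]
      · simp [h2, hI]
      · simp [h30, h1, r30, r0, h2]
  · rw [run_ite_neg]
    · rw [min_eq_right (by omega)] at hI ⊢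
      simp [hI]
    · simp [h30, h1]

/-- The value of the allocation that consists of as many units as the integer variable `31` says
of the item in the integer variable `33`; the result is in the real variable `31`. -/
def singleCmd : Cmd :=
  .loop 34 (nv 0) (.setNat 35 (nv 34) (.lit 0)) ;;
  .setNat 35 (nv 33) (nv 31) ;;
  .value 35 31

@[simp] theorem singleCmd_natWrites : singleCmd.natWrites = [34, 35, 35] := rfl
@[simp] theorem singleCmd_realWrites : singleCmd.realWrites = [31] := rfl

theorem run_singleCmd (D : DemandFn m) (V : (Fin m → ℕ) → ℝ) {s : State} (hs : s.nat 0 0 = m)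
    {i : Fin m} (hi : s.nat 33 0 = i) :
    (run D V singleCmd s).real 31 0 = V (single i (s.nat 31 0)) := by
  unfold singleCmd
  have h := run_fill_nat D V (a := 34) (b := 35) (body := .setNat 35 (nv 34) (.lit 0)) hs
    (fun _ => 0) (fun i s' hn hr j => by simp [Fin.ext_iff])
  simp only [run_seq, run_setNat, run_value, State.setReal_real, and_self, if_true]
  congr 1
  funext j
  have h33 : (run D V (.loop 34 (nv 0) (.setNat 35 (nv 34) (.lit 0))) s).nat 33 = s.nat 33 := by
    simp
  have h31 : (run D V (.loop 34 (nv 0) (.setNat 35 (nv 34) (.lit 0))) s).nat 31 = s.nat 31 := by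
    simp
  simp only [State.setNat_nat, NExp.eval, h33, h31, hi, true_and, h, single]
  by_cases hj : j = i
  · subst hj; simp
  · have : (j : ℕ) ≠ i := fun h' => hj (Fin.ext h')
    simp [hj, this]

/-! ## `A_Max` -/

/-- The memory holds the public data of the game. -/
structure Ctx (G : Game m) (s : State) : Prop where
  players : s.nat 0 0 = m
  total : s.nat 3 0 = G.total
  units : ∀ i : Fin m, s.nat 1 i = G.units i
  budget : s.real 0 0 = G.budget

theorem Ctx.of_eq {G : Game m} {s s' : State} (h : Ctx G s) (h0 : s'.nat 0 = s.nat 0)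
    (h1 : s'.nat 1 = s.nat 1) (h3 : s'.nat 3 = s.nat 3) (r0 : s'.real 0 = s.real 0) : Ctx G s' :=
  ⟨h0 ▸ h.players, h3 ▸ h.total, fun i => h1 ▸ h.units i, r0 ▸ h.budget⟩

open Classical in
/-- The set of players that is stored in an integer array. -/
def memSet (m : ℕ) (f : ℕ → ℕ) : Finset (Fin m) := Finset.univ.filter (fun i : Fin m => f i ≠ 0)

@[simp] theorem mem_memSet {f : ℕ → ℕ} {i : Fin m} : i ∈ memSet m f ↔ f i ≠ 0 := by
  simp [memSet]

/-- The affordable numbers of units, for the players in the integer array `10` and the costs in the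
real array `10`; the result is in the integer array `12`. -/
def unitsCmd : Cmd :=
  .loop 20 (nv 0)
    (.ite (nonzero 10 20)
      (setN 30 (na 1 20) ;; setR 30 (ra 10 20) ;; affordCmd ;; .setNat 12 (nv 20) (nv 31))
      (.setNat 12 (nv 20) (.lit 0)))

@[simp] theorem unitsCmd_natWrites : unitsCmd.natWrites = [20, 30, 31, 32, 31, 12, 12] := rfl
@[simp] theorem unitsCmd_realWrites : unitsCmd.realWrites = [30] := rfl

theorem run_unitsCmd (D : DemandFn m) (V : (Fin m → ℕ) → ℝ) {G : Game m} {s : State}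
    (hs : Ctx G s) (i : Fin m) :
    (run D V unitsCmd s).nat 12 i =
      maxUnits G (memSet m (s.nat 10)) (fun i => s.real 10 i) i := by
  revert i
  unfold unitsCmd
  refine run_fill_nat D V hs.players (maxUnits G (memSet m (s.nat 10)) (fun i => s.real 10 i)) ?_
  intro i s' hn hr j
  have h10 : s'.nat 10 = s.nat 10 := hn 10 (by decide)
  have h1 : s'.nat 1 = s.nat 1 := hn 1 (by decide)
  have h3 : s'.nat 3 = s.nat 3 := hn 3 (by decide)
  have r10 : s'.real 10 = s.real 10 := hr 10 (by decide)
  have r0 : s'.real 0 = s.real 0 := hr 0 (by decide)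
  by_cases h : s.nat 10 i = 0
  · rw [run_ite_neg]
    · simp [maxUnits, h, Fin.ext_iff]
    · simp [h10, h]
  · rw [run_ite_pos]
    · have hle : G.units i ≤ G.total := G.units_le_total i
      simp [maxUnits, h, Fin.ext_iff, run_affordCmd, h1, h3, hs.units, hs.total, hle, r0, r10,
        hs.budget]
    · simp only [BExp.Holds, NExp.eval, State.setNat_nat]
      simp [h10]; omega

/-- The number of players in the integer array `10` (in the integer variable `13`) and the largest
value of the numbers of units in the integer array `12` (in the real variable `13`). -/
def bestCmd : Cmd :=
  setR 13 (.ofNat (.lit 0)) ;; setN 13 (.lit 0) ;;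
  .loop 21 (nv 0)
    (.ite (nonzero 10 21)
      (setN 33 (nv 21) ;; setN 31 (na 12 21) ;; singleCmd ;;
        .ite (.rle (rv 13) (rv 31)) (setR 13 (rv 31)) .skip ;;
        setN 13 (.add (nv 13) (.lit 1)))
      .skip)

@[simp] theorem bestCmd_natWrites : bestCmd.natWrites = [13, 21, 33, 31, 34, 35, 35, 13] := rfl
@[simp] theorem bestCmd_realWrites : bestCmd.realWrites = [13, 31, 13] := rfl

open Classical in
/-- The players with an index below `j` that satisfy `P`. -/
def below (P : Fin m → Prop) (j : ℕ) : Finset (Fin m) :=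
  Finset.univ.filter (fun l : Fin m => P l ∧ (l : ℕ) < j)

@[simp] theorem mem_below {P : Fin m → Prop} {j : ℕ} {l : Fin m} :
    l ∈ below P j ↔ P l ∧ (l : ℕ) < j := by
  simp [below]

@[simp] theorem below_zero (P : Fin m → Prop) : below P 0 = ∅ := by
  ext; simp

open Classical in
theorem below_succ {P : Fin m → Prop} {i : Fin m} (h : P i) :
    below P ((i : ℕ) + 1) = insert i (below P i) := by
  ext l
  simp only [mem_below, Finset.mem_insert, Fin.ext_iff]
  constructor
  · rintro ⟨h1, h2⟩
    by_cases h : (l : ℕ) = i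
    · exact Or.inl h
    · exact Or.inr ⟨h1, by omega⟩
  · rintro (h1 | ⟨h1, h2⟩)
    · have : l = i := Fin.ext h1
      subst this; exact ⟨h, by omega⟩
    · exact ⟨h1, by omega⟩

theorem below_succ_of_not {P : Fin m → Prop} {i : Fin m} (h : ¬ P i) :
    below P ((i : ℕ) + 1) = below P i := by
  ext l
  simp only [mem_below]
  constructor
  · rintro ⟨h1, h2⟩
    have : (l : ℕ) ≠ i := fun h' => h (Fin.ext h' ▸ h1)
    exact ⟨h1, by omega⟩
  · rintro ⟨h1, h2⟩
    exact ⟨h1, by omega⟩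

theorem run_bestCmd (D : DemandFn m) (V : (Fin m → ℕ) → ℝ) {s : State}
    (hs : s.nat 0 0 = m) :
    (run D V bestCmd s).nat 13 0 = (memSet m (s.nat 10)).card ∧
      (run D V bestCmd s).real 13 0 =
        (memSet m (s.nat 10)).fold max 0 (fun i => V (single i (s.nat 12 i))) := by
  classical
  have hm : memSet m (s.nat 10) = below (fun i : Fin m => s.nat 10 i ≠ 0) m := by ext; simp
  unfold bestCmd
  rw [hm]
  rw [run_seq, run_seq]
  refine run_players D V (by simpa using hs) (fun j s' =>
    s'.nat 13 0 = (below (fun i : Fin m => s.nat 10 i ≠ 0) j).card ∧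
    s'.real 13 0 = (below (fun i : Fin m => s.nat 10 i ≠ 0) j).fold max 0
      (fun i => V (single i (s.nat 12 i)))) (by simp) ?_
  intro i s' hn hr ⟨hI1, hI2⟩
  have h10 : s'.nat 10 = s.nat 10 := by rw [hn 10 (by decide)]; simp
  have h12 : s'.nat 12 = s.nat 12 := by rw [hn 12 (by decide)]; simp
  have h0 : s'.nat 0 = s.nat 0 := by rw [hn 0 (by decide)]; simp
  by_cases h : s.nat 10 i = 0
  · rw [run_ite_neg]
    · rw [below_succ_of_not (by simpa using h)]
      simpa using ⟨hI1, hI2⟩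
    · simp [h10, h]
  · rw [run_ite_pos]
    · rw [below_succ h, Finset.card_insert_of_notMem (by simp),
        Finset.fold_insert (by simp), ← hI1, ← hI2]
      simp only [run_seq]
      generalize hs1 : run D V (setN 31 (na 12 21)) (run D V (setN 33 (nv 21)) (s'.setNat 21 0 i)) = s1
      have e0 : s1.nat 0 0 = m := by rw [← hs1]; simp [h0, hs]
      have e33 : s1.nat 33 0 = i := by rw [← hs1]; simp
      have e31 : s1.nat 31 0 = s.nat 12 i := by rw [← hs1]; simp [h12]
      have e13 : s1.nat 13 = s'.nat 13 := by rw [← hs1]; simp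
      have f13 : s1.real 13 = s'.real 13 := by rw [← hs1]; simp
      have hv := run_singleCmd D V e0 e33
      rw [e31] at hv
      by_cases hle : s'.real 13 0 ≤ V (single i (s.nat 12 i))
      · rw [run_ite_pos]
        · simp [e13, hv, hle]
        · simp [hv, f13, hle]
      · rw [run_ite_neg]
        · simp [e13, f13, le_of_not_ge hle]
        · simp [hv, f13, hle]
    · simp [h10]; omega

/-- The test whether `a` with key `x` does not come after `b` with key `y`. -/
def rankTest (x y : RExp) (a b : NExp) : BExp :=
  .not (.and (.rle x y) (.not (.and (.rle y x) (.nle a b))))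

/-- Tests have neither strict comparison nor disjunction, so the order is expressed through two
negations. -/
theorem holds_rankTest {x y : RExp} {a b : NExp} {s : State} :
    (rankTest x y a b).Holds s ↔
      (y.eval s < x.eval s ∨ (x.eval s = y.eval s ∧ a.eval s ≤ b.eval s)) := by
  simp only [rankTest, BExp.Holds]
  rcases lt_trichotomy (x.eval s) (y.eval s) with h | h | h
  · simp [h.le, not_le.mpr h, not_lt.mpr h.le, h.ne]
  · simp [h]
  · simp [h, h.le, not_le.mpr h]

/-- The cost of an item in the allocation in the integer array `16`, with costs in the real array
`10`. -/
abbrev itemCost (i : ℕ) : RExp := .mul (.ofNat (na 16 i)) (ra 10 i)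

/-- The total cost (in the real variable `18`) of the players of the set in the integer array `10`
that are listed up to and including the one in the integer variable `23`. -/
def prefixSumCmd : Cmd :=
  setR 18 (.ofNat (.lit 0)) ;;
  .loop 24 (nv 0)
    (.ite (.and (nonzero 10 24) (rankTest (itemCost 24) (itemCost 23) (nv 24) (nv 23)))
      (setR 18 (.add (rv 18) (itemCost 24))) .skip)

@[simp] theorem prefixSumCmd_natWrites : prefixSumCmd.natWrites = [24] := rfl
@[simp] theorem prefixSumCmd_realWrites : prefixSumCmd.realWrites = [18, 18] := rfl

open Classical in
theorem run_prefixSumCmd (D : DemandFn m) (V : (Fin m → ℕ) → ℝ) {s : State}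
    (hs : s.nat 0 0 = m) {i : Fin m} (hi : s.nat 23 0 = i) :
    (run D V prefixSumCmd s).real 18 0 =
      ∑ l ∈ (memSet m (s.nat 10)).filter
        (fun l => RankLE (fun j : Fin m => (s.nat 16 j : ℝ) * s.real 10 j) l i),
        (s.nat 16 l : ℝ) * s.real 10 l := by
  set P : Fin m → Prop := fun l => s.nat 10 l ≠ 0 ∧
    RankLE (fun j : Fin m => (s.nat 16 j : ℝ) * s.real 10 j) l i with hP
  have hm : (memSet m (s.nat 10)).filter
      (fun l => RankLE (fun j : Fin m => (s.nat 16 j : ℝ) * s.real 10 j) l i) = below P m := by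
    ext l; simp [hP]
  rw [hm]
  unfold prefixSumCmd
  rw [run_seq]
  refine run_players D V (by simpa using hs) (fun j s' =>
    s'.real 18 0 = ∑ l ∈ below P j, (s.nat 16 l : ℝ) * s.real 10 l) (by simp) ?_
  intro l s' hn hr hI
  have h10 : s'.nat 10 = s.nat 10 := by rw [hn 10 (by decide)]; simp
  have h16 : s'.nat 16 = s.nat 16 := by rw [hn 16 (by decide)]; simp
  have h23 : s'.nat 23 = s.nat 23 := by rw [hn 23 (by decide)]; simp
  have r10 : s'.real 10 = s.real 10 := by rw [hr 10 (by decide)]; simp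
  have htest : (BExp.and (nonzero 10 24)
      (rankTest (itemCost 24) (itemCost 23) (nv 24) (nv 23))).Holds (s'.setNat 24 0 l) ↔ P l := by
    simp only [BExp.Holds, holds_rankTest, hP, RankLE]
    simp only [RExp.eval, NExp.eval, State.setNat_nat, State.setNat_real]
    simp [h10, h16, h23, r10, hi, Nat.one_le_iff_ne_zero]
  by_cases h : P l
  · rw [run_ite_pos _ _ (htest.mpr h), below_succ h, Finset.sum_insert (by simp), ← hI]
    simp [h16, r10, add_comm]
  · rw [run_ite_neg _ _ (htest.not.mpr h), below_succ_of_not h, ← hI]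
    simp

/-- The affordable prefix (in the integer array `17`) of the allocation in the integer array `16`. -/
def prefixCmd : Cmd :=
  .loop 23 (nv 0)
    (prefixSumCmd ;;
      .ite (.and (nonzero 10 23) (.rle (rv 18) (rv 0)))
        (.setNat 17 (nv 23) (na 16 23)) (.setNat 17 (nv 23) (.lit 0)))

@[simp] theorem prefixCmd_natWrites : prefixCmd.natWrites = [23, 24, 17, 17] := rfl
@[simp] theorem prefixCmd_realWrites : prefixCmd.realWrites = [18, 18] := rfl

theorem run_prefixCmd (D : DemandFn m) (V : (Fin m → ℕ) → ℝ) {G : Game m} {s : State}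
    (hs : Ctx G s) (i : Fin m) :
    (run D V prefixCmd s).nat 17 i =
      affordablePrefix G (memSet m (s.nat 10)) (fun i => s.real 10 i) (fun i => s.nat 16 i) i := by
  classical
  revert i
  unfold prefixCmd
  refine run_fill_nat D V hs.players (affordablePrefix G (memSet m (s.nat 10))
    (fun i => s.real 10 i) (fun i => s.nat 16 i)) ?_
  intro i s' hn hr j
  have h0 : s'.nat 0 = s.nat 0 := hn 0 (by decide)
  have h10 : s'.nat 10 = s.nat 10 := hn 10 (by decide)
  have h16 : s'.nat 16 = s.nat 16 := hn 16 (by decide)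
  have r10 : s'.real 10 = s.real 10 := hr 10 (by decide)
  have r0 : s'.real 0 = s.real 0 := hr 0 (by decide)
  have hsum := run_prefixSumCmd D V (s := s'.setNat 23 0 i) (i := i)
    (by simp [h0, hs.players]) (by simp)
  rw [show (s'.setNat 23 0 i).nat 10 = s.nat 10 by simp [h10],
    show (s'.setNat 23 0 i).nat 16 = s.nat 16 by simp [h16],
    show (s'.setNat 23 0 i).real 10 = s.real 10 by simp [r10]] at hsum
  rw [run_seq]
  unfold affordablePrefix
  have htest : (BExp.and (nonzero 10 23) (.rle (rv 18) (rv 0))).Holds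
      (run D V prefixSumCmd (s'.setNat 23 0 i)) ↔
      i ∈ memSet m (s.nat 10) ∧ ∑ l ∈ (memSet m (s.nat 10)).filter
        (fun l => RankLE (fun j : Fin m => (s.nat 16 j : ℝ) * s.real 10 j) l i),
        (s.nat 16 l : ℝ) * s.real 10 l ≤ G.budget := by
    simp only [BExp.Holds, RExp.eval, NExp.eval, hsum]
    simp [h10, r0, hs.budget, Nat.one_le_iff_ne_zero]
  by_cases h : (BExp.and (nonzero 10 23) (.rle (rv 18) (rv 0))).Holds
      (run D V prefixSumCmd (s'.setNat 23 0 i))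
  · rw [run_ite_pos _ _ h, if_pos (htest.mp h)]
    simp [h16, Fin.ext_iff]
  · rw [run_ite_neg _ _ h, if_neg (htest.not.mp h)]
    simp [Fin.ext_iff]

/-- The allocation `S_v` (in the integer array `17`) for the players in the integer array `10`,
with numbers of units in the integer array `12`, costs in the real array `10`, and `v` in the real
variable `14`. -/
def guessCmd : Cmd :=
  .loop 22 (nv 0)
    (.ite (nonzero 10 22)
      (.setReal 15 (nv 22)
        (.mul (.div (rv 14) (.mul (.ofNat (.lit 2)) (rv 0))) (ra 10 22)))
      (.setReal 15 (nv 22) (.ofNat (.lit 0)))) ;;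
  .demand 10 12 15 16 ;;
  .value 16 16 ;;
  .ite (.rle (.div (rv 14) (.ofNat (.lit 2))) (rv 16)) prefixCmd
    (.loop 23 (nv 0) (.setNat 17 (nv 23) (.lit 0)))

@[simp] theorem guessCmd_natWrites : guessCmd.natWrites = [22, 16, 23, 24, 17, 17, 23, 17] := rfl
@[simp] theorem guessCmd_realWrites : guessCmd.realWrites = [15, 15, 16, 18, 18] := rfl

theorem run_guessCmd (D : DemandFn m) {G : Game m} {s : State}
    (hs : Ctx G s)
    (hu : ∀ i : Fin m, s.nat 12 i = maxUnits G (memSet m (s.nat 10)) (fun i => s.real 10 i) i)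
    (i : Fin m) :
    (run D G.val guessCmd s).nat 17 i =
      guessAlloc G D (memSet m (s.nat 10)) (fun i => s.real 10 i) (s.real 14 0) i := by
  classical
  unfold guessCmd
  rw [run_seq, run_seq, run_seq]
  set T := memSet m (s.nat 10) with hT
  have hfill := run_fill_real D G.val (a := 22) (b := 15) (body := .ite (nonzero 10 22)
      (.setReal 15 (nv 22)
        (.mul (.div (rv 14) (.mul (.ofNat (.lit 2)) (rv 0))) (ra 10 22)))
      (.setReal 15 (nv 22) (.ofNat (.lit 0)))) hs.players
    (fun i => if i ∈ T then s.real 14 0 / (2 * G.budget) * s.real 10 i else 0) (by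
      intro i s' hn hr j
      have h10 : s'.nat 10 = s.nat 10 := hn 10 (by decide)
      have r10 : s'.real 10 = s.real 10 := hr 10 (by decide)
      have r14 : s'.real 14 = s.real 14 := hr 14 (by decide)
      have r0 : s'.real 0 = s.real 0 := hr 0 (by decide)
      by_cases h : s.nat 10 i = 0
      · rw [run_ite_neg]
        · simp [hT, h, Fin.ext_iff]
        · simp [h10, h]
      · rw [run_ite_pos]
        · simp [hT, h, Fin.ext_iff, r10, r14, r0, hs.budget]
        · simp [h10]; omega)
  generalize hs1 : run D G.val (.loop 22 (nv 0) (.ite (nonzero 10 22)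
      (.setReal 15 (nv 22)
        (.mul (.div (rv 14) (.mul (.ofNat (.lit 2)) (rv 0))) (ra 10 22)))
      (.setReal 15 (nv 22) (.ofNat (.lit 0))))) s = s1 at hfill ⊢
  have hn1 : ∀ r, r ≠ 22 → s1.nat r = s.nat r := by
    intro r hr; rw [← hs1]; simp [hr]
  have hr1 : ∀ r, r ≠ 15 → s1.real r = s.real r := by
    intro r hr; rw [← hs1]; simp [hr]
  -- The oracle may break ties arbitrarily, so the query must equal that of `guessDemand` in every
  -- entry, including the zeros outside `T`.
  have hdem : ∀ j : Fin m, (run D G.val (.demand 10 12 15 16) s1).nat 16 j =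
      guessDemand G D T (fun i => s.real 10 i) (s.real 14 0) j := by
    intro j
    simp only [run, answerDemand, Function.update_self, j.2, dif_pos, Fin.eta]
    unfold guessDemand
    congr 1
    · ext l; simp [hT, hn1]
    · funext l; rw [hn1 12 (by norm_num), hu]
    · funext l; exact hfill l
  have hn2 : ∀ r, r ≠ 16 → (run D G.val (.demand 10 12 15 16) s1).nat r = s1.nat r := by
    intro r hr; simp [hr]
  have hr2 : (run D G.val (.demand 10 12 15 16) s1).real = s1.real := rfl
  generalize run D G.val (.demand 10 12 15 16) s1 = s2 at hdem hn2 hr2 ⊢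
  have hval : (fun i : Fin m => s2.nat 16 i) =
      guessDemand G D T (fun i => s.real 10 i) (s.real 14 0) := funext hdem
  rw [run_value, hval]
  have htest : (BExp.rle (.div (rv 14) (.ofNat (.lit 2))) (rv 16)).Holds
      (s2.setReal 16 0 (G.val (guessDemand G D T (fun i => s.real 10 i) (s.real 14 0)))) ↔
      ¬ G.val (guessDemand G D T (fun i => s.real 10 i) (s.real 14 0)) < s.real 14 0 / 2 := by
    simp [hr2, hr1]
  have hctx : Ctx G (s2.setReal 16 0
      (G.val (guessDemand G D T (fun i => s.real 10 i) (s.real 14 0)))) := by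
    refine hs.of_eq ?_ ?_ ?_ ?_ <;> simp [hn2, hn1, hr2, hr1]
  unfold guessAlloc
  by_cases h : G.val (guessDemand G D T (fun i => s.real 10 i) (s.real 14 0)) < s.real 14 0 / 2
  · rw [run_ite_neg _ _ (htest.not.mpr (not_not.mpr h)), if_pos h]
    exact run_fill_nat D G.val hctx.players (fun _ => 0)
      (fun i s' hn hr j => by simp [Fin.ext_iff]) i
  · rw [run_ite_pos _ _ (htest.mpr h), if_neg h, run_prefixCmd D G.val hctx]
    rw [show (s2.setReal 16 0 (G.val (guessDemand G D T (fun i => s.real 10 i)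
        (s.real 14 0)))).nat 10 = s.nat 10 by simp [hn2, hn1],
      show (s2.setReal 16 0 (G.val (guessDemand G D T (fun i => s.real 10 i)
        (s.real 14 0)))).real 10 = s.real 10 by simp [hr2, hr1]]
    simp only [State.setReal_nat, hval]
    rw [hT]

/-- `A_Max` for the players in the integer array `10` and the costs in the real array `10`; the
allocation is returned in the integer array `11` and its value in the real variable `12`. -/
def aMaxCmd : Cmd :=
  unitsCmd ;; bestCmd ;; setN 25 (.lit 0) ;;
  .loop 26 (nv 0) (.setNat 11 (nv 26) (.lit 0)) ;;
  .loop 27 (nv 0)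
    (.ite (.nle (.add (nv 27) (.lit 1)) (nv 13))
      (setR 14 (.mul (.ofNat (.sub (nv 13) (nv 27))) (rv 13)) ;;
        guessCmd ;;
        .value 17 17 ;;
        .ite (.and (.nle (.lit 1) (nv 25)) (.rle (rv 17) (rv 12))) .skip
          (.loop 26 (nv 0) (.setNat 11 (nv 26) (na 17 26)) ;;
            setR 12 (rv 17) ;; setN 25 (.lit 1)))
      .skip) ;;
  .value 11 12

@[simp] theorem aMaxCmd_natWrites : aMaxCmd.natWrites =
    [20, 30, 31, 32, 31, 12, 12, 13, 21, 33, 31, 34, 35, 35, 13, 25, 26, 11, 27, 22, 16, 23, 24,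
      17, 17, 23, 17, 26, 11, 25] := rfl
@[simp] theorem aMaxCmd_realWrites : aMaxCmd.realWrites =
    [30, 13, 31, 13, 14, 15, 15, 16, 18, 18, 17, 12, 12] := rfl

theorem reverse_range_map {α : Type*} (f : ℕ → α) (n : ℕ) :
    (List.range n).reverse.map f = (List.range n).map (fun r => f (n - 1 - r)) := by
  apply List.ext_getElem
  · simp
  · intro i h1 h2
    simp

/-- A later candidate wins only if strictly better, as in the running maximum kept by the program.
-/
theorem argmax_append_singleton {α : Type*} (f : α → ℝ) (l : List α) (a : α) :
    List.argmax f (l ++ [a]) = (List.argmax f l).elim (some a)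
      (fun c => if f c < f a then some a else some c) := by
  classical
  rw [List.argmax_concat]
  cases List.argmax f l <;> simp

/-- The invariant says that the memory holds the `argmax` of the candidates seen so far. The integer
variable 25 tells whether there is one, and rounds beyond the size of `T` are idle. -/
theorem run_aMaxCmd (D : DemandFn m) {G : Game m} {s : State} (hs : Ctx G s) :
    (∀ i : Fin m, (run D G.val aMaxCmd s).nat 11 i =
      aMax G D (memSet m (s.nat 10)) (fun i => s.real 10 i) i) ∧
    (run D G.val aMaxCmd s).real 12 0 =
      G.val (aMax G D (memSet m (s.nat 10)) (fun i => s.real 10 i)) := by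
  classical
  set T := memSet m (s.nat 10) with hT
  set c : Fin m → ℝ := fun i => s.real 10 i with hc
  set g : ℕ → Fin m → ℕ := fun r => guessAlloc G D T c (((T.card - r : ℕ) : ℝ) * maxSingle G T c)
    with hg
  have hlist : (List.range T.card).reverse.map
      (fun j => guessAlloc G D T c (((j + 1 : ℕ) : ℝ) * maxSingle G T c)) =
      (List.range T.card).map g := by
    rw [reverse_range_map]
    refine List.map_congr_left (fun r hr => ?_)
    rw [List.mem_range] at hr
    simp only [hg]
    rw [show T.card - 1 - r + 1 = T.card - r by omega]
  have hTm : T.card ≤ m := by simpa using Finset.card_le_univ T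
  unfold aMaxCmd
  simp only [run_seq]
  have hunits := run_unitsCmd D G.val hs
  -- The intermediate memory is made opaque; only the result and the frame facts are kept.
  generalize hs1 : run D G.val unitsCmd s = s1 at hunits ⊢
  have hn1 : ∀ r, r ∉ unitsCmd.natWrites → s1.nat r = s.nat r := by
    intro r hr; rw [← hs1, run_nat_frame _ _ hr]
  have hr1 : ∀ r, r ∉ unitsCmd.realWrites → s1.real r = s.real r := by
    intro r hr; rw [← hs1, run_real_frame _ _ hr]
  have hctx1 : Ctx G s1 := by refine hs.of_eq ?_ ?_ ?_ ?_ <;> simp [hn1, hr1]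
  obtain ⟨hcard, hbest⟩ := run_bestCmd D G.val hctx1.players
  rw [hn1 10 (by decide)] at hcard hbest
  have hbest' : (run D G.val bestCmd s1).real 13 0 = maxSingle G T c := by
    rw [hbest]
    unfold maxSingle
    simp only [hunits]
    rfl
  generalize hs2 : run D G.val bestCmd s1 = s2 at hcard hbest' ⊢
  have hn2 : ∀ r, r ∉ bestCmd.natWrites → s2.nat r = s1.nat r := by
    intro r hr; rw [← hs2, run_nat_frame _ _ hr]
  have hr2 : ∀ r, r ∉ bestCmd.realWrites → s2.real r = s1.real r := by
    intro r hr; rw [← hs2, run_real_frame _ _ hr]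
  have hctx2 : Ctx G s2 := by refine hctx1.of_eq ?_ ?_ ?_ ?_ <;> simp [hn2, hr2]
  have hctx3 : Ctx G (run D G.val (setN 25 (.lit 0)) s2) := by
    refine hctx2.of_eq ?_ ?_ ?_ ?_ <;> simp
  have hzero := run_fill_nat D G.val (a := 26) (b := 11) (body := .setNat 11 (nv 26) (.lit 0))
    hctx3.players (fun _ => 0) (fun i s' hn hr j => by simp [Fin.ext_iff])
  generalize hs3 : run D G.val (.loop 26 (nv 0) (.setNat 11 (nv 26) (.lit 0)))
    (run D G.val (setN 25 (.lit 0)) s2) = s3 at hzero ⊢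
  have hn3 : ∀ r, r ≠ 25 → r ≠ 26 → r ≠ 11 → s3.nat r = s2.nat r := by
    intro r h1 h2 h3; rw [← hs3]; simp [h1, h2, h3]
  have hr3 : s3.real = s2.real := by funext r; rw [← hs3]; simp
  have h25 : s3.nat 25 0 = 0 := by rw [← hs3]; simp
  have hctx4 : Ctx G s3 := by refine hctx2.of_eq ?_ ?_ ?_ ?_ <;> simp [hn3, hr3]
  have hloop := run_players D G.val (a := 27) (body := .ite (.nle (.add (nv 27) (.lit 1)) (nv 13))
      (setR 14 (.mul (.ofNat (.sub (nv 13) (nv 27))) (rv 13)) ;;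
        guessCmd ;;
        .value 17 17 ;;
        .ite (.and (.nle (.lit 1) (nv 25)) (.rle (rv 17) (rv 12))) .skip
          (.loop 26 (nv 0) (.setNat 11 (nv 26) (na 17 26)) ;;
            setR 12 (rv 17) ;; setN 25 (.lit 1)))
      .skip) hctx4.players
    (fun j s' =>
      (s'.nat 25 0 = 0 ∧ List.argmax G.val ((List.range (min j T.card)).map g) = none ∧
        ∀ i : Fin m, s'.nat 11 i = 0) ∨
      (s'.nat 25 0 = 1 ∧ ∃ A, List.argmax G.val ((List.range (min j T.card)).map g) = some A ∧
        (∀ i : Fin m, s'.nat 11 i = A i) ∧ s'.real 12 0 = G.val A))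
    (Or.inl ⟨h25, by simp, hzero⟩) (by
      intro i s' hn hr hI
      have h13 : s'.nat 13 0 = T.card := by rw [hn 13 (by decide), hn3 13] <;> simp [hcard, hT]
      have r13 : s'.real 13 0 = maxSingle G T c := by rw [hr 13 (by decide), hr3, hbest']
      have h12 : s'.nat 12 = s1.nat 12 := by
        rw [hn 12 (by decide), hn3 12, hn2 12 (by decide)] <;> simp
      have h10 : s'.nat 10 = s.nat 10 := by
        rw [hn 10 (by decide), hn3 10, hn2 10 (by decide), hn1 10 (by decide)] <;> simp
      have r10 : s'.real 10 = s.real 10 := by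
        rw [hr 10 (by decide), hr3, hr2 10 (by decide), hr1 10 (by decide)]
      have hctx5 : Ctx G s' := hctx4.of_eq (hn 0 (by decide)) (hn 1 (by decide)) (hn 3 (by decide))
        (hr 0 (by decide))
      by_cases hlt : (i : ℕ) + 1 ≤ T.card
      swap
      · rw [run_ite_neg]
        · rw [min_eq_right (by omega)] at hI ⊢
          simpa using hI
        · simp [h13]; omega
      rw [run_ite_pos]
      swap
      · simp [h13]; omega
      rw [min_eq_left hlt, List.range_succ, List.map_append, List.map_singleton,
        argmax_append_singleton]
      rw [min_eq_left (by omega)] at hI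
      simp only [run_seq]
      have hA5 : (run D G.val (setR 14 (.mul (.ofNat (.sub (nv 13) (nv 27))) (rv 13)))
          (s'.setNat 27 0 i)).real 14 0 = ((T.card - i : ℕ) : ℝ) * maxSingle G T c := by
        simp [h13, r13]
      generalize hs5 : run D G.val (setR 14 (.mul (.ofNat (.sub (nv 13) (nv 27))) (rv 13)))
        (s'.setNat 27 0 i) = s5 at hA5 ⊢
      have hn5 : ∀ r, r ≠ 27 → s5.nat r = s'.nat r := by
        intro r h1; rw [← hs5]; simp [h1]
      have hr5 : ∀ r, r ≠ 14 → s5.real r = s'.real r := by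
        intro r h1; rw [← hs5]; simp [h1]
      have hctx6 : Ctx G s5 := by refine hctx5.of_eq ?_ ?_ ?_ ?_ <;> simp [hn5, hr5]
      have hguess := run_guessCmd D hctx6 (by
        intro l
        rw [hn5 12 (by norm_num), h12, hunits, hn5 10 (by norm_num), hr5 10 (by norm_num), h10,
          r10])
      rw [hn5 10 (by norm_num), hr5 10 (by norm_num), h10, r10, hA5] at hguess
      have hguess' : (fun l : Fin m => (run D G.val guessCmd s5).nat 17 l) = g i := funext hguess
      generalize hs6 : run D G.val guessCmd s5 = s6 at hguess' ⊢
      have hn6 : ∀ r, r ∉ guessCmd.natWrites → s6.nat r = s5.nat r := by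
        intro r h; rw [← hs6, run_nat_frame _ _ h]
      have hr6 : ∀ r, r ∉ guessCmd.realWrites → s6.real r = s5.real r := by
        intro r h; rw [← hs6, run_real_frame _ _ h]
      rw [run_value, hguess']
      have e25 : s6.nat 25 = s'.nat 25 := by rw [hn6 25 (by decide), hn5 25 (by norm_num)]
      have e11 : s6.nat 11 = s'.nat 11 := by rw [hn6 11 (by decide), hn5 11 (by norm_num)]
      have e0 : s6.nat 0 = s'.nat 0 := by rw [hn6 0 (by decide), hn5 0 (by norm_num)]
      have f12 : s6.real 12 = s'.real 12 := by rw [hr6 12 (by decide), hr5 12 (by norm_num)]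
      have hcopy := run_fill_nat D G.val (a := 26) (b := 11)
        (body := .setNat 11 (nv 26) (na 17 26)) (s := s6.setReal 17 0 (G.val (g i)))
        (by simp [e0, hctx5.players]) (g i) (fun l s' hn hr j => by
          have e17 : s'.nat 17 = s6.nat 17 := hn 17 (by decide)
          simp [Fin.ext_iff, e17, ← hguess'])
      rcases hI with ⟨i1, i2, i3⟩ | ⟨i1, A, i2, i3, i4⟩
      · right
        rw [i2, run_ite_neg]
        · refine ⟨by simp, g i, rfl, fun l => ?_, ?_⟩
          · simpa using hcopy l
          · simp
        · simp [e25, i1]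
      · right
        rw [i2]
        by_cases hle : G.val (g i) ≤ G.val A
        · rw [run_ite_pos]
          · refine ⟨by simp [e25, i1], A, by simp [not_lt.mpr hle], fun l => ?_, ?_⟩
            · simp [e11, i3]
            · simp [f12, i4]
          · simp [e25, i1, f12, i4, hle]
        · rw [run_ite_neg]
          · refine ⟨by simp, g i, by simp [not_le.mp hle], fun l => ?_, ?_⟩
            · simpa using hcopy l
            · simp
          · simp [e25, i1, f12, i4, hle])
  rw [min_eq_right hTm] at hloop
  generalize run D G.val (.loop 27 (nv 0) _) s3 = s4 at hloop ⊢
  have hfinal : (fun i : Fin m => s4.nat 11 i) = aMax G D T c := by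
    unfold aMax
    rw [hlist]
    rcases hloop with ⟨_, h2, h3⟩ | ⟨_, A, h2, h3, _⟩
    · rw [h2]; funext i; exact h3 i
    · rw [h2]; funext i; exact h3 i
  rw [run_value]
  refine ⟨fun i => congrFun hfinal i, ?_⟩
  rw [hfinal]; simp

/-! ## Random sampling -/

/-- The logarithm with base `2`. -/
abbrev logTwo (x : RExp) : RExp := .div (.ln x) (.ln (.ofNat (.lit 2)))

/-- The acceptance threshold. -/
abbrev thresholdExp : RExp :=
  .div (logTwo (logTwo (.ofNat (nv 3)))) (.mul (.ofNat (.lit 64)) (logTwo (.ofNat (nv 3))))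

/-- One round of random sampling; the number of the previous round is in the integer variable
`42`, and the integer variable `43` is set if the round accepts. -/
def roundCmd : Cmd :=
  setR 44 (.div (rv 0) (.ofNat (.add (nv 42) (.lit 1)))) ;;
  .loop 40 (nv 0)
    (.setReal 10 (nv 40) (rv 44) ;;
      .ite (.and (.nle (na 6 40) (.lit 0)) (.rle (ra 1 40) (rv 44)))
        (.setNat 10 (nv 40) (.lit 1)) (.setNat 10 (nv 40) (.lit 0))) ;;
  aMaxCmd ;;
  .ite (.rle (rv 40) (rv 12))
    (setN 43 (.lit 1) ;;
      .loop 40 (nv 0)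
        (.setNat 2 (nv 40) (na 11 40) ;;
          .setReal 2 (nv 40) (.mul (.ofNat (na 11 40)) (rv 44))))
    .skip

@[simp] theorem roundCmd_natWrites : roundCmd.natWrites =
    40 :: 10 :: 10 :: (aMaxCmd.natWrites ++ [43, 40, 2]) := rfl
@[simp] theorem roundCmd_realWrites : roundCmd.realWrites =
    44 :: 10 :: (aMaxCmd.realWrites ++ [2]) := rfl

open Classical in
-- The real variable 40 holds the acceptance bound. Output arrays are written only on acceptance, so
-- rejected rounds leave the null outcome in place.
theorem run_roundCmd (D : DemandFn m) {G : Game m} {c : Fin m → ℝ} {s : State} (hs : Ctx G s)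
    (hc : ∀ i : Fin m, s.real 1 i = c i) {k : ℕ} (hk : s.nat 42 0 + 1 = k) :
    if s.real 40 0 ≤ G.val (roundAlloc G D (memSet m (s.nat 6)) c k) then
      (run D G.val roundCmd s).nat 43 0 = 1 ∧
        output m (run D G.val roundCmd s) = roundOutcome G D (memSet m (s.nat 6)) c k
    else
      (run D G.val roundCmd s).nat 43 = s.nat 43 ∧
        output m (run D G.val roundCmd s) = output m s := by
  set T := memSet m (s.nat 6) with hT
  unfold roundCmd
  simp only [run_seq]
  generalize hs1 : run D G.val (setR 44 (.div (rv 0) (.ofNat (.add (nv 42) (.lit 1))))) s = s1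
  have hn1 : s1.nat = s.nat := by rw [← hs1]; rfl
  have hr1 : ∀ r, r ≠ 44 → s1.real r = s.real r := by
    intro r hr; rw [← hs1]; simp [hr]
  have h44 : s1.real 44 0 = roundPrice G k := by
    rw [← hs1]; simp [roundPrice, hs.budget, ← hk]
  have hctx1 : Ctx G s1 := by refine hs.of_eq ?_ ?_ ?_ ?_ <;> simp [hn1, hr1]
  have hfill1 := run_fill_nat D G.val (a := 40) (b := 10) (body := .setReal 10 (nv 40) (rv 44) ;;
      .ite (.and (.nle (na 6 40) (.lit 0)) (.rle (ra 1 40) (rv 44)))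
        (.setNat 10 (nv 40) (.lit 1)) (.setNat 10 (nv 40) (.lit 0))) hctx1.players
    (fun i => if i ∈ Tᶜ.filter (fun i => c i ≤ roundPrice G k) then 1 else 0) (by
      intro i s' hn hr j
      have h6 : s'.nat 6 = s.nat 6 := by rw [hn 6 (by decide), hn1]
      have r1 : s'.real 1 = s.real 1 := by rw [hr 1 (by decide), hr1 1 (by norm_num)]
      have r44 : s'.real 44 = s1.real 44 := hr 44 (by decide)
      simp only [run_seq, run_ite]
      have htest : (BExp.and (.nle (na 6 40) (.lit 0)) (.rle (ra 1 40) (rv 44))).Holds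
          (run D G.val (.setReal 10 (nv 40) (rv 44)) (s'.setNat 40 0 i)) ↔
          i ∈ Tᶜ.filter (fun i => c i ≤ roundPrice G k) := by
        simp [h6, r1, r44, h44, hc, hT]
      rw [if_congr htest rfl rfl]
      split_ifs <;> simp_all [Fin.ext_iff])
  have hfill2 := run_fill_real D G.val (a := 40) (b := 10) (body := .setReal 10 (nv 40) (rv 44) ;;
      .ite (.and (.nle (na 6 40) (.lit 0)) (.rle (ra 1 40) (rv 44)))
        (.setNat 10 (nv 40) (.lit 1)) (.setNat 10 (nv 40) (.lit 0))) hctx1.players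
    (fun i => roundPrice G k) (by
      intro i s' hn hr j
      have r44 : s'.real 44 = s1.real 44 := hr 44 (by decide)
      simp only [run_seq]
      rw [run_real_frame D G.val (c := .ite _ _ _) (by simp)]
      simp [r44, h44, Fin.ext_iff])
  generalize hs2 : run D G.val (.loop 40 (nv 0) (.setReal 10 (nv 40) (rv 44) ;;
      .ite (.and (.nle (na 6 40) (.lit 0)) (.rle (ra 1 40) (rv 44)))
        (.setNat 10 (nv 40) (.lit 1)) (.setNat 10 (nv 40) (.lit 0)))) s1 = s2 at hfill1 hfill2 ⊢
  have hn2 : ∀ r, r ≠ 40 → r ≠ 10 → s2.nat r = s.nat r := by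
    intro r h1 h2; rw [← hs2, run_nat_frame D G.val (by simp [h1, h2]), hn1]
  have hr2 : ∀ r, r ≠ 10 → s2.real r = s1.real r := by
    intro r h1; rw [← hs2, run_real_frame D G.val (by simp [h1])]
  have hctx2 : Ctx G s2 := by refine hctx1.of_eq ?_ ?_ ?_ ?_ <;> simp [hn2, hr2, hn1]
  have hset : memSet m (s2.nat 10) = Tᶜ.filter (fun i => c i ≤ roundPrice G k) := by
    ext i
    rw [mem_memSet, hfill1]
    split_ifs with h <;> simp [h]
  have hcost : (fun i : Fin m => s2.real 10 i) = fun _ => roundPrice G k := funext hfill2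
  obtain ⟨h11, h12⟩ := run_aMaxCmd D hctx2
  rw [hset, hcost] at h11 h12
  change ∀ i : Fin m, _ = roundAlloc G D T c k i at h11
  change _ = G.val (roundAlloc G D T c k) at h12
  generalize hs3 : run D G.val aMaxCmd s2 = s3 at h11 h12 ⊢
  have hn3 : ∀ r, r ∉ aMaxCmd.natWrites → s3.nat r = s2.nat r := by
    intro r h; rw [← hs3, run_nat_frame _ _ h]
  have hr3 : ∀ r, r ∉ aMaxCmd.realWrites → s3.real r = s2.real r := by
    intro r h; rw [← hs3, run_real_frame _ _ h]
  have h40 : s3.real 40 = s.real 40 := by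
    rw [hr3 40 (by decide), hr2 40 (by norm_num), hr1 40 (by norm_num)]
  have h44' : s3.real 44 0 = roundPrice G k := by
    rw [hr3 44 (by decide), hr2 44 (by norm_num), h44]
  split_ifs with hacc
  · rw [run_ite_pos]
    swap
    · simp [h40, h12, hacc]
    simp only [run_seq]
    generalize hs4 : run D G.val (setN 43 (.lit 1)) s3 = s4
    have hp : s4.nat 0 0 = m := by
      rw [← hs4]; simp [hn3, hn2, hs.players]
    have e11 : s4.nat 11 = s3.nat 11 := by rw [← hs4]; simp
    have e44 : s4.real = s3.real := by rw [← hs4]; simp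
    refine ⟨?_, ?_⟩
    · rw [run_nat_frame D G.val (by simp), ← hs4]; simp
    · unfold output roundOutcome
      congr 1
      · funext i
        refine run_fill_nat D G.val hp (roundAlloc G D T c k) ?_ i
        intro i s' hn hr j
        have h11' : s'.nat 11 = s3.nat 11 := by rw [hn 11 (by decide), e11]
        simp [h11', h11, Fin.ext_iff]
      · funext i
        refine run_fill_real D G.val hp
          (fun i => (roundAlloc G D T c k i : ℝ) * roundPrice G k) ?_ i
        intro i s' hn hr j
        have h11' : s'.nat 11 = s3.nat 11 := by rw [hn 11 (by decide), e11]
        have r44' : s'.real 44 = s3.real 44 := by rw [hr 44 (by decide), e44]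
        simp [h11', h11, r44', h44', Fin.ext_iff]
  · rw [run_ite_neg]
    swap
    · simp [h40, h12, hacc]
    rw [run_skip]
    refine ⟨by simp [hn3, hn2], ?_⟩
    unfold output
    congr 1
    · funext i; rw [hn3 2 (by decide), hn2] <;> simp
    · funext i; rw [hr3 2 (by decide), hr2, hr1] <;> simp

/-- Random sampling, where the group `T` is in the integer array `6`. -/
def randCmd : Cmd :=
  .loop 40 (nv 0) (.setNat 10 (nv 40) (na 6 40) ;; .setReal 10 (nv 40) (ra 1 40)) ;;
  aMaxCmd ;;
  setR 40 (.mul thresholdExp (rv 12)) ;;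
  setN 41 (.lit 0) ;;
  .loop 40 (nv 0) (.ite (nonzero 6 40) .skip (setN 41 (.add (nv 41) (na 1 40)))) ;;
  setN 43 (.lit 0) ;;
  .loop 42 (nv 3)
    (.ite (.and (.nle (nv 43) (.lit 0)) (.nle (.add (nv 42) (.lit 1)) (nv 41))) roundCmd .skip)

theorem run_randCmd (D : DemandFn m) {G : Game m} {c : Fin m → ℝ} {s : State} (hs : Ctx G s)
    (hc : ∀ i : Fin m, s.real 1 i = c i) (hout : output m s = ⟨0, 0⟩) :
    output m (run D G.val randCmd s) = randMech G D (memSet m (s.nat 6)) c := by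
  classical
  set T := memSet m (s.nat 6) with hT
  unfold randCmd
  simp only [run_seq]
  have hfill1 := run_fill_nat D G.val (a := 40) (b := 10)
    (body := .setNat 10 (nv 40) (na 6 40) ;; .setReal 10 (nv 40) (ra 1 40)) hs.players
    (fun i => s.nat 6 i) (by
      intro i s' hn hr j
      have h6 : s'.nat 6 = s.nat 6 := hn 6 (by decide)
      simp [h6, Fin.ext_iff])
  have hfill2 := run_fill_real D G.val (a := 40) (b := 10)
    (body := .setNat 10 (nv 40) (na 6 40) ;; .setReal 10 (nv 40) (ra 1 40)) hs.players c (by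
      intro i s' hn hr j
      have r1 : s'.real 1 = s.real 1 := hr 1 (by decide)
      simp [r1, hc, Fin.ext_iff])
  generalize hs1 : run D G.val (.loop 40 (nv 0)
    (.setNat 10 (nv 40) (na 6 40) ;; .setReal 10 (nv 40) (ra 1 40))) s = s1 at hfill1 hfill2 ⊢
  have hn1 : ∀ r, r ≠ 40 → r ≠ 10 → s1.nat r = s.nat r := by
    intro r h1 h2; rw [← hs1, run_nat_frame D G.val (by simp [h1, h2])]
  have hr1 : ∀ r, r ≠ 10 → s1.real r = s.real r := by
    intro r h1; rw [← hs1, run_real_frame D G.val (by simp [h1])]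
  have hctx1 : Ctx G s1 := by refine hs.of_eq ?_ ?_ ?_ ?_ <;> simp [hn1, hr1]
  have hset : memSet m (s1.nat 10) = T := by
    ext i
    rw [mem_memSet, hfill1, hT, mem_memSet]
  have hcost : (fun i : Fin m => s1.real 10 i) = c := funext hfill2
  obtain ⟨-, h12⟩ := run_aMaxCmd D hctx1
  rw [hset, hcost] at h12
  generalize hs2 : run D G.val aMaxCmd s1 = s2 at h12 ⊢
  have hn2 : ∀ r, r ∉ aMaxCmd.natWrites → s2.nat r = s1.nat r := by
    intro r h; rw [← hs2, run_nat_frame _ _ h]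
  have hr2 : ∀ r, r ∉ aMaxCmd.realWrites → s2.real r = s1.real r := by
    intro r h; rw [← hs2, run_real_frame _ _ h]
  have hctx2 : Ctx G s2 := by refine hctx1.of_eq ?_ ?_ ?_ ?_ <;> simp [hn2, hr2]
  have h40 : (run D G.val (setR 40 (.mul thresholdExp (rv 12))) s2).real 40 0 =
      threshold G.total * G.val (aMax G D T c) := by
    simp [hctx2.total, h12, threshold, Real.logb]
  generalize hs3 : run D G.val (setR 40 (.mul thresholdExp (rv 12))) s2 = s3 at h40 ⊢
  have hn3 : s3.nat = s2.nat := by rw [← hs3]; rfl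
  have hr3 : ∀ r, r ≠ 40 → s3.real r = s2.real r := by
    intro r h; rw [← hs3]; simp [h]
  have hctx3 : Ctx G s3 := by refine hctx2.of_eq ?_ ?_ ?_ ?_ <;> simp [hn3, hr3]
  have h6' : s3.nat 6 = s.nat 6 := by rw [hn3, hn2 6 (by decide), hn1] <;> simp
  have hTc : Tᶜ = below (fun i : Fin m => s.nat 6 i = 0) m := by
    ext i; simp [hT]
  have hsum := run_players D G.val (a := 40)
    (body := .ite (nonzero 6 40) .skip (setN 41 (.add (nv 41) (na 1 40))))
    (s := run D G.val (setN 41 (.lit 0)) s3) (by simpa using hctx3.players)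
    (fun j s' => s'.nat 41 0 = ∑ i ∈ below (fun i : Fin m => s.nat 6 i = 0) j, G.units i)
    (by simp) (by
      intro i s' hn hr hI
      have e6 : s'.nat 6 = s.nat 6 := by rw [hn 6 (by decide), ← h6']; simp
      have e1 : s'.nat 1 = s3.nat 1 := by rw [hn 1 (by decide)]; simp
      by_cases h : s.nat 6 i = 0
      · rw [run_ite_neg, below_succ h, Finset.sum_insert (by simp), ← hI]
        · simp [e1, hctx3.units, add_comm]
        · simp [e6, h]
      · rw [run_ite_pos, below_succ_of_not h, ← hI]
        · simp
        · simp [e6]; omega)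
  rw [← hTc] at hsum
  generalize hs4 : run D G.val (.loop 40 (nv 0)
    (.ite (nonzero 6 40) .skip (setN 41 (.add (nv 41) (na 1 40)))))
    (run D G.val (setN 41 (.lit 0)) s3) = s4 at hsum ⊢
  have hn4 : ∀ r, r ≠ 40 → r ≠ 41 → s4.nat r = s3.nat r := by
    intro r h1 h2; rw [← hs4, run_nat_frame D G.val (by simp [h1, h2])]; simp [h2]
  have hr4 : s4.real = s3.real := by
    funext r; rw [← hs4, run_real_frame D G.val (by simp)]; simp
  have hctx4 : Ctx G (run D G.val (setN 43 (.lit 0)) s4) := by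
    refine hctx3.of_eq ?_ ?_ ?_ ?_ <;> simp [hn4, hr4]
  have hout4 : output m (run D G.val (setN 43 (.lit 0)) s4) = ⟨0, 0⟩ := by
    rw [← hout]
    unfold output
    congr 1
    · funext i; simp [hn4, hn3, hn2, hn1]
    · funext i; simp [hr4, hr3, hr2, hr1]
  have hN : ∑ i ∈ Tᶜ, G.units i ≤ G.total := by
    unfold Game.total
    exact Finset.sum_le_sum_of_subset (Finset.subset_univ _)
  have hloop := run_loop_induct D G.val (a := 42) (bound := nv 3) (N := G.total)
    (body := .ite (.and (.nle (nv 43) (.lit 0)) (.nle (.add (nv 42) (.lit 1)) (nv 41)))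
      roundCmd .skip) (s := run D G.val (setN 43 (.lit 0)) s4) hctx4.total
    -- Either all rounds so far have rejected and the output is null, or the final outcome has been
    -- written and the flag 43 keeps later rounds idle.
    (fun j s' =>
      (s'.nat 43 0 = 0 ∧ (∀ k, 1 ≤ k → k ≤ j → k ≤ ∑ i ∈ Tᶜ, G.units i → ¬ Accepts G D T c k) ∧
        output m s' = ⟨0, 0⟩) ∨
      (s'.nat 43 0 = 1 ∧ output m s' = randMech G D T c))
    (Or.inl ⟨by simp, fun k h1 h2 => by omega, hout4⟩) (by
      intro j hj s' hn hr hI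
      have e41 : s'.nat 41 0 = ∑ i ∈ Tᶜ, G.units i := by
        rw [hn 41 (by decide), ← hsum]; simp
      rcases hI with ⟨i1, i2, i3⟩ | ⟨i1, i2⟩
      · by_cases hle : j + 1 ≤ ∑ i ∈ Tᶜ, G.units i
        · rw [run_ite_pos]
          swap
          · simp [i1, e41, hle]
          have hctx5 : Ctx G (s'.setNat 42 0 j) := by
            refine hctx4.of_eq ?_ ?_ ?_ ?_
            · rw [← hn 0 (by decide)]; simp
            · rw [← hn 1 (by decide)]; simp
            · rw [← hn 3 (by decide)]; simp
            · rw [← hr 0 (by decide)]; simp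
          have hc5 : ∀ i : Fin m, (s'.setNat 42 0 j).real 1 i = c i := by
            intro i
            rw [State.setNat_real, hr 1 (by decide), ← hc i]
            simp [hr4, hr3, hr2, hr1]
          have hround := run_roundCmd D hctx5 hc5 (k := j + 1) (by simp)
          have e6 : (s'.setNat 42 0 j).nat 6 = s.nat 6 := by
            rw [State.setNat_nat_of_ne _ (by norm_num), hn 6 (by decide)]
            simp [hn4, h6']
          have e40 : (s'.setNat 42 0 j).real 40 0 = threshold G.total * G.val (aMax G D T c) := by
            rw [State.setNat_real, hr 40 (by decide), ← h40]
            simp [hr4]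
          rw [e6, e40, ← hT] at hround
          by_cases hacc : threshold G.total * G.val (aMax G D T c) ≤
              G.val (roundAlloc G D T c (j + 1))
          · rw [if_pos hacc] at hround
            refine Or.inr ⟨hround.1, hround.2.trans ?_⟩
            exact (randMech_eq_of_accepts (by omega) hle hacc
              (fun k' h1 h2 => i2 k' h1 (by omega) (by omega))).symm
          · rw [if_neg hacc] at hround
            refine Or.inl ⟨?_, ?_, ?_⟩
            · rw [hround.1]; simp [i1]
            · intro k h1 h2 h3
              rcases Nat.lt_or_ge j k with h | h
              · have : k = j + 1 := by omega
                rw [this]; exact hacc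
              · exact i2 k h1 h h3
            · rw [hround.2, ← i3]
              unfold output
              congr 1
        · rw [run_ite_neg]
          swap
          · simp [i1, e41, hle]
          refine Or.inl ⟨by simp [i1], fun k h1 h2 h3 => i2 k h1 (by omega) h3, ?_⟩
          rw [← i3]
          unfold output
          congr 1
      · rw [run_ite_neg]
        swap
        · simp [i1]
        refine Or.inr ⟨by simp [i1], ?_⟩
        rw [← i2]
        unfold output
        congr 1)
  rcases hloop with ⟨_, h2, h3⟩ | ⟨_, h2⟩
  · rw [h3, randMech_eq_of_not_accepts (fun k hk1 hk => h2 k hk1 (hk.trans hN) hk)]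
  · exact h2

/-! ## Buying from one player -/

/-- The affordable numbers of units of all players and their values, in the integer array `50` and
the real array `50`. -/
def soloCmd : Cmd :=
  .loop 60 (nv 0)
    (setN 30 (na 1 60) ;; setR 30 (ra 1 60) ;; affordCmd ;; .setNat 50 (nv 60) (nv 31) ;;
      setN 33 (nv 60) ;; singleCmd ;; .setReal 50 (nv 60) (rv 31))

@[simp] theorem soloCmd_natWrites : soloCmd.natWrites =
    [60, 30, 31, 32, 31, 50, 33, 34, 35, 35] := rfl
@[simp] theorem soloCmd_realWrites : soloCmd.realWrites = [30, 31, 50] := rfl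

theorem run_soloCmd (D : DemandFn m) {G : Game m} {c : Fin m → ℝ} {s : State} (hs : Ctx G s)
    (hc : ∀ i : Fin m, s.real 1 i = c i) :
    (∀ i : Fin m, (run D G.val soloCmd s).nat 50 i = soloUnits G c i) ∧
      ∀ i : Fin m, (run D G.val soloCmd s).real 50 i = soloVal G c i := by
  have key : ∀ (i : Fin m) (s' : State),
      (∀ r, r ∉ soloCmd.natWrites → s'.nat r = s.nat r) →
      (∀ r, r ∉ soloCmd.realWrites → s'.real r = s.real r) →
      (run D G.val affordCmd (run D G.val (setR 30 (ra 1 60)) (run D G.val (setN 30 (na 1 60))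
        (s'.setNat 60 0 i)))).nat 31 0 = soloUnits G c i := by
    intro i s' hn hr
    have h1 : s'.nat 1 = s.nat 1 := hn 1 (by decide)
    have h3 : s'.nat 3 = s.nat 3 := hn 3 (by decide)
    have r1 : s'.real 1 = s.real 1 := hr 1 (by decide)
    have r0 : s'.real 0 = s.real 0 := hr 0 (by decide)
    rw [run_affordCmd]
    · simp [h1, r0, r1, hs.units, hs.budget, hc, soloUnits]
    · simpa [h1, h3, hs.units, hs.total] using G.units_le_total i
  unfold soloCmd
  constructor
  · refine run_fill_nat D G.val hs.players _ ?_
    intro i s' hn hr j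
    have h := key i s' hn hr
    simp only [run_seq]
    generalize hs1 : run D G.val affordCmd (run D G.val (setR 30 (ra 1 60))
      (run D G.val (setN 30 (na 1 60)) (s'.setNat 60 0 i))) = s1 at h ⊢
    have e60 : s1.nat 60 0 = i := by rw [← hs1]; simp
    have e50 : s1.nat 50 = s'.nat 50 := by rw [← hs1]; simp
    simp [h, e60, e50, Fin.ext_iff]
  · refine run_fill_real D G.val hs.players _ ?_
    intro i s' hn hr j
    have h := key i s' hn hr
    have h0 : s'.nat 0 = s.nat 0 := hn 0 (by decide)
    simp only [run_seq]
    generalize hs1 : run D G.val affordCmd (run D G.val (setR 30 (ra 1 60))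
      (run D G.val (setN 30 (na 1 60)) (s'.setNat 60 0 i))) = s1 at h ⊢
    have e60 : s1.nat 60 0 = i := by rw [← hs1]; simp
    have e0 : s1.nat 0 = s'.nat 0 := by rw [← hs1]; simp
    have e50 : s1.real 50 = s'.real 50 := by rw [← hs1]; simp
    have hv := run_singleCmd D G.val (s := run D G.val (setN 33 (nv 60))
      (run D G.val (.setNat 50 (nv 60) (nv 31)) s1)) (i := i) (by simp [e0, h0, hs.players])
      (by simp [e60])
    rw [show (run D G.val (setN 33 (nv 60))
      (run D G.val (.setNat 50 (nv 60) (nv 31)) s1)).nat 31 0 = soloUnits G c i by simp [h]] at hv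
    rw [run_setReal, State.setReal_real]
    rw [show RExp.eval _ (rv 31) = G.val (single i (soloUnits G c i)) from hv]
    simp [e60, e50, Fin.ext_iff, soloVal]

/-- The integer variable `54` tells whether the player in the integer variable `53` comes first if
his key is in the real variable `53` and the keys of the others are in the real array `50`. -/
def firstCmd : Cmd :=
  setN 54 (.lit 1) ;;
  .loop 61 (nv 0)
    (.ite (.and (.not (.and (.nle (nv 61) (nv 53)) (.nle (nv 53) (nv 61))))
        (.not (rankTest (rv 53) (ra 50 61) (nv 53) (nv 61))))
      (setN 54 (.lit 0)) .skip)

@[simp] theorem firstCmd_natWrites : firstCmd.natWrites = [54, 61, 54] := rfl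
@[simp] theorem firstCmd_realWrites : firstCmd.realWrites = [] := rfl

open Classical in
-- The entry of `i` in the list of keys is skipped, so the block also answers for hypothetical
-- numbers of units, as the search for the smallest index needs.
theorem run_firstCmd (D : DemandFn m) {G : Game m} {c : Fin m → ℝ} {s : State}
    (hs : s.nat 0 0 = m) (hv : ∀ i : Fin m, s.real 50 i = soloVal G c i) {i : Fin m} {a : ℕ}
    (hi : s.nat 53 0 = i) (ha : s.real 53 0 = G.val (single i a)) :
    (run D G.val firstCmd s).nat 54 0 = if FirstAt G c i a then 1 else 0 := by
  unfold firstCmd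
  rw [run_seq]
  have hloop := run_players D G.val (a := 61)
    (body := .ite (.and (.not (.and (.nle (nv 61) (nv 53)) (.nle (nv 53) (nv 61))))
        (.not (rankTest (rv 53) (ra 50 61) (nv 53) (nv 61))))
      (setN 54 (.lit 0)) .skip) (s := run D G.val (setN 54 (.lit 1)) s) (by simpa using hs)
    (fun j s' => s'.nat 54 0 = if ∀ l : Fin m, (l : ℕ) < j → l ≠ i →
      (soloVal G c l < G.val (single i a) ∨ (G.val (single i a) = soloVal G c l ∧ i ≤ l))
      then 1 else 0) (by simp) (by
      intro l s' hn hr hI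
      have h53 : s'.nat 53 = s.nat 53 := by rw [hn 53 (by decide)]; simp
      have r53 : s'.real 53 = s.real 53 := by rw [hr 53 (by decide)]; simp
      have r50 : s'.real 50 = s.real 50 := by rw [hr 50 (by decide)]; simp
      have htest : (BExp.and (.not (.and (.nle (nv 61) (nv 53)) (.nle (nv 53) (nv 61))))
        (.not (rankTest (rv 53) (ra 50 61) (nv 53) (nv 61)))).Holds (s'.setNat 61 0 l) ↔
        ¬ (l ≠ i → (soloVal G c l < G.val (single i a) ∨
          (G.val (single i a) = soloVal G c l ∧ i ≤ l))) := by
        simp only [BExp.Holds, holds_rankTest]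
        simp only [RExp.eval, NExp.eval, State.setNat_nat, State.setNat_real]
        simp only [h53, r53, r50, hi, ha]
        simp only [Nat.reduceEqDiff, false_and, if_false, and_self, if_true, ← le_antisymm_iff,
          Fin.val_fin_le, Classical.not_imp, ne_eq]
        rw [hv l]
      by_cases h : (l ≠ i → (soloVal G c l < G.val (single i a) ∨
          (G.val (single i a) = soloVal G c l ∧ i ≤ l)))
      · rw [run_ite_neg _ _ (htest.not.mpr (not_not.mpr h)), run_skip]
        rw [State.setNat_nat, if_neg (by norm_num), hI]
        refine if_congr ⟨fun h' l' hl' => ?_, fun h' l' hl' => h' l' (by omega)⟩ rfl rfl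
        by_cases hll : l' = l
        · rw [hll]; exact h
        · have : (l' : ℕ) ≠ l := fun h'' => hll (Fin.ext h'')
          exact h' l' (by omega)
      · rw [run_ite_pos _ _ (htest.mpr h), if_neg (fun h' => h (h' l (by omega)))]
        simp)
  rw [hloop]
  refine if_congr ?_ rfl rfl
  unfold FirstAt
  exact ⟨fun h l hl => h l l.2 hl, fun h l _ hl => h l hl⟩

theorem isFirst_update_iff {G : Game m} (c : Fin m → ℝ) (i : Fin m) (b : ℝ) :
    IsFirst G (Function.update c i b) i ↔ FirstAt G c i (affordable G.budget (G.units i) b) := by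
  rw [isFirst_iff, firstAt_update]
  simp [soloUnits]

/-- One step of the search for the smallest index: if it is still missing in the integer variable
`55`, try the next one after the integer variable `63` for the player in the integer variable
`62`. -/
def indexStepCmd : Cmd :=
  .ite (.and (.nle (nv 55) (.lit 0)) (.nle (.add (nv 63) (.lit 1)) (na 50 62)))
    (setN 30 (na 1 62) ;; setR 30 (.div (rv 0) (.ofNat (.add (nv 63) (.lit 1)))) ;; affordCmd ;;
      setN 33 (nv 62) ;; singleCmd ;; setN 53 (nv 62) ;; setR 53 (rv 31) ;; firstCmd ;;
      .ite (.nle (.lit 1) (nv 54)) (setN 55 (.add (nv 63) (.lit 1))) .skip)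
    .skip

/-- Find the smallest index, for the player in the integer variable `62`. -/
def indexCmd : Cmd :=
  setN 55 (.lit 0) ;; .loop 63 (nv 3) indexStepCmd

@[simp] theorem indexStepCmd_natWrites : indexStepCmd.natWrites =
    [30, 31, 32, 31, 33, 34, 35, 35, 53, 54, 61, 54, 55] := rfl
@[simp] theorem indexStepCmd_realWrites : indexStepCmd.realWrites = [30, 31, 53] := rfl
@[simp] theorem indexCmd_natWrites : indexCmd.natWrites =
    [55, 63, 30, 31, 32, 31, 33, 34, 35, 35, 53, 54, 61, 54, 55] := rfl
@[simp] theorem indexCmd_realWrites : indexCmd.realWrites = [30, 31, 53] := rfl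

theorem run_indexCmd (D : DemandFn m) {G : Game m} {c : Fin m → ℝ} {s : State} (hs : Ctx G s)
    (hu : ∀ i : Fin m, s.nat 50 i = soloUnits G c i)
    (hv : ∀ i : Fin m, s.real 50 i = soloVal G c i) {i : Fin m} (hi : s.nat 62 0 = i) :
    (run D G.val indexCmd s).nat 55 0 = firstIndex G c i := by
  classical
  unfold indexCmd
  rw [run_seq]
  set K : Set ℕ := {k : ℕ | 1 ≤ k ∧ k ≤ soloUnits G c i ∧
    IsFirst G (Function.update c i (G.budget / k)) i} with hK
  have hctx1 : Ctx G (run D G.val (setN 55 (.lit 0)) s) := by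
    refine hs.of_eq ?_ ?_ ?_ ?_ <;> simp
  have hloop := run_loop_induct D G.val (a := 63) (bound := nv 3) (N := G.total)
    (body := indexStepCmd) (s := run D G.val (setN 55 (.lit 0)) s) hctx1.total
    -- Indices start at 1, so 0 can stand for "not found yet".
    (fun j s' => (s'.nat 55 0 = 0 ∧ ∀ k ∈ K, j < k) ∨
      (1 ≤ s'.nat 55 0 ∧ s'.nat 55 0 ∈ K ∧ ∀ k ∈ K, s'.nat 55 0 ≤ k))
    (Or.inl ⟨by simp, fun k hk => hk.1⟩) (by
      intro j hj s' hn hr hI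
      have h0 : s'.nat 0 = s.nat 0 := by rw [hn 0 (by decide)]; simp
      have h1 : s'.nat 1 = s.nat 1 := by rw [hn 1 (by decide)]; simp
      have h3 : s'.nat 3 = s.nat 3 := by rw [hn 3 (by decide)]; simp
      have h50 : s'.nat 50 = s.nat 50 := by rw [hn 50 (by decide)]; simp
      have h62 : s'.nat 62 = s.nat 62 := by rw [hn 62 (by decide)]; simp
      have r0 : s'.real 0 = s.real 0 := by rw [hr 0 (by decide)]; simp
      have r50 : s'.real 50 = s.real 50 := by rw [hr 50 (by decide)]; simp
      unfold indexStepCmd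
      rcases hI with ⟨i1, i2⟩ | ⟨i1, i2⟩
      swap
      · rw [run_ite_neg]
        · simpa using Or.inr ⟨i1, i2⟩
        · simp; omega
      by_cases hle : j + 1 ≤ soloUnits G c i
      swap
      · rw [run_ite_neg]
        · left
          refine ⟨by simpa using i1, fun k hk => ?_⟩
          have h1 := hk.2.1
          have h2 := i2 k hk
          omega
        · simp [h50, h62, hi, hu, hle]
      rw [run_ite_pos]
      swap
      · simp [h50, h62, hi, hu, hle, i1]
      simp only [run_seq]
      have haff : (run D G.val affordCmd (run D G.val (setR 30 (.div (rv 0)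
          (.ofNat (.add (nv 63) (.lit 1))))) (run D G.val (setN 30 (na 1 62))
          (s'.setNat 63 0 j)))).nat 31 0 =
          affordable G.budget (G.units i) (G.budget / ((j + 1 : ℕ) : ℝ)) := by
        rw [run_affordCmd]
        · simp [h1, h62, hi, r0, hs.units, hs.budget]
        · simpa [h1, h62, hi, h3, hs.units, hs.total] using G.units_le_total i
      generalize hs1 : run D G.val affordCmd (run D G.val (setR 30 (.div (rv 0)
          (.ofNat (.add (nv 63) (.lit 1))))) (run D G.val (setN 30 (na 1 62))
          (s'.setNat 63 0 j))) = s1 at haff ⊢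
      have hn1 : ∀ r, r ∉ [30, 31, 32, 63] → s1.nat r = s'.nat r := by
        intro r h
        simp only [List.mem_cons, not_or, List.not_mem_nil, not_false_eq_true, and_true] at h
        rw [← hs1]; simp [h]
      have hr1 : ∀ r, r ≠ 30 → s1.real r = s'.real r := by
        intro r h; rw [← hs1]; simp [h]
      have e63 : s1.nat 63 0 = j := by rw [← hs1]; simp
      have hv1 := run_singleCmd D G.val (s := run D G.val (setN 33 (nv 62)) s1) (i := i)
        (by simp [hn1, h0, hs.players]) (by simp [hn1, h62, hi])
      rw [show (run D G.val (setN 33 (nv 62)) s1).nat 31 0 =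
        affordable G.budget (G.units i) (G.budget / ((j + 1 : ℕ) : ℝ)) by simp [haff]] at hv1
      generalize hs2 : run D G.val singleCmd (run D G.val (setN 33 (nv 62)) s1) = s2 at hv1 ⊢
      have hn2 : ∀ r, r ∉ [33, 34, 35] → s2.nat r = s1.nat r := by
        intro r h
        simp only [List.mem_cons, not_or, List.not_mem_nil, not_false_eq_true, and_true] at h
        rw [← hs2]; simp [h]
      have hr2 : ∀ r, r ≠ 31 → s2.real r = s1.real r := by
        intro r h; rw [← hs2]; simp [h]
      have hfirst := run_firstCmd D (G := G) (c := c)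
        (s := run D G.val (setR 53 (rv 31)) (run D G.val (setN 53 (nv 62)) s2)) (i := i)
        (a := affordable G.budget (G.units i) (G.budget / ((j + 1 : ℕ) : ℝ)))
        (by simp [hn2, hn1, h0, hs.players])
        (by intro l; simp [hr2, hr1, r50, hv]) (by simp [hn2, hn1, h62, hi]) (by simp [hv1])
      generalize hs3 : run D G.val firstCmd
        (run D G.val (setR 53 (rv 31)) (run D G.val (setN 53 (nv 62)) s2)) = s3 at hfirst ⊢
      have e55 : s3.nat 55 = s'.nat 55 := by rw [← hs3]; simp [hn2, hn1]
      have e63' : s3.nat 63 0 = j := by rw [← hs3]; simp [hn2, e63]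
      by_cases hF : FirstAt G c i (affordable G.budget (G.units i) (G.budget / ((j + 1 : ℕ) : ℝ)))
      · rw [if_pos hF] at hfirst
        rw [run_ite_pos]
        swap
        · simp [hfirst]
        right
        have hmem : j + 1 ∈ K := ⟨by omega, hle, (isFirst_update_iff c i _).mpr hF⟩
        have e : (run D G.val (setN 55 (.add (nv 63) (.lit 1))) s3).nat 55 0 = j + 1 := by
          simp [e63']
        rw [e]
        exact ⟨by omega, hmem, fun k hk => i2 k hk⟩
      · rw [if_neg hF] at hfirst
        rw [run_ite_neg]
        swap
        · simp [hfirst]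
        left
        refine ⟨by rw [run_skip, e55, i1], fun k hk => ?_⟩
        have h := i2 k hk
        rcases Nat.lt_or_ge (j + 1) k with h' | h'
        · exact h'
        · have : k = j + 1 := by omega
          subst this
          exact absurd ((isFirst_update_iff c i _).mp hk.2.2) hF)
  have hfi : firstIndex G c i = sInf K := rfl
  rw [hfi]
  rcases hloop with ⟨h1, h2⟩ | ⟨_, h2, h3⟩
  -- No index was found, so `K` is empty, and the stored 0 is the default value of `sInf`.
  · rw [h1]
    have : K = ∅ := by
      rw [Set.eq_empty_iff_forall_notMem]
      intro k hk
      have e1 := h2 k hk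
      have e2 := hk.2.1
      have e3 := soloUnits_le G c i
      have e4 := G.units_le_total i
      omega
    rw [this]; simp
  · exact le_antisymm (le_csInf ⟨_, h2⟩ h3) (Nat.sInf_le h2)

/-- The total payment (in the real variable `56`) of the player in the integer variable `62`, given
the smallest index in the integer variable `55`. -/
def payCmd : Cmd :=
  setR 56 (.ofNat (.lit 0)) ;;
  .loop 64 (nv 3)
    (.ite (.nle (.add (nv 64) (.lit 1)) (na 50 62))
      (.ite (.nle (.add (nv 64) (.lit 1)) (nv 55))
        (setR 56 (.add (rv 56) (.div (rv 0) (.ofNat (nv 55)))))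
        (setR 56 (.add (rv 56) (.div (rv 0) (.ofNat (.add (nv 64) (.lit 1)))))))
      .skip)

@[simp] theorem payCmd_natWrites : payCmd.natWrites = [64] := rfl
@[simp] theorem payCmd_realWrites : payCmd.realWrites = [56, 56, 56] := rfl

theorem run_payCmd (D : DemandFn m) {G : Game m} {c : Fin m → ℝ} {s : State} (hs : Ctx G s)
    {i : Fin m} (hu : s.nat 50 i = soloUnits G c i) (hi : s.nat 62 0 = i)
    (hk : s.nat 55 0 = firstIndex G c i) :
    (run D G.val payCmd s).real 56 0 =
      ∑ l ∈ Finset.Icc 1 (soloUnits G c i), unitPay G c i l := by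
  have hle : soloUnits G c i ≤ G.total := (soloUnits_le G c i).trans (G.units_le_total i)
  unfold payCmd
  rw [run_seq]
  rw [← min_eq_right hle]
  refine run_loop_induct D G.val (by simpa using hs.total)
    (fun j s' => s'.real 56 0 = ∑ l ∈ Finset.Icc 1 (min j (soloUnits G c i)), unitPay G c i l)
    (by simp) ?_
  intro j hj s' hn hr hI
  have h50 : s'.nat 50 = s.nat 50 := by rw [hn 50 (by decide)]; simp
  have h55 : s'.nat 55 = s.nat 55 := by rw [hn 55 (by decide)]; simp
  have h62 : s'.nat 62 = s.nat 62 := by rw [hn 62 (by decide)]; simp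
  have r0 : s'.real 0 = s.real 0 := by rw [hr 0 (by decide)]; simp
  by_cases h1 : j + 1 ≤ soloUnits G c i
  · rw [run_ite_pos]
    swap
    · simp [h50, h62, hi, hu, h1]
    rw [min_eq_left (by omega)] at hI
    rw [min_eq_left h1, Finset.sum_Icc_succ_top (by omega), ← hI]
    unfold unitPay
    by_cases h2 : j + 1 ≤ firstIndex G c i
    · rw [run_ite_pos]
      · simp [h55, hk, r0, hs.budget, h2]
      · simp [h55, hk, h2]
    · rw [run_ite_neg]
      · simp [r0, hs.budget, h2]
      · simp [h55, hk, h2]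
  · rw [run_ite_neg]
    swap
    · simp [h50, h62, hi, hu, h1]
    rw [min_eq_right (by omega)] at hI ⊢
    simpa using hI

/-- Buy from the player in the integer variable `62` if he comes first. -/
def buyCmd : Cmd :=
  setN 53 (nv 62) ;; setR 53 (ra 50 62) ;; firstCmd ;;
  .ite (.nle (.lit 1) (nv 54))
    (indexCmd ;; payCmd ;; .setReal 2 (nv 62) (rv 56) ;; .setNat 2 (nv 62) (na 50 62))
    (.setReal 2 (nv 62) (.ofNat (.lit 0)) ;; .setNat 2 (nv 62) (.lit 0))

@[simp] theorem buyCmd_natWrites : buyCmd.natWrites =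
    [53, 54, 61, 54, 55, 63, 30, 31, 32, 31, 33, 34, 35, 35, 53, 54, 61, 54, 55, 64, 2, 2] := rfl
@[simp] theorem buyCmd_realWrites : buyCmd.realWrites =
    [53, 30, 31, 53, 56, 56, 56, 2, 2] := rfl

theorem run_buyCmd (D : DemandFn m) {G : Game m} {c : Fin m → ℝ} {s : State} (hs : Ctx G s)
    (hu : ∀ i : Fin m, s.nat 50 i = soloUnits G c i)
    (hv : ∀ i : Fin m, s.real 50 i = soloVal G c i) {i : Fin m} (hi : s.nat 62 0 = i)
    (j : Fin m) :
    (run D G.val buyCmd s).nat 2 j = (if j = i then (oneMech G c).alloc i else s.nat 2 j) ∧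
      (run D G.val buyCmd s).real 2 j = (if j = i then (oneMech G c).pay i else s.real 2 j) := by
  classical
  unfold buyCmd
  simp only [run_seq]
  have hfirst := run_firstCmd D (G := G) (c := c)
    (s := run D G.val (setR 53 (ra 50 62)) (run D G.val (setN 53 (nv 62)) s)) (i := i)
    (a := soloUnits G c i) (by simp [hs.players]) (by intro l; simp [hv]) (by simp [hi])
    (by simp [hi, hv, soloVal])
  rw [if_congr (isFirst_iff c i).symm rfl rfl] at hfirst
  generalize hs1 : run D G.val firstCmd
    (run D G.val (setR 53 (ra 50 62)) (run D G.val (setN 53 (nv 62)) s)) = s1 at hfirst ⊢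
  have hn1 : ∀ r, r ∉ [53, 54, 61] → s1.nat r = s.nat r := by
    intro r h
    simp only [List.mem_cons, not_or, List.not_mem_nil, not_false_eq_true, and_true] at h
    rw [← hs1]; simp [h]
  have hr1 : ∀ r, r ≠ 53 → s1.real r = s.real r := by
    intro r h; rw [← hs1]; simp [h]
  have hctx1 : Ctx G s1 := by refine hs.of_eq ?_ ?_ ?_ ?_ <;> simp [hn1, hr1]
  by_cases hF : IsFirst G c i
  · rw [if_pos hF] at hfirst
    rw [run_ite_pos]
    swap
    · simp [hfirst]
    simp only [run_seq]
    have hidx := run_indexCmd D hctx1 (c := c) (by intro l; simp [hn1, hu])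
      (by intro l; simp [hr1, hv]) (i := i) (by simp [hn1, hi])
    generalize hs2 : run D G.val indexCmd s1 = s2 at hidx ⊢
    have hn2 : ∀ r, r ∉ indexCmd.natWrites → s2.nat r = s1.nat r := by
      intro r h; rw [← hs2, run_nat_frame _ _ h]
    have hr2 : ∀ r, r ∉ indexCmd.realWrites → s2.real r = s1.real r := by
      intro r h; rw [← hs2, run_real_frame _ _ h]
    have hctx2 : Ctx G s2 := by refine hctx1.of_eq ?_ ?_ ?_ ?_ <;> simp [hn2, hr2]
    have hpay := run_payCmd D hctx2 (c := c) (i := i) (by simp [hn2, hn1, hu])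
      (by simp [hn2, hn1, hi]) hidx
    simp [oneMech, hF, hpay, hn2, hn1, hr2, hr1, hi, hu, Fin.ext_iff]
  · rw [if_neg hF] at hfirst
    rw [run_ite_neg]
    swap
    · simp [hfirst]
    simp [oneMech, hF, hn1, hr1, hi, Fin.ext_iff]

/-- Buy from the first player. -/
def oneCmd : Cmd := soloCmd ;; .loop 62 (nv 0) buyCmd

theorem run_oneCmd (D : DemandFn m) {G : Game m} {c : Fin m → ℝ} {s : State} (hs : Ctx G s)
    (hc : ∀ i : Fin m, s.real 1 i = c i) :
    output m (run D G.val oneCmd s) = oneMech G c := by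
  unfold oneCmd
  rw [run_seq]
  obtain ⟨hu, hv⟩ := run_soloCmd D hs hc
  generalize hs1 : run D G.val soloCmd s = s1 at hu hv ⊢
  have hctx1 : Ctx G s1 := by
    refine hs.of_eq ?_ ?_ ?_ ?_ <;> rw [← hs1] <;> simp
  have key : ∀ (i : Fin m) (s' : State),
      (∀ r, r ∉ 62 :: buyCmd.natWrites → s'.nat r = s1.nat r) →
      (∀ r, r ∉ buyCmd.realWrites → s'.real r = s1.real r) → ∀ j : Fin m,
      (run D G.val buyCmd (s'.setNat 62 0 i)).nat 2 j =
        (if j = i then (oneMech G c).alloc i else s'.nat 2 j) ∧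
      (run D G.val buyCmd (s'.setNat 62 0 i)).real 2 j =
        (if j = i then (oneMech G c).pay i else s'.real 2 j) := by
    intro i s' hn hr j
    have hctx : Ctx G (s'.setNat 62 0 i) := by
      refine hctx1.of_eq ?_ ?_ ?_ ?_
      · rw [← hn 0 (by decide)]; simp
      · rw [← hn 1 (by decide)]; simp
      · rw [← hn 3 (by decide)]; simp
      · rw [← hr 0 (by decide)]; simp
    have h50 : s'.nat 50 = s1.nat 50 := hn 50 (by decide)
    have r50 : s'.real 50 = s1.real 50 := hr 50 (by decide)
    have := run_buyCmd D hctx (c := c) (by intro l; simp [h50, hu]) (by intro l; simp [r50, hv])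
      (i := i) (by simp) j
    simpa using this
  have h1 := run_fill_nat D G.val (a := 62) (b := 2) (body := buyCmd) hctx1.players
    (fun i => (oneMech G c).alloc i) (fun i s' hn hr j => (key i s' hn hr j).1)
  have h2 := run_fill_real D G.val (a := 62) (b := 2) (body := buyCmd) hctx1.players
    (fun i => (oneMech G c).pay i) (fun i s' hn hr j => (key i s' hn hr j).2)
  unfold output
  rw [funext h1, funext h2]

/-! ## Coin flips -/

/-- Membership of the player with index `i`, as a bit. -/
def bit (T : Finset (Fin m)) (i : ℕ) : Bool := decide (∃ l ∈ T, (l : ℕ) = i)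

@[simp] theorem bit_val (T : Finset (Fin m)) (l : Fin m) : bit T l = decide (l ∈ T) := by
  unfold bit
  refine decide_eq_decide.mpr ⟨?_, fun h => ⟨l, h, rfl⟩⟩
  rintro ⟨l', h, e⟩
  rwa [← Fin.ext e]

/-- `T` with or without `l`. -/
def putBit (T : Finset (Fin m)) (l : Fin m) (b : Bool) : Finset (Fin m) :=
  if b then insert l T else T.erase l

theorem mem_putBit {T : Finset (Fin m)} {l l' : Fin m} {b : Bool} :
    l' ∈ putBit T l b ↔ if l' = l then b = true else l' ∈ T := by
  unfold putBit
  cases b <;> by_cases h : l' = l <;> simp [h]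

theorem bit_putBit (T : Finset (Fin m)) (l : Fin m) (b : Bool) (i : ℕ) :
    bit (putBit T l b) i = if i = l then b else bit T i := by
  by_cases hi : i < m
  · have := bit_val (putBit T l b) ⟨i, hi⟩
    simp only at this
    rw [this]
    have h2 := bit_val T ⟨i, hi⟩
    simp only at h2
    rw [h2]
    by_cases h : i = l
    · have h' : (⟨i, hi⟩ : Fin m) = l := Fin.ext h
      simp [mem_putBit, h]
    · have h' : (⟨i, hi⟩ : Fin m) ≠ l := fun e => h (by rw [← e])
      simp [mem_putBit, h, h']
  · have h : i ≠ l := by have := l.2; omega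
    have hb : ∀ S : Finset (Fin m), bit S i = false := by
      intro S
      unfold bit
      rw [decide_eq_false_iff_not]
      rintro ⟨l', _, e⟩
      have := l'.2
      omega
    rw [if_neg h, hb, hb]

/-- For a given result the bit is forced, and exactly two sets lead to it. With weight 1/2 each,
this preserves the uniform distribution. -/
theorem eq_putBit_iff {S T : Finset (Fin m)} {l : Fin m} {b : Bool} :
    S = putBit T l b ↔ b = decide (l ∈ S) ∧ T ∈ ({insert l S, S.erase l} : Finset _) := by
  constructor
  · intro h
    constructor
    · rw [h]; cases b <;> simp [mem_putBit]
    · by_cases hT : l ∈ T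
      · have : T = insert l S := by
          ext x; by_cases hx : x = l <;> simp [h, mem_putBit, hx, hT]
        simp [← this]
      · have : T = S.erase l := by
          ext x; by_cases hx : x = l <;> simp [h, mem_putBit, hx, hT]
        simp [← this]
  · rintro ⟨rfl, h⟩
    simp only [Finset.mem_insert, Finset.mem_singleton] at h
    ext x
    by_cases hx : x = l
    · simp [mem_putBit, hx]
    · rcases h with rfl | rfl <;> simp [mem_putBit, hx]

/-- Flipping anew whether `l` belongs to a uniformly random set of players does not change the
distribution. -/
theorem uniform_bind_putBit (l : Fin m) :
    (PMF.uniformOfFintype (Finset (Fin m))).bind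
        (fun T => (coin (1 / 2)).map (putBit T l)) =
      PMF.uniformOfFintype (Finset (Fin m)) := by
  classical
  ext S
  simp only [PMF.bind_apply, PMF.uniformOfFintype_apply, PMF.map_apply, tsum_fintype, coin_half]
  rw [← Finset.mul_sum]
  have hne : insert l S ≠ S.erase l := by
    intro h
    have : l ∈ S.erase l := h ▸ Finset.mem_insert_self l S
    simp at this
  have : ∀ T : Finset (Fin m), ∑ b : Bool, (if S = putBit T l b then (2⁻¹ : ENNReal) else 0) =
      if T ∈ ({insert l S, S.erase l} : Finset _) then 2⁻¹ else 0 := by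
    intro T
    simp only [eq_putBit_iff]
    split_ifs with h <;> simp [h]
  simp only [this]
  rw [← Finset.sum_filter, Finset.filter_mem_eq_inter, Finset.univ_inter, Finset.sum_pair hne,
    ENNReal.inv_two_add_inv_two, mul_one]

/-- Independent fair coin flips, one for each of the first `j` players, draw a uniformly random set
of players. -/
theorem repeatFor_coin (g : ℕ → Bool → State → State) (s : State) (j : ℕ) (hj : j ≤ m) :
    repeatFor (fun i s' => (coin (1 / 2)).map (fun b => g i b s')) j s =
      (PMF.uniformOfFintype (Finset (Fin m))).map
        (fun T => runFor (fun i s' => g i (bit T i) s') j s) := by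
  induction j with
  | zero => exact (PMF.map_const _ _).symm
  | succ j ih =>
    -- The first `j` rounds do not look at bit `j`, so that bit can be redrawn by the next coin.
    have hrun : ∀ (T : Finset (Fin m)) (b : Bool), ∀ i ≤ j,
        runFor (fun i s' => g i (bit (putBit T ⟨j, hj⟩ b) i) s') i s =
          runFor (fun i s' => g i (bit T i) s') i s := by
      intro T b i
      induction i with
      | zero => exact fun _ => rfl
      | succ i ih =>
        intro hi
        simp only [runFor]
        rw [ih (by omega), bit_putBit, if_neg (by simp; omega)]
    rw [← uniform_bind_putBit ⟨j, hj⟩, repeatFor, ih (by omega), PMF.bind_map, PMF.map_bind]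
    congr 1
    funext T
    rw [PMF.map_comp]
    simp only [Function.comp_def]
    congr 1
    funext b
    simp only [runFor]
    rw [hrun T b j le_rfl, bit_putBit, if_pos rfl]

/-! ## The program -/

/-- A probability of one half. -/
abbrev halfExp : RExp := .div (.ofNat (.lit 1)) (.ofNat (.lit 2))

/-- Compute the total number of units. -/
def totalCmd : Cmd :=
  setN 3 (.lit 0) ;; .loop 8 (nv 0) (setN 3 (.add (nv 3) (na 1 8)))

/-- Flip all coins. -/
def coinsCmd : Cmd :=
  .flip 4 (.lit 0) halfExp ;;
  .flip 5 (.lit 0) (.div (.ofNat (.lit 1)) (.add (.ofNat (.lit 1)) (.ln (.ofNat (nv 3))))) ;;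
  .loop 7 (nv 0) (.flip 6 (nv 7) halfExp)

/-- Run the mechanism chosen by the coins. -/
def choiceCmd : Cmd :=
  .ite (.nle (.lit 1) (nv 4)) randCmd (.ite (.nle (.lit 1) (nv 5)) oneCmd .skip)

/-- The program of the mechanism. -/
def subCmd : Cmd := totalCmd ;; coinsCmd ;; choiceCmd

theorem run_totalCmd (D : DemandFn m) (G : Game m) (c : Fin m → ℝ) :
    Ctx G (run D G.val totalCmd (input G c)) ∧
      (∀ i : Fin m, (run D G.val totalCmd (input G c)).real 1 i = c i) ∧
      output m (run D G.val totalCmd (input G c)) = ⟨0, 0⟩ := by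
  have hn : ∀ r, r ∉ totalCmd.natWrites →
      (run D G.val totalCmd (input G c)).nat r = (input G c).nat r :=
    fun r h => run_nat_frame D G.val h _
  have hr : ∀ r, (run D G.val totalCmd (input G c)).real r = (input G c).real r :=
    fun r => run_real_frame D G.val (by simp [totalCmd]) _
  have htotal : (run D G.val totalCmd (input G c)).nat 3 0 = G.total := by
    unfold totalCmd
    rw [run_seq]
    have := run_players D G.val (a := 8) (body := setN 3 (.add (nv 3) (na 1 8)))
      (s := run D G.val (setN 3 (.lit 0)) (input G c)) (by simp [input])
      (fun j s' => s'.nat 3 0 = ∑ i : Fin m, if (i : ℕ) < j then G.units i else 0) (by simp) (by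
        intro i s' hn hr hI
        have h1 : s'.nat 1 = (input G c).nat 1 := by rw [hn 1 (by simp)]; simp
        have h2 : ∀ l : Fin m, (if (l : ℕ) < i + 1 then G.units l else 0) =
            (if (l : ℕ) < i then G.units l else 0) + if l = i then G.units l else 0 := by
          intro l
          rcases lt_trichotomy l i with h | h | h
          · have h' : (l : ℕ) < i := h
            simp [h', h.ne, Nat.lt_succ_of_lt h']
          · simp [h]
          · have h' : (i : ℕ) < l := h
            rw [if_neg (by omega), if_neg (by omega), if_neg h.ne']
        simp only [h2, Finset.sum_add_distrib]
        simp [hI, h1, input])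
    rw [this]
    simp [Game.total]
  refine ⟨⟨?_, htotal, ?_, ?_⟩, ?_, ?_⟩
  · rw [hn 0 (by decide)]; simp [input]
  · intro i; rw [hn 1 (by decide)]; simp [input]
  · rw [hr 0]; simp [input]
  · intro i; rw [hr 1]; simp [input]
  · unfold output
    rw [hn 2 (by decide), hr 2]
    simp [input]; exact ⟨rfl, rfl⟩

/-- All coins are flipped in advance, even those the chosen branch ignores, so the rest of the
program is deterministic. -/
theorem exec_coinsCmd (D : DemandFn m) {G : Game m} {s : State} (hs : Ctx G s) :
    ∃ h : Bool → Bool → Finset (Fin m) → State,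
      exec D G.val coinsCmd s = (coin (1 / 2)).bind (fun b₁ =>
        (coin (1 / (1 + Real.log G.total))).bind (fun b₂ =>
          (PMF.uniformOfFintype (Finset (Fin m))).map (h b₁ b₂))) ∧
      ∀ b₁ b₂ T, (h b₁ b₂ T).nat 4 0 = (if b₁ then 1 else 0) ∧
        (h b₁ b₂ T).nat 5 0 = (if b₂ then 1 else 0) ∧ memSet m ((h b₁ b₂ T).nat 6) = T ∧
        (∀ r, r ∉ [4, 5, 6, 7] → (h b₁ b₂ T).nat r = s.nat r) ∧ (h b₁ b₂ T).real = s.real := by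
  -- The numbers of ticks here and in `s₂` are the exact costs of the commands, so that the states
  -- agree definitionally.
  set g : ℕ → Bool → State → State := fun i b s' =>
    (((s'.setNat 7 0 i).tick 1).setNat 6 i (if b then 1 else 0)).tick 8 with hg
  have hrun : ∀ (T : Finset (Fin m)) (s : State) (j : ℕ),
      (∀ i < j, (runFor (fun i s' => g i (bit T i) s') j s).nat 6 i = if bit T i then 1 else 0) ∧
      (∀ r, r ∉ [6, 7] → (runFor (fun i s' => g i (bit T i) s') j s).nat r = s.nat r) ∧
      (runFor (fun i s' => g i (bit T i) s') j s).real = s.real := by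
    intro T s j
    induction j with
    | zero => exact ⟨fun i hi => absurd hi (by omega), fun _ _ => rfl, rfl⟩
    | succ j ih =>
      obtain ⟨h1, h2, h3⟩ := ih
      refine ⟨fun i hi => ?_, fun r hr => ?_, ?_⟩
      · simp only [runFor, hg, State.tick_nat, State.setNat_nat]
        by_cases hij : i = j
        · simp [hij]
        · simp only [hij, and_false, if_false]
          rw [if_neg (by norm_num)]
          exact h1 i (by omega)
      · simp only [List.mem_cons, not_or, List.not_mem_nil, not_false_eq_true, and_true] at hr
        rw [← h2 r (by simp [hr])]
        simp [runFor, hg, hr]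
      · rw [← h3]; rfl
  set s₂ : Bool → Bool → State := fun b₁ b₂ =>
    (((((s.setNat 4 0 (if b₁ then 1 else 0)).tick 7).setNat 5 0 (if b₂ then 1 else 0)).tick
      12).tick 3) with hs₂
  refine ⟨fun b₁ b₂ T => runFor (fun i s' => g i (bit T i) s') m (s₂ b₁ b₂), ?_, ?_⟩
  · have hloop : ∀ s' : State, s'.nat 0 0 = m →
        exec D G.val (.loop 7 (nv 0) (.flip 6 (nv 7) halfExp)) s' =
        repeatFor (fun i s' => (coin (1 / 2)).map (fun b => g i b s')) m (s'.tick 3) := by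
      intro s' h
      simp only [exec]
      have : NExp.eval s' (nv 0) = m := by simpa using h
      rw [this]
      congr 1
      funext i s'
      have e : RExp.eval ((s'.setNat 7 0 i).tick 1) halfExp = 1 / 2 := by simp
      rw [e]
      rfl
    simp only [coinsCmd, exec.eq_4, exec.eq_7, PMF.bind_map, Function.comp_def]
    have e₁ : RExp.eval s halfExp = 1 / 2 := by simp
    rw [e₁]
    congr 1
    funext b₁
    have e₂ : RExp.eval ((s.setNat 4 0 (if b₁ then 1 else 0)).tick 7)
        (.div (.ofNat (.lit 1)) (.add (.ofNat (.lit 1)) (.ln (.ofNat (nv 3))))) =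
        1 / (1 + Real.log G.total) := by simp [hs.total]
    refine (congrArg (fun p => (coin p).bind _) e₂).trans ?_
    congr 1
    funext b₂
    rw [hloop _ (by simp [hs.players])]
    exact repeatFor_coin g _ m le_rfl
  · intro b₁ b₂ T
    obtain ⟨h1, h2, h3⟩ := hrun T (s₂ b₁ b₂) m
    refine ⟨?_, ?_, ?_, ?_, ?_⟩
    · rw [h2 4 (by decide)]; simp [hs₂]
    · rw [h2 5 (by decide)]; simp [hs₂]
    · ext l
      rw [mem_memSet, h1 l l.2, bit_val]
      simp
    · intro r hr
      simp only [List.mem_cons, not_or, List.not_mem_nil, not_false_eq_true, and_true] at hr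
      rw [h2 r (by simp [hr])]
      simp [hs₂, hr]
    · rw [h3]; rfl

theorem run_choiceCmd (D : DemandFn m) {G : Game m} {c : Fin m → ℝ} {s : State} (hs : Ctx G s)
    (hc : ∀ i : Fin m, s.real 1 i = c i) (hout : output m s = ⟨0, 0⟩) {b₁ b₂ : Bool}
    (h₁ : s.nat 4 0 = if b₁ then 1 else 0) (h₂ : s.nat 5 0 = if b₂ then 1 else 0) :
    output m (run D G.val choiceCmd s) =
      if b₁ then randMech G D (memSet m (s.nat 6)) c else
        (if b₂ then oneMech G else nullMech) c := by
  unfold choiceCmd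
  cases b₁
  · rw [run_ite_neg _ _ (by simp [h₁])]
    cases b₂
    · rw [run_ite_neg _ _ (by simp [h₂]), run_skip, hout]
      rfl
    · rw [run_ite_pos _ _ (by simp [h₂]), run_oneCmd D hs hc]
      rfl
  · rw [run_ite_pos _ _ (by simp [h₁]), run_randCmd D hs hc hout]
    rfl

theorem map_output_subCmd (D : DemandFn m) (G : Game m) (c : Fin m → ℝ) :
    (exec D G.val subCmd (input G c)).map (output m) = (mSub G D).map (fun M => M c) := by
  obtain ⟨hctx, hc, hout⟩ := run_totalCmd D G c
  obtain ⟨t, ht⟩ := exec_eq_run D G.val (c := totalCmd) rfl (input G c)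
  generalize run D G.val totalCmd (input G c) = s at *
  have hctx' : Ctx G (s.tick t) := hctx.of_eq rfl rfl rfl rfl
  obtain ⟨h, hexec, hh⟩ := exec_coinsCmd D hctx'
  have hchoice : ∀ b₁ b₂ T, (exec D G.val choiceCmd (h b₁ b₂ T)).map (output m) =
      PMF.pure (if b₁ then randMech G D T c else (if b₂ then oneMech G else nullMech) c) := by
    intro b₁ b₂ T
    obtain ⟨h4, h5, h6, hn, hr⟩ := hh b₁ b₂ T
    obtain ⟨u, hu⟩ := exec_eq_run D G.val (c := choiceCmd) rfl (h b₁ b₂ T)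
    have := run_choiceCmd D (s := h b₁ b₂ T) (c := c)
      (hctx'.of_eq (hn 0 (by decide)) (hn 1 (by decide)) (hn 3 (by decide)) (by rw [hr]))
      (by rw [hr]; exact hc)
      (by rw [← hout]; unfold output; rw [hn 2 (by decide), hr]; rfl) h4 h5
    rw [h6] at this
    rw [hu, PMF.pure_map, ← this]
    rfl
  have e : exec D G.val subCmd (input G c) =
      (exec D G.val coinsCmd (s.tick t)).bind (exec D G.val choiceCmd) := by
    simp only [subCmd, exec, ht, PMF.pure_bind]
  rw [e, hexec, mSub]
  simp only [PMF.bind_bind, PMF.map_bind, PMF.bind_map, Function.comp_def, hchoice]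
  congr 1
  funext b₁
  cases b₁
  -- `PMF.bind_const` integrates out the coins that this branch ignores.
  · simp only [Bool.false_eq_true, if_false, PMF.bind_const, mOne, PMF.map_comp, Function.comp_def]
    rfl
  · simp only [if_true, PMF.bind_const, mRand, PMF.map_comp, Function.comp_def]
    rfl

/-- `totalCmd` writes array 3, which bounds later loops, so the time bound is applied separately
before and after this array becomes fixed. -/
theorem time_subCmd (D : DemandFn m) (G : Game m) (c : Fin m → ℝ) :
    ∀ s ∈ (exec D G.val subCmd (input G c)).support, s.time ≤ subCmd.cost.eval (m + G.total) := by
  intro s hmem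
  obtain ⟨hctx, -, -⟩ := run_totalCmd D G c
  obtain ⟨t, ht⟩ := exec_eq_run D G.val (c := totalCmd) rfl (input G c)
  have e : exec D G.val subCmd (input G c) = (exec D G.val totalCmd (input G c)).bind
      (exec D G.val (coinsCmd ;; choiceCmd)) := rfl
  rw [e, PMF.mem_support_bind_iff] at hmem
  obtain ⟨s', hs', hmem⟩ := hmem
  have h1 := exec_time_le D G.val (R := [0]) (K := m + G.total) (by omega) (c := totalCmd)
    (by simp [totalCmd, Cmd.Bounded, NExp.isBound]) (by decide) (input G c) (by simp [input]) s' hs'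
  have hs'' : s' = (run D G.val totalCmd (input G c)).tick t := by
    rw [ht, PMF.mem_support_pure_iff] at hs'
    exact hs'
  have h2 := exec_time_le D G.val (R := [0, 3]) (K := m + G.total) (by omega)
    (c := coinsCmd ;; choiceCmd)
    (by simp [coinsCmd, choiceCmd, randCmd, oneCmd, aMaxCmd, roundCmd, soloCmd, buyCmd, affordCmd,
      singleCmd, unitsCmd, bestCmd, prefixSumCmd, prefixCmd, guessCmd, firstCmd, indexStepCmd,
      indexCmd, payCmd, Cmd.Bounded, NExp.isBound]) (by decide) s'
    (by simp [hs'', hctx.players, hctx.total]) s hmem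
  have h0 : (input G c).time = 0 := rfl
  have : subCmd.cost.eval (m + G.total) = totalCmd.cost.eval (m + G.total) +
      (coinsCmd ;; choiceCmd).cost.eval (m + G.total) := by
    rw [← Polynomial.eval_add]; rfl
  omega

end Machine
end Procurement

end

theorem theorem4 :
    (∃ C : ℝ, 0 < C ∧
      ∀ (m : ℕ) (G : Procurement.Game m) (D : Procurement.DemandFn m),
        G.Proper → Procurement.IsDemandOracle G D →
        (G.SubAdditive ∨ G.DiminishingReturn ∨ G.SubModular ∨ G.Additive) →
          (Procurement.mSub G D).WellFormed G ∧
          (Procurement.mSub G D).UniversallyTruthful ∧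
          (Procurement.mSub G D).IndividuallyRational ∧
          (Procurement.mSub G D).BudgetFeasible G ∧
          (3 ≤ G.total →
            (Procurement.mSub G D).Approximates G
              (C * (Real.logb 2 G.total ^ 2 / Real.logb 2 (Real.logb 2 G.total))))) ∧
    (∃ (P : Procurement.Machine.Cmd) (q : Polynomial ℕ),
      ∀ (m : ℕ) (G : Procurement.Game m) (D : Procurement.DemandFn m),
        G.Proper → Procurement.IsDemandOracle G D →
        (G.SubAdditive ∨ G.DiminishingReturn ∨ G.SubModular ∨ G.Additive) →
        ∀ c : Fin m → ℝ, (∀ i, 0 ≤ c i) →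
          Procurement.Machine.Implements P G D (Procurement.mSub G D) c
            (q.eval (m + G.total))) := by
  refine ⟨⟨40000, by norm_num, fun m G D hG hD h => ?_⟩,
    Procurement.Machine.subCmd, Procurement.Machine.subCmd.cost, fun m G D _ _ _ c _ =>
      ⟨Procurement.Machine.map_output_subCmd D G c, Procurement.Machine.time_subCmd D G c⟩⟩
  have hS := Procurement.Game.subAdditive_of_class hG h
  exact ⟨Procurement.mSub_wellFormed hG hD, Procurement.mSub_universallyTruthful hG hD,
    Procurement.mSub_individuallyRational hG hD, Procurement.mSub_budgetFeasible hG D,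
    fun hn => Procurement.mSub_approximates hG hS hD hn⟩
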